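/- **Setting.** Let $n,k\ge 0$ and let $H=\bigl(\frac{S_k}{z^k}+\cdots+\frac{S_1}{z}+S_0+N_0\bigr)\frac{dz}{z}$ be an unramified Hukuhara–Turrittin–Levelt normal form: $S_i=\mathrm{diag}(s_i(1),\dots,s_i(n))$ complex diagonal, $N_0$ nilpotent and commuting with all $S_i$. For $1\le i\le k+1$ say that $a,b\in\{1,\dots,n\}$ lie in the same block of level $i$ if $s_l(a)=s_l(b)$ for all $l\ge i$ (one block for $i=k+1$). Fix total orders on the blocks of each level $1\le i\le k$ such that the refinement maps from level $i$ to level $i+1$ are monotone. Let $\mathfrak l_{\mathbf m_i}\subset M_n(\mathbb C)$ be the block diagonal matrices of level $i$ and $L_{\mathbf m_i}$ its group of units. Let $\mathfrak n^-_l:=\mathfrak n^-_{\mathbf m_l^{l+1}}$ be the space of the matrices supported at positions $(a,b)$ with $a,b$ in the same block of level $l+1$ and the level-$l$ block of $a$ strictly before that of $b$; let $\mathfrak n^+_l:=\mathfrak n^+_{\mathbf m_l^{l+1}}$ be the space with the transposed support. *The parameter space.* $\mathbb D(H)\subset\mathbb C^{k+1}$ is the set of $\mathbf c=(c_0,\dots,c_k)$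 such that for all $0\le i<k$ and all $a,b$ for which some $l\ge i$ has $s_l(a)\ne s_l(b)$, $$\sum_{i\le l\le e}(s_l(a)-s_l(b))\prod_{l<\nu\le e}(c_i-c_\nu)\neq 0,\qquad e:=\max\{l: s_l(a)\ne s_l(b)\}.$$ *The deformation.* Put $R_l(\mathbf c)=\mathbb C[z]/\prod_{i<l}(z-c_i)$. A matrix $W$ of rational functions whose entries have poles bounded by $c_0+\cdots+c_{l-1}$ is regarded as the functional $Z\mapsto-\mathrm{tr}\,\mathrm{res}_{z=\infty}(ZW\,dz)$ on $M_n(R_l(\mathbf c))$. The deformation $(\mathbb O_{H_{\mathrm{irr}}})_{\mathbb D(H)}$ is the bundle $\theta$ over $\mathbb D(H)$ whose fibre at $\mathbf c$ is $\prod_{l=2}^kT^*N_l(\mathbf c)$, where $N_l(\mathbf c)$ is the group of matrices $n_l=1+\sum_{i=1}^{l-1}x_i\prod_{j<i}(z-c_j)$ over $R_l(\mathbf c)$ with $x_i\in\mathfrak n^-_l$. In the right trivialization $(n_l,\xi)\mapsto R^*_{n_l^{-1}}\xi$ its points over $\mathbf c$ are the families $(n_l,X_l)_{2\le l\le k}$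 with $n_l\in N_l(\mathbf c)$ and $X_l=\sum_{i=1}^{l-1}\frac{\xi_i}{(z-c_0)\cdots(z-c_i)}dz$, $\xi_i\in\mathfrak n^+_l$, representing an element of the dual of the Lie algebra of $N_l(\mathbf c)$. The group $L_{\mathbf m_1}$ acts on it by conjugation of the $n_l$, that is $h\cdot(n_l,X_l)=(hn_lh^{-1},hX_lh^{-1})$. Define $$\mathrm{res}_{\mathfrak l_{\mathbf m_1}}(n_l,X_l)_l:=\Bigl(\sum_{l=2}^k-\mathrm{res}_{z=\infty}\mathrm{Ad}^*(n_l^{-1})(X_l)\Bigr)\Big|_{\mathfrak l_{\mathbf m_1}},\quad\text{i.e.}\quad Y\mapsto\sum_{l=2}^k-\mathrm{tr}\,\mathrm{res}_{z=\infty}(n_lYn_l^{-1}X_l),$$ where $(\mathrm{Ad}^*(g)\eta)(Z)=\eta(g^{-1}Zg)$. *The orbit and its residue map.* Write $\mathbb C[z]_k=\mathbb C[z]/(z^{k+1})$, let $G=\mathrm{GL}_n(\mathbb C[z]_k)^1$ be the group of $g$ with $g(0)=1$, and $\mathfrak g=\mathfrak{gl}_n(\mathbb C[z]_k)^1$ its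 Lie algebra $\{V: V(0)=0\}$. Let $H_{\mathrm{irr}}\in\mathfrak g^*$, $V\mapsto\mathrm{res}_{z=0}\mathrm{tr}(VH)$, let $\mathbb O_{H_{\mathrm{irr}}}$ be its coadjoint $G$-orbit, and $\mathrm{GL}_n(\mathbb C)_{H_{\mathrm{irr}}}$ its stabilizer in $\mathrm{GL}_n(\mathbb C)$, with Lie algebra $\mathfrak{gl}_n(\mathbb C)_{H_{\mathrm{irr}}}$. For $\alpha\in T_g^*G$ put $\mu(\alpha)=L_g^*\alpha$, $\nu(\alpha)=R_g^*\alpha$, and let $\mu^0(\alpha)\in\mathfrak{gl}_n(\mathbb C)_{H_{\mathrm{irr}}}^*$ be the restriction of $L_g^*\pi_1^*\alpha$, where $\pi_1\colon\mathrm{GL}_n(\mathbb C[z]_k)\to G$, $g\mapsto g(0)^{-1}g$. Then $\nu$ maps $\mu^{-1}(H_{\mathrm{irr}})$ onto $\mathbb O_{H_{\mathrm{irr}}}$, and Boalch's residue map $\mathrm{res}_{\mathbb O_{H_{\mathrm{irr}}}}\colon\mathbb O_{H_{\mathrm{irr}}}\to\mathfrak{gl}_n(\mathbb C)_{H_{\mathrm{irr}}}^*$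 is the map with $\mathrm{res}_{\mathbb O_{H_{\mathrm{irr}}}}(\nu(\alpha))=\mu^0(\alpha)$ for $\mu(\alpha)=H_{\mathrm{irr}}$. *The central fibre.* Let $\iota_l\colon N_l(0)\to G$ be the section that keeps the coefficients of powers of $z$ and let $\pi_l\colon G\to N_l(0)$ be truncation modulo $z^l$ followed by the projection along the LU decomposition. For $\alpha_l\in T^*_{n_l}N_l(0)$, $2\le l\le k$, put $\theta^{[i;j]}=\iota_j(n_j)\cdots\iota_i(n_i)$ ($=1$ if $i>j$) and $$F((\alpha_l)_l)=L^*_{(\theta^{[2;k]})^{-1}}H_{\mathrm{irr}}+\sum_{l=2}^kL^*_{(\theta^{[l+1;k]})^{-1}}R^*_{(\theta^{[2;l-1]})^{-1}}\pi_l^*\alpha_l\in T^*_{\theta^{[2;k]}}G,$$ the pull-back $\pi_l^*$ being taken at $\iota_l(n_l)$. **Proposition.** 1. $L_{\mathbf m_1}=\mathrm{GL}_n(\mathbb C)_{H_{\mathrm{irr}}}$ and $\mathfrak l_{\mathbf m_1}=\mathfrak{gl}_n(\mathbb C)_{H_{\mathrm{irr}}}$, and the map $\mathrm{res}_{\mathfrak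 l_{\mathbf m_1}}\colon(\mathbb O_{H_{\mathrm{irr}}})_{\mathbb D(H)}\to\mathfrak l_{\mathbf m_1}^*$ is equivariant for the action of $L_{\mathbf m_1}$ and its coadjoint action. 2. The map $\nu\circ F$ is a bijection $\theta^{-1}(0)=\prod_{l=2}^kT^*N_l(0)\to\mathbb O_{H_{\mathrm{irr}}}$, and under this identification $\mathrm{res}_{\mathfrak l_{\mathbf m_1}}|_{\theta^{-1}(0)}=\mathrm{res}_{\mathbb O_{H_{\mathrm{irr}}}}$. -/

import Mathlib

noncomputable section

namespace Unfolding

open Polynomial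

/-! ## Normal forms, block decompositions, and the parameter space -/

/-- An unramified Hukuhara-Turrittin-Levelt normal form
`(S_k / z^k + ... + S_1 / z + S_0 + N_0) dz / z` of rank `n`, where `S_i = diag (s i)`. -/
structure HTL (n k : ℕ) where
  s : Fin (k + 1) → Fin n → ℂ
  N₀ : Matrix (Fin n) (Fin n) ℂ
  nilpotent : IsNilpotent N₀
  commute : ∀ i, Commute (Matrix.diagonal (s i)) N₀

variable {n k : ℕ}

/-- The coefficient of `dz` in the normal form, as a matrix of rational functions. -/
def HTL.form (H : HTL n k) : Matrix (Fin n) (Fin n) (RatFunc ℂ) :=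
  (∑ i : Fin (k + 1), (Matrix.diagonal (H.s i)).map fun a =>
      RatFunc.C a * (RatFunc.X ^ ((i : ℕ) + 1))⁻¹) +
    H.N₀.map fun a => RatFunc.C a * RatFunc.X⁻¹

/-- `e_a` and `e_b` lie in the same simultaneous eigenspace of `(S_i, ..., S_k)`.
For `i = k + 1` this holds for all `a`, `b`: there is a single block. -/
def HTL.SameBlock (H : HTL n k) (i : ℕ) (a b : Fin n) : Prop :=
  ∀ l : Fin (k + 1), i ≤ (l : ℕ) → H.s l a = H.s l b

lemma HTL.SameBlock.trans {H : HTL n k} {i : ℕ} {a b c : Fin n}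
    (h : H.SameBlock i a b) (h' : H.SameBlock i b c) : H.SameBlock i a c :=
  fun l hl => (h l hl).trans (h' l hl)

lemma HTL.SameBlock.symm {H : HTL n k} {i : ℕ} {a b : Fin n}
    (h : H.SameBlock i a b) : H.SameBlock i b a := fun l hl => (h l hl).symm

lemma HTL.SameBlock.mono {H : HTL n k} {i j : ℕ} (hij : i ≤ j) {a b : Fin n}
    (h : H.SameBlock i a b) : H.SameBlock j a b := fun l hl => h l (hij.trans hl)

/-- An ordering of the sequence of compositions `m_1 ≤ ... ≤ m_k`: a total order on the blocks
of each level `i = 1, ..., k`, given by an injective numbering of the blocks, such that the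
refinement maps from level `i` to level `i + 1` are monotone. -/
structure HTL.BlockOrdering (H : HTL n k) where
  rank : ℕ → Fin n → ℕ
  rank_eq_iff : ∀ i, 1 ≤ i → i ≤ k → ∀ a b, rank i a = rank i b ↔ H.SameBlock i a b
  monotone : ∀ i, 1 ≤ i → i < k → ∀ a b, rank i a ≤ rank i b → rank (i + 1) a ≤ rank (i + 1) b

/-- The block diagonal algebra `𝔩_{m_i}`, with `𝔩_{m_{k+1}} = 𝔤𝔩_n`. -/
def HTL.levi (H : HTL n k) (i : ℕ) : Subalgebra ℂ (Matrix (Fin n) (Fin n) ℂ) where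
  carrier := {Y | ∀ a b, ¬ H.SameBlock i a b → Y a b = 0}
  mul_mem' := by
    intro Y Z hY hZ a b hab
    rw [Matrix.mul_apply]
    refine Finset.sum_eq_zero fun c _ => ?_
    by_cases h : H.SameBlock i a c
    · rw [hZ c b fun h' => hab (h.trans h'), mul_zero]
    · rw [hY a c h, zero_mul]
  add_mem' := by
    intro Y Z hY hZ a b hab
    rw [Matrix.add_apply, hY a b hab, hZ a b hab, add_zero]
  algebraMap_mem' := by
    intro r a b hab
    rw [Matrix.algebraMap_matrix_apply, if_neg]
    rintro rfl
    exact hab fun _ _ => rfl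

lemma HTL.levi_mono (H : HTL n k) {i j : ℕ} (hij : i ≤ j) : H.levi i ≤ H.levi j :=
  fun _ hY a b hab => hY a b fun h => hab (h.mono hij)

/-- The block diagonal group `L_{m_i}`: units of `M_n(ℂ)` that lie, with their inverse,
in `𝔩_{m_i}`. -/
def HTL.leviGroup (H : HTL n k) (i : ℕ) : Subgroup (GL (Fin n) ℂ) :=
  (H.levi i).toSubmonoid.units

/-- Matrix positions of `𝔫^-_{m_l^{l+1}} = 𝔩_{m_{l+1}} ∩ 𝔫^-_{m_l}`: the entry `(a, b)` maps the
block of `b` to the block of `a`, and the block of `b` comes strictly after that of `a`. -/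
def HTL.BlockOrdering.NegPos {H : HTL n k} (O : H.BlockOrdering) (l : ℕ) (a b : Fin n) : Prop :=
  H.SameBlock (l + 1) a b ∧ O.rank l a < O.rank l b

/-- `𝔫^-_{m_l^{l+1}}`. -/
def HTL.BlockOrdering.nMinus {H : HTL n k} (O : H.BlockOrdering) (l : ℕ) :
    Submodule ℂ (Matrix (Fin n) (Fin n) ℂ) where
  carrier := {Y | ∀ a b, ¬ O.NegPos l a b → Y a b = 0}
  add_mem' := by
    intro Y Z hY hZ a b hab
    rw [Matrix.add_apply, hY a b hab, hZ a b hab, add_zero]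
  zero_mem' := fun _ _ _ => rfl
  smul_mem' := by
    intro r Y hY a b hab
    rw [Matrix.smul_apply, hY a b hab, smul_zero]

/-- `𝔫^+_{m_l^{l+1}} = 𝔩_{m_{l+1}} ∩ 𝔫^+_{m_l}`, supported on the transposed positions. -/
def HTL.BlockOrdering.nPlus {H : HTL n k} (O : H.BlockOrdering) (l : ℕ) :
    Submodule ℂ (Matrix (Fin n) (Fin n) ℂ) where
  carrier := {Y | ∀ a b, ¬ O.NegPos l b a → Y a b = 0}
  add_mem' := by
    intro Y Z hY hZ a b hab
    rw [Matrix.add_apply, hY a b hab, hZ a b hab, add_zero]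
  zero_mem' := fun _ _ _ => rfl
  smul_mem' := by
    intro r Y hY a b hab
    rw [Matrix.smul_apply, hY a b hab, smul_zero]

/-- The Zariski open set `𝔻(H) ⊆ ℂ^{k+1}`: one removes the zero sets of the polynomials
`α*_{i;a,b} = ∑_{i ≤ l ≤ e} (s_l(a) - s_l(b)) ∏_{l < ν ≤ e} (x_i - x_ν)` for `i < k` and `a`, `b` in
different blocks of level `i`, where `e` is the largest index with `s_e(a) ≠ s_e(b)`. -/
def HTL.domain (H : HTL n k) : Set (Fin (k + 1) → ℂ) :=
  {c | ∀ (i : Fin (k + 1)) (a b : Fin n) (e : Fin (k + 1)), (i : ℕ) < k → i ≤ e →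
    H.s e a ≠ H.s e b → (∀ l, e < l → H.s l a = H.s l b) →
    ∑ l ∈ Finset.Icc i e, (H.s l a - H.s l b) * ∏ ν ∈ Finset.Ioc l e, (c i - c ν) ≠ 0}

/-! ## The deformed truncated polynomial rings and rational forms -/

/-- `(z - c_0) (z - c_1) ⋯ (z - c_{i-1})`. -/
def newton (c : Fin (k + 1) → ℂ) (i : ℕ) : ℂ[X] :=
  ∏ j ∈ Finset.univ.filter (fun j : Fin (k + 1) => (j : ℕ) < i), (X - C (c j))

lemma newton_monic (c : Fin (k + 1) → ℂ) (i : ℕ) : (newton c i).Monic :=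
  monic_prod_of_monic _ _ fun _ _ => monic_X_sub_C _

lemma newton_dvd (c : Fin (k + 1) → ℂ) (i : ℕ) : newton c i ∣ newton c (k + 1) :=
  Finset.prod_dvd_prod_of_subset _ _ _ fun j hj => by simp [Nat.lt_succ_iff.mp j.2]

lemma newton_eval (c : Fin (k + 1) → ℂ) (i : ℕ) : (newton c (i + 1)).eval (c 0) = 0 := by
  rw [newton, eval_prod]
  exact Finset.prod_eq_zero (i := 0) (by simp) (by simp)

/-- The ring `ℂ[z] / ((z - c_0) ⋯ (z - c_{l-1}))`. -/
abbrev Zhat (c : Fin (k + 1) → ℂ) (l : ℕ) : Type := AdjoinRoot (newton c l)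

/-- At the origin this is `ℂ[z]_{l-1} = ℂ[z] / (z^l)`, for `l ≤ k + 1`. -/
abbrev Trunc (k l : ℕ) : Type := Zhat (0 : Fin (k + 1) → ℂ) l

lemma newton_zero {l : ℕ} (hl : l ≤ k + 1) : newton (0 : Fin (k + 1) → ℂ) l = X ^ l := by
  have h : (Finset.univ.filter fun j : Fin (k + 1) => (j : ℕ) < l).card = l := by
    rw [Fin.card_filter_val_lt]; exact min_eq_right hl
  simp [newton, h]

/-- Evaluation at `c_0`. -/
def ev (c : Fin (k + 1) → ℂ) (l : ℕ) : Zhat c (l + 1) →ₐ[ℂ] ℂ :=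
  AdjoinRoot.liftAlgHom _ (AlgHom.id ℂ ℂ) (c 0)
    ((eval₂_eq_eval_map _).trans (by
      rw [AlgHom.id_toRingHom, Polynomial.map_id]; exact newton_eval c l))

/-- The projection `ℂ[z] / ((z - c_0) ⋯ (z - c_k)) → ℂ[z] / ((z - c_0) ⋯ (z - c_{l-1}))`. -/
def proj (c : Fin (k + 1) → ℂ) (l : ℕ) : Zhat c (k + 1) →ₐ[ℂ] Zhat c l :=
  AdjoinRoot.algHomOfDvd ℂ _ _ (newton_dvd c l)

lemma ev_proj (c : Fin (k + 1) → ℂ) (l : ℕ) (f : Zhat c (k + 1)) :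
    ev c l (proj c (l + 1) f) = ev c k f := by
  have h : (ev c l).comp (proj c (l + 1)) = ev c k := by
    apply AdjoinRoot.algHom_ext
    rw [AlgHom.comp_apply, proj, AdjoinRoot.algHomOfDvd_root, ev, ev, AdjoinRoot.liftAlgHom_root,
      AdjoinRoot.liftAlgHom_root]
  exact DFunLike.congr_fun h f

/-- Matrices with complex entries as constant matrices over `A`. -/
def const (A : Type) [CommRing A] [Algebra ℂ A] :
    Matrix (Fin n) (Fin n) ℂ →ₐ[ℂ] Matrix (Fin n) (Fin n) A :=
  (Algebra.ofId ℂ A).mapMatrix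

/-- Invertible complex matrices as constant invertible matrices over `A`. -/
def constGL (A : Type) [CommRing A] [Algebra ℂ A] : GL (Fin n) ℂ →* GL (Fin n) A :=
  Matrix.GeneralLinearGroup.map (algebraMap ℂ A)

lemma laurent_injective {d : ℤ} (hd : d ≠ 0) :
    Function.Injective (eval₂RingHom (HahnSeries.C : ℂ →+* LaurentSeries ℂ)
      (HahnSeries.single d 1)) := by
  have h : ∀ (p : ℂ[X]) (m : ℕ), (eval₂RingHom (HahnSeries.C : ℂ →+* LaurentSeries ℂ)
      (HahnSeries.single d 1) p).coeff (m * d) = p.coeff m := by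
    intro p m
    rw [coe_eval₂RingHom, eval₂_eq_sum, Polynomial.sum]
    simp only [HahnSeries.single_pow, HahnSeries.C_apply, HahnSeries.single_mul_single,
      HahnSeries.coeff_sum, one_pow, mul_one, zero_add, HahnSeries.coeff_single, nsmul_eq_mul,
      mul_left_inj' hd, Nat.cast_inj]
    rw [Finset.sum_ite_eq]
    split_ifs with hm
    · rfl
    · exact (notMem_support_iff.mp hm).symm
  intro p q hpq
  ext m
  rw [← h p m, ← h q m, hpq]

/-- The Laurent series in `w` of `f(w^d)`, for a rational function `f` and `d ≠ 0`. -/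
def laurent (d : ℤ) (hd : d ≠ 0) : RatFunc ℂ →+* LaurentSeries ℂ :=
  RatFunc.liftRingHom (eval₂RingHom HahnSeries.C (HahnSeries.single d 1))
    (nonZeroDivisors_le_comap_nonZeroDivisors_of_injective _ (laurent_injective hd))

lemma laurent_smul (d : ℤ) (hd : d ≠ 0) (r : ℂ) (f : RatFunc ℂ) :
    laurent d hd (r • f) = HahnSeries.C r * laurent d hd f := by
  rw [RatFunc.smul_eq_C_mul, map_mul]
  congr 1
  rw [laurent, RatFunc.liftRingHom_C, coe_eval₂RingHom, eval₂_C]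

/-- The residue at `z = 0` of `f dz`. -/
def resZero : RatFunc ℂ →ₗ[ℂ] ℂ where
  toFun f := (laurent 1 one_ne_zero f).coeff (-1)
  map_add' f g := by rw [map_add, HahnSeries.coeff_add]
  map_smul' r f := by
    rw [laurent_smul, HahnSeries.C_mul_eq_smul, HahnSeries.coeff_smul]; rfl

/-- The residue at `z = ∞` of `f dz`, namely `- res_{w = 0} f(1 / w) dw / w^2`. -/
def resInfty : RatFunc ℂ →ₗ[ℂ] ℂ where
  toFun f := -(laurent (-1) (neg_ne_zero.mpr one_ne_zero) f * HahnSeries.single (-2 : ℤ) 1).coeff (-1)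
  map_add' f g := by
    rw [map_add (laurent _ _), add_mul, HahnSeries.coeff_add, neg_add]
  map_smul' r f := by
    rw [laurent_smul, mul_assoc, HahnSeries.C_mul_eq_smul, HahnSeries.coeff_smul, ← smul_neg]; rfl

/-- The polynomial matrix of minimal degrees that represents a matrix over the quotient ring. -/
def lift (c : Fin (k + 1) → ℂ) (l : ℕ) :
    Matrix (Fin n) (Fin n) (Zhat c l) →ₗ[ℂ] Matrix (Fin n) (Fin n) ℂ[X] :=
  (AdjoinRoot.modByMonicHom (newton_monic c l)).mapMatrix

/-- The pairing `Z ↦ - tr res_{z = ∞} (Z ⬝ W dz)` of `M_n(ℂ[z] / ((z - c_0) ⋯ (z - c_{l-1})))` with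
a matrix `W` of rational functions whose entries have poles bounded by `c_0 + ... + c_{l-1}`.
It depends only on `W` modulo polynomials, since polynomials have no residue at infinity. -/
def pairing (c : Fin (k + 1) → ℂ) (l : ℕ) (W : Matrix (Fin n) (Fin n) (RatFunc ℂ)) :
    Module.Dual ℂ (Matrix (Fin n) (Fin n) (Zhat c l)) :=
  -(resInfty ∘ₗ Matrix.traceLinearMap (Fin n) ℂ (RatFunc ℂ) ∘ₗ LinearMap.mulRight ℂ W ∘ₗ
    (IsScalarTower.toAlgHom ℂ ℂ[X] (RatFunc ℂ)).mapMatrix.toLinearMap ∘ₗ lift c l)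

/-- The coadjoint action `(Ad^*(g) η)(Z) = η(g⁻¹ Z g)` of `GL_n(A)`. -/
def coAd {A : Type} [CommRing A] [Algebra ℂ A] (g : GL (Fin n) A)
    (η : Module.Dual ℂ (Matrix (Fin n) (Fin n) A)) :
    Module.Dual ℂ (Matrix (Fin n) (Fin n) A) :=
  η ∘ₗ LinearMap.mulLeft ℂ (g⁻¹ : GL (Fin n) A).1 ∘ₗ LinearMap.mulRight ℂ g.1

/-! ## The unipotent groups and the deformation -/

/-- The matrix `1 + ∑_{i=1}^m x_i (z - c_0) ⋯ (z - c_{i-1})` over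
`ℂ[z] / ((z - c_0) ⋯ (z - c_{L-1}))`; the index of `x` is shifted by one. -/
def unipotent (c : Fin (k + 1) → ℂ) (L : ℕ) {m : ℕ} (x : Fin m → Matrix (Fin n) (Fin n) ℂ) :
    Matrix (Fin n) (Fin n) (Zhat c L) :=
  1 + ∑ i : Fin m, AdjoinRoot.mk (newton c L) (newton c (i + 1)) • const (Zhat c L) (x i)

lemma unipotent_apply (c : Fin (k + 1) → ℂ) (L : ℕ) {m : ℕ}
    (x : Fin m → Matrix (Fin n) (Fin n) ℂ) (a b : Fin n) :
    unipotent c L x a b = (1 : Matrix (Fin n) (Fin n) (Zhat c L)) a b +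
      ∑ i : Fin m, AdjoinRoot.mk (newton c L) (newton c (i + 1)) *
        algebraMap ℂ (Zhat c L) (x i a b) := by
  simp [unipotent, const, Matrix.sum_apply, Algebra.ofId_apply]

lemma unipotent_apply_of_not {H : HTL n k} (O : H.BlockOrdering) {l : ℕ} (c : Fin (k + 1) → ℂ)
    (L : ℕ) {m : ℕ} (x : Fin m → O.nMinus l) {a b : Fin n} (h : ¬ O.NegPos l a b) :
    unipotent c L (fun i => (x i).1) a b = (1 : Matrix (Fin n) (Fin n) (Zhat c L)) a b := by
  rw [unipotent_apply, Finset.sum_eq_zero, add_zero]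
  intro i _
  rw [(x i).2 a b h, map_zero, mul_zero]

lemma unipotent_det {H : HTL n k} (O : H.BlockOrdering) {l : ℕ} (c : Fin (k + 1) → ℂ)
    (L : ℕ) {m : ℕ} (x : Fin m → O.nMinus l) :
    IsUnit (unipotent c L (fun i => (x i).1)).det := by
  have hT : (unipotent c L (fun i => (x i).1)).BlockTriangular (O.rank l) := by
    intro a b hab
    rw [unipotent_apply_of_not O c L x fun h => absurd h.2 (not_lt.mpr hab.le),
      Matrix.one_apply_ne]
    rintro rfl
    exact lt_irrefl _ hab
  rw [hT.det, Finset.prod_eq_one]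
  · exact isUnit_one
  · intro r _
    have : (unipotent c L (fun i => (x i).1)).toSquareBlock (O.rank l) r = 1 := by
      ext a b
      rw [Matrix.toSquareBlock_def, Matrix.of_apply,
        unipotent_apply_of_not O c L x fun h => absurd h.2 (by rw [a.2, b.2]; exact lt_irrefl _),
        Matrix.one_apply, Matrix.one_apply]
      simp [Subtype.ext_iff]
    rw [this, Matrix.det_one]

/-- The previous matrix as an element of `GL_n`, for coefficients in `𝔫^-_{m_l^{l+1}}`. -/
def unipotentGL {H : HTL n k} (O : H.BlockOrdering) {l : ℕ} (c : Fin (k + 1) → ℂ) (L : ℕ)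
    {m : ℕ} (x : Fin m → O.nMinus l) : GL (Fin n) (Zhat c L) :=
  Matrix.nonsingInvUnit (unipotent c L fun i => (x i).1) (unipotent_det O c L x)

/-- The matrix `∑_{i=1}^m X_i / ((z - c_0) ⋯ (z - c_i))` of rational functions; the index of `X` is
shifted by one. -/
def polarForm (c : Fin (k + 1) → ℂ) {m : ℕ} (ξ : Fin m → Matrix (Fin n) (Fin n) ℂ) :
    Matrix (Fin n) (Fin n) (RatFunc ℂ) :=
  ∑ i : Fin m, (algebraMap ℂ[X] (RatFunc ℂ) (newton c (i + 2)))⁻¹ •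
    (Algebra.ofId ℂ (RatFunc ℂ)).mapMatrix (ξ i)

/-- The deformation `(𝕆_{H_irr})_{𝔻(H)}`, in the right trivialization: the total space of the
vector bundle over `𝔻(H)` with fibre
`⨁_{l=2}^k N^-_{m_l^{l+1}}(ℂ[z] / ∏_{i<l} (z - c_i))^1 ⊕ 𝔫^+_{m_l^{l+1}}(Ω(c)_{l-1})^1` at `c`. The index
`j` stands for `l = j + 2`; `x j` are the coordinates of `n_l` and `ξ j` those of the form `X_l`
that represents an element of the dual of `𝔫^-_{m_l^{l+1}}(ℂ[z] / ∏_{i<l} (z - c_i))^1`. -/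
@[ext]
structure Deformation {H : HTL n k} (O : H.BlockOrdering) where
  c : H.domain
  x : (j : Fin (k - 1)) → Fin (j + 1) → O.nMinus (j + 2)
  ξ : (j : Fin (k - 1)) → Fin (j + 1) → O.nPlus (j + 2)

lemma levi_conj_nMinus {H : HTL n k} (O : H.BlockOrdering) {l : ℕ} (hl : 1 ≤ l) (hk : l ≤ k)
    {g g' Y : Matrix (Fin n) (Fin n) ℂ} (hg : g ∈ H.levi l) (hg' : g' ∈ H.levi l)
    (hY : Y ∈ O.nMinus l) : g * Y * g' ∈ O.nMinus l := by
  intro a b hab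
  rw [Matrix.mul_apply]
  refine Finset.sum_eq_zero fun d _ => ?_
  by_cases hd : H.SameBlock l d b
  · rw [Matrix.mul_apply, Finset.sum_eq_zero, zero_mul]
    intro e _
    by_cases he : H.SameBlock l a e
    · rw [hY e d, mul_zero]
      intro h
      refine hab ⟨(he.mono l.le_succ).trans (h.1.trans (hd.mono l.le_succ)), ?_⟩
      rw [(O.rank_eq_iff l hl hk a e).2 he, ← (O.rank_eq_iff l hl hk d b).2 hd]
      exact h.2
    · rw [hg a e he, zero_mul]
  · rw [hg' d b hd, mul_zero]

lemma levi_conj_nPlus {H : HTL n k} (O : H.BlockOrdering) {l : ℕ} (hl : 1 ≤ l) (hk : l ≤ k)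
    {g g' Y : Matrix (Fin n) (Fin n) ℂ} (hg : g ∈ H.levi l) (hg' : g' ∈ H.levi l)
    (hY : Y ∈ O.nPlus l) : g * Y * g' ∈ O.nPlus l := by
  intro a b hab
  rw [Matrix.mul_apply]
  refine Finset.sum_eq_zero fun d _ => ?_
  by_cases hd : H.SameBlock l d b
  · rw [Matrix.mul_apply, Finset.sum_eq_zero, zero_mul]
    intro e _
    by_cases he : H.SameBlock l a e
    · rw [hY e d, mul_zero]
      intro h
      refine hab ⟨((hd.symm.mono l.le_succ).trans h.1).trans (he.symm.mono l.le_succ), ?_⟩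
      rw [(O.rank_eq_iff l hl hk a e).2 he, ← (O.rank_eq_iff l hl hk d b).2 hd]
      exact h.2
    · rw [hg a e he, zero_mul]
  · rw [hg' d b hd, mul_zero]

lemma index_le (j : Fin (k - 1)) : (j : ℕ) + 2 ≤ k := by have := j.2; omega

namespace Deformation

variable {H : HTL n k} {O : H.BlockOrdering}

/-- The action of `L_{m_1}` on the relative cotangent bundles that is induced from conjugation on
the groups `N^-_{m_l^{l+1}}(ℂ[z] / ∏_{i<l} (z - c_i))^1`. In the right trivialization it is
`(n_l, X_l) ↦ (h n_l h⁻¹, h X_l h⁻¹)`. -/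
instance : MulAction (H.leviGroup 1) (Deformation O) where
  smul h p :=
    { c := p.c
      x := fun j i => ⟨h.1.1 * (p.x j i).1 * (h.1⁻¹).1,
        levi_conj_nMinus O (by omega) (index_le j) (H.levi_mono (by omega) h.2.1)
          (H.levi_mono (by omega) h.2.2) (p.x j i).2⟩
      ξ := fun j i => ⟨h.1.1 * (p.ξ j i).1 * (h.1⁻¹).1,
        levi_conj_nPlus O (by omega) (index_le j) (H.levi_mono (by omega) h.2.1)
          (H.levi_mono (by omega) h.2.2) (p.ξ j i).2⟩ }
  one_smul p := by
    refine Deformation.ext rfl ?_ ?_ <;> funext j i <;> apply Subtype.ext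
    · change (1 : Matrix _ _ ℂ) * (p.x j i).1 * ((1 : GL (Fin n) ℂ)⁻¹).1 = _
      simp
    · change (1 : Matrix _ _ ℂ) * (p.ξ j i).1 * ((1 : GL (Fin n) ℂ)⁻¹).1 = _
      simp
  mul_smul h h' p := by
    refine Deformation.ext rfl ?_ ?_ <;> funext j i <;> apply Subtype.ext
    · change (h.1.1 * h'.1.1) * (p.x j i).1 * ((h.1 * h'.1)⁻¹).1 =
        h.1.1 * (h'.1.1 * (p.x j i).1 * (h'.1⁻¹).1) * (h.1⁻¹).1
      rw [mul_inv_rev, Units.val_mul]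
      noncomm_ring
    · change (h.1.1 * h'.1.1) * (p.ξ j i).1 * ((h.1 * h'.1)⁻¹).1 =
        h.1.1 * (h'.1.1 * (p.ξ j i).1 * (h'.1⁻¹).1) * (h.1⁻¹).1
      rw [mul_inv_rev, Units.val_mul]
      noncomm_ring

/-- The bundle projection `θ` to `𝔻(H) ⊆ ℂ^{k+1}`. -/
def θ (p : Deformation O) : Fin (k + 1) → ℂ := p.c

/-- The element `n_l(c)`, `l = j + 2`, of `N^-_{m_l^{l+1}}(ℂ[z] / ∏_{i<l} (z - c_i))^1`. -/
def nl (p : Deformation O) (j : Fin (k - 1)) : GL (Fin n) (Zhat p.θ (j + 2)) :=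
  unipotentGL O p.θ (j + 2) (p.x j)

/-- The form `X_l(c)`, `l = j + 2`, in `𝔫^+_{m_l^{l+1}}(Ω(c)_{l-1})^1`. -/
def Xl (p : Deformation O) (j : Fin (k - 1)) : Matrix (Fin n) (Fin n) (RatFunc ℂ) :=
  polarForm p.θ fun i => (p.ξ j i).1

/-- The deformed residue map to the dual of `𝔩_{m_1}`,
`Y ↦ ∑_{l=2}^k (Ad^*(n_l⁻¹) X_l)(Y) = ∑_{l=2}^k - tr res_{z = ∞} (n_l Y n_l⁻¹ X_l)`.
The form `X_l` is viewed as the functional `Z ↦ - tr res_{z = ∞} (Z X_l)`; for such functionals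
`- res_{z = ∞}` is restriction to constant matrices. -/
def residue (p : Deformation O) : Module.Dual ℂ (H.levi 1) :=
  ∑ j : Fin (k - 1), coAd (p.nl j)⁻¹ (pairing p.θ (j + 2) (p.Xl j)) ∘ₗ
    (const (Zhat p.θ (j + 2))).toLinearMap ∘ₗ (H.levi 1).val.toLinearMap

end Deformation

/-- The coadjoint action `(Ad^*(h) η)(Y) = η(h⁻¹ Y h)` of `L_{m_i}` on the dual of `𝔩_{m_i}`. -/
def leviCoAd {H : HTL n k} {i : ℕ} (h : H.leviGroup i) (η : Module.Dual ℂ (H.levi i)) :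
    Module.Dual ℂ (H.levi i) :=
  η ∘ₗ LinearMap.mulLeft ℂ (⟨(h.1⁻¹).1, h.2.2⟩ : H.levi i) ∘ₗ
    LinearMap.mulRight ℂ (⟨h.1.1, h.2.1⟩ : H.levi i)

/-! ## The coadjoint orbit of the irregular type and its residue map -/

/-- `𝔤𝔩_n(ℂ[z]_k)^1`, the matrices over `ℂ[z]_k` that vanish at `z = 0`. -/
def gl1 (n k : ℕ) : Submodule ℂ (Matrix (Fin n) (Fin n) (Trunc k (k + 1))) :=
  LinearMap.ker (ev (0 : Fin (k + 1) → ℂ) k).mapMatrix.toLinearMap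

lemma mem_gl1 {V : Matrix (Fin n) (Fin n) (Trunc k (k + 1))} :
    V ∈ gl1 n k ↔ (ev (0 : Fin (k + 1) → ℂ) k).mapMatrix V = 0 := Iff.rfl

/-- `GL_n(ℂ[z]_k)^1`, the group of the `g` with `g(0) = 1`. -/
def GL1 (n k : ℕ) : Subgroup (GL (Fin n) (Trunc k (k + 1))) :=
  (Matrix.GeneralLinearGroup.map (ev (0 : Fin (k + 1) → ℂ) k).toRingHom).ker

lemma mem_GL1 {g : GL (Fin n) (Trunc k (k + 1))} :
    g ∈ GL1 n k ↔ (ev (0 : Fin (k + 1) → ℂ) k).mapMatrix g.1 = 1 := by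
  rw [GL1, MonoidHom.mem_ker, Units.ext_iff]
  exact Iff.rfl

/-- Left multiplication on `𝔤𝔩_n(ℂ[z]_k)^1`. -/
def lmul (M : Matrix (Fin n) (Fin n) (Trunc k (k + 1))) : gl1 n k →ₗ[ℂ] gl1 n k :=
  (LinearMap.mulLeft ℂ M).restrict fun V hV => by
    rw [mem_gl1] at hV ⊢
    rw [LinearMap.mulLeft_apply, map_mul, hV, mul_zero]

/-- Right multiplication on `𝔤𝔩_n(ℂ[z]_k)^1`. -/
def rmul (M : Matrix (Fin n) (Fin n) (Trunc k (k + 1))) : gl1 n k →ₗ[ℂ] gl1 n k :=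
  (LinearMap.mulRight ℂ M).restrict fun V hV => by
    rw [mem_gl1] at hV ⊢
    rw [LinearMap.mulRight_apply, map_mul, hV, zero_mul]

@[simp] lemma lmul_coe (M : Matrix (Fin n) (Fin n) (Trunc k (k + 1))) (V : gl1 n k) :
    (lmul M V : Matrix (Fin n) (Fin n) (Trunc k (k + 1))) = M * V := rfl

@[simp] lemma rmul_coe (M : Matrix (Fin n) (Fin n) (Trunc k (k + 1))) (V : gl1 n k) :
    (rmul M V : Matrix (Fin n) (Fin n) (Trunc k (k + 1))) = V * M := rfl

/-- The coadjoint action of `GL_n(ℂ[z]_k)` on the dual of its ideal `𝔤𝔩_n(ℂ[z]_k)^1`. -/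
def coAd1 (g : GL (Fin n) (Trunc k (k + 1))) (η : Module.Dual ℂ (gl1 n k)) :
    Module.Dual ℂ (gl1 n k) :=
  η ∘ₗ lmul (g⁻¹ : GL (Fin n) (Trunc k (k + 1))).1 ∘ₗ rmul g.1

lemma coAd1_one (η : Module.Dual ℂ (gl1 n k)) : coAd1 1 η = η := by
  ext V
  refine congrArg η (Subtype.ext ?_)
  simp

lemma coAd1_mul (g h : GL (Fin n) (Trunc k (k + 1))) (η : Module.Dual ℂ (gl1 n k)) :
    coAd1 (g * h) η = coAd1 g (coAd1 h η) := by
  ext V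
  refine congrArg η (Subtype.ext ?_)
  simp [mul_assoc]

namespace HTL

/-- The normal form as an element of the dual of `𝔤𝔩_n(ℂ[z]_k)`, through `res_{z = 0} tr (Z H)`. -/
def functional (H : HTL n k) : Module.Dual ℂ (Matrix (Fin n) (Fin n) (Trunc k (k + 1))) :=
  resZero ∘ₗ Matrix.traceLinearMap (Fin n) ℂ (RatFunc ℂ) ∘ₗ LinearMap.mulRight ℂ H.form ∘ₗ
    (IsScalarTower.toAlgHom ℂ ℂ[X] (RatFunc ℂ)).mapMatrix.toLinearMap ∘ₗ
      lift (0 : Fin (k + 1) → ℂ) (k + 1)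

/-- The irregular type `H_irr`, the restriction of the normal form to `𝔤𝔩_n(ℂ[z]_k)^1`. -/
def irr (H : HTL n k) : Module.Dual ℂ (gl1 n k) := H.functional ∘ₗ (gl1 n k).subtype

/-- `𝕆_{H_irr}`, the coadjoint orbit of `GL_n(ℂ[z]_k)^1` through `H_irr`. -/
def orbit (H : HTL n k) : Set (Module.Dual ℂ (gl1 n k)) :=
  {A | ∃ g ∈ GL1 n k, A = coAd1 g H.irr}

/-- `GL_n(ℂ)_{H_irr}`, the stabilizer of `H_irr` in `GL_n(ℂ)`. -/
def stabilizer (H : HTL n k) : Subgroup (GL (Fin n) ℂ) where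
  carrier := {g | coAd1 (constGL _ g) H.irr = H.irr}
  one_mem' := by
    change coAd1 (constGL _ 1) H.irr = H.irr
    rw [map_one, coAd1_one]
  mul_mem' := by
    intro g h hg hh
    change coAd1 (constGL _ (g * h)) H.irr = H.irr
    rw [map_mul, coAd1_mul, hh, hg]
  inv_mem' := by
    intro g hg
    change coAd1 (constGL _ g⁻¹) H.irr = H.irr
    conv_lhs => rw [← hg, ← coAd1_mul, ← map_mul, inv_mul_cancel, map_one, coAd1_one]

/-- `𝔤𝔩_n(ℂ)_{H_irr}`, the Lie algebra of that stabilizer: the `Y` with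
`H_irr (Y Z - Z Y) = 0` for all `Z` in `𝔤𝔩_n(ℂ[z]_k)^1`. -/
def lieStabilizer (H : HTL n k) : Submodule ℂ (Matrix (Fin n) (Fin n) ℂ) where
  carrier := {Y | ∀ Z : gl1 n k, H.irr (lmul (const _ Y) Z - rmul (const _ Y) Z) = 0}
  add_mem' := by
    intro Y Y' hY hY' Z
    have : lmul (const _ (Y + Y')) Z - rmul (const _ (Y + Y')) Z =
        (lmul (const _ Y) Z - rmul (const _ Y) Z) +
          (lmul (const _ Y') Z - rmul (const _ Y') Z) := by
      apply Subtype.ext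
      simp [add_mul, mul_add]
      abel
    rw [this, map_add, hY Z, hY' Z, add_zero]
  zero_mem' := by
    intro Z
    have : lmul (const _ 0) Z - rmul (const _ 0) Z = 0 := by
      apply Subtype.ext
      simp
    rw [this, map_zero]
  smul_mem' := by
    intro r Y hY Z
    have : lmul (const _ (r • Y)) Z - rmul (const _ (r • Y)) Z =
        r • (lmul (const _ Y) Z - rmul (const _ Y) Z) := by
      apply Subtype.ext
      simp [smul_sub]
    rw [this, map_smul, hY Z, smul_zero]

end HTL

/-- `T^* GL_n(ℂ[z]_k)^1`: the group is open in the affine space `1 + 𝔤𝔩_n(ℂ[z]_k)^1`, so that all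
its tangent spaces are `𝔤𝔩_n(ℂ[z]_k)^1`. -/
abbrev TstarGL1 (n k : ℕ) : Type := GL1 n k × Module.Dual ℂ (gl1 n k)

/-- The moment map `μ : α ↦ L_g^* α`. -/
def mu (α : TstarGL1 n k) : Module.Dual ℂ (gl1 n k) := α.2 ∘ₗ lmul α.1.1.1

/-- The map `ν : α ↦ R_g^* α`. -/
def nu (α : TstarGL1 n k) : Module.Dual ℂ (gl1 n k) := α.2 ∘ₗ rmul α.1.1.1

/-- The differential `V ↦ V - V(0) g` at `g ∈ GL_n(ℂ[z]_k)^1` of the projection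
`π_1 : GL_n(ℂ[z]_k) → GL_n(ℂ[z]_k)^1`, `g ↦ g(0)⁻¹ g`. -/
def dπ₁ (g : GL1 n k) : Matrix (Fin n) (Fin n) (Trunc k (k + 1)) →ₗ[ℂ] gl1 n k :=
  LinearMap.codRestrict (gl1 n k)
    (LinearMap.id - LinearMap.mulRight ℂ g.1.1 ∘ₗ (const _).toLinearMap ∘ₗ
      (ev (0 : Fin (k + 1) → ℂ) k).mapMatrix.toLinearMap)
    (fun V => by
      rw [mem_gl1]
      have h : (ev (0 : Fin (k + 1) → ℂ) k).mapMatrix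
          (const _ ((ev (0 : Fin (k + 1) → ℂ) k).mapMatrix V)) =
            (ev (0 : Fin (k + 1) → ℂ) k).mapMatrix V := by
        ext a b
        exact (ev (0 : Fin (k + 1) → ℂ) k).commutes _
      simp only [LinearMap.sub_apply, LinearMap.id_apply, LinearMap.comp_apply,
        AlgHom.toLinearMap_apply, LinearMap.mulRight_apply, map_sub, map_mul]
      rw [h, mem_GL1.1 g.2, mul_one, sub_self])

/-- The map `T^* GL_n(ℂ[z]_k)^1 → T^* GL_n(ℂ[z]_k) → 𝔤𝔩_n(ℂ[z]_k)^* → 𝔤𝔩_n(ℂ)_{H_irr}^*`, the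
composition of the pull-back along `π_1`, of `L_g^*`, and of restriction. -/
def mu0 (H : HTL n k) (α : TstarGL1 n k) : Module.Dual ℂ H.lieStabilizer :=
  α.2 ∘ₗ dπ₁ α.1 ∘ₗ LinearMap.mulLeft ℂ α.1.1.1 ∘ₗ (const _).toLinearMap ∘ₗ
    H.lieStabilizer.subtype

/-- The map `ν : μ⁻¹(H_irr) → 𝕆_{H_irr}` is onto. -/
lemma exists_nu_eq (H : HTL n k) (A : H.orbit) :
    ∃ α : TstarGL1 n k, mu α = H.irr ∧ nu α = A := by
  obtain ⟨A, g, hg, rfl⟩ := A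
  refine ⟨(⟨g, hg⟩, H.irr ∘ₗ lmul (g⁻¹).1), ?_, ?_⟩
  · ext V
    refine congrArg H.irr (Subtype.ext ?_)
    simp [← mul_assoc]
  · rfl

/-- The residue map `𝕆_{H_irr} → 𝔤𝔩_n(ℂ)_{H_irr}^*`, induced from `mu0` on `μ⁻¹(H_irr)` through the
quotient map `ν`. -/
def orbitResidue (H : HTL n k) (A : H.orbit) : Module.Dual ℂ H.lieStabilizer :=
  mu0 H (exists_nu_eq H A).choose

/-- Constant on the fibres of `ν`, so the previous definition does not depend on choices. -/
lemma mu0_eq_of_nu_eq (H : HTL n k) {α β : TstarGL1 n k} (hα : mu α = H.irr) (hβ : mu β = H.irr)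
    (h : nu α = nu β) : mu0 H α = mu0 H β := by
  obtain ⟨g, γ⟩ := α
  obtain ⟨g', γ'⟩ := β
  have key : ∀ (g : GL1 n k) (β : Module.Dual ℂ (gl1 n k)), mu (g, β) = H.irr →
      nu (g, β) = coAd1 g.1 H.irr ∧ ∀ Y, mu0 H (g, β) Y =
        H.irr (lmul (g.1⁻¹).1 (dπ₁ g (g.1.1 * const _ Y.1))) := by
    intro g β h
    rw [← h]
    refine ⟨?_, fun Y => ?_⟩
    · ext V
      refine congrArg β (Subtype.ext ?_)
      simp
    · refine congrArg β (Subtype.ext ?_)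
      simp
  obtain ⟨h1, h2⟩ := key g γ hα
  obtain ⟨h1', h2'⟩ := key g' γ' hβ
  rw [h1, h1'] at h
  ext Y
  rw [h2, h2']
  set s : GL (Fin n) (Trunc k (k + 1)) := g.1⁻¹ * g'.1 with hs
  have hsH : coAd1 s H.irr = H.irr := by
    rw [hs, coAd1_mul, ← h, ← coAd1_mul, inv_mul_cancel, coAd1_one]
  have hsm : s ∈ GL1 n k := (GL1 n k).mul_mem ((GL1 n k).inv_mem g.2) g'.2
  have hsm' : s⁻¹ ∈ GL1 n k := (GL1 n k).inv_mem hsm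
  have inv1 : ∀ V : gl1 n k, H.irr (lmul (s⁻¹).1 (rmul s.1 V)) = H.irr V := fun V =>
    LinearMap.congr_fun hsH V
  have inv2 : ∀ V : gl1 n k, H.irr (rmul s.1 V) = H.irr (lmul s.1 V) := fun V => by
    rw [← inv1 (lmul s.1 V)]
    refine congrArg H.irr (Subtype.ext ?_)
    simp [← mul_assoc]
  let W : gl1 n k := ⟨s.1 - 1, by rw [mem_gl1, map_sub, mem_GL1.1 hsm, map_one, sub_self]⟩
  let W' : gl1 n k := ⟨(s⁻¹).1 - 1, by rw [mem_gl1, map_sub, mem_GL1.1 hsm', map_one, sub_self]⟩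
  set y : Matrix (Fin n) (Fin n) (Trunc k (k + 1)) := const _ Y.1 with hy
  let D : gl1 n k := lmul (g.1⁻¹).1 (dπ₁ g (g.1.1 * y))
  let D' : gl1 n k := lmul (g'.1⁻¹).1 (dπ₁ g' (g'.1.1 * y))
  have hval : ∀ g : GL1 n k, (lmul (g.1⁻¹).1 (dπ₁ g (g.1.1 * y)) : gl1 n k).1 =
      y - (g.1⁻¹).1 * y * g.1.1 := by
    intro g
    have : (const (Trunc k (k + 1))) ((ev (0 : Fin (k + 1) → ℂ) k).mapMatrix (g.1.1 * y)) = y := by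
      rw [map_mul, mem_GL1.1 g.2, one_mul]
      ext a b
      exact congrArg (algebraMap ℂ (Trunc k (k + 1)))
        ((ev (0 : Fin (k + 1) → ℂ) k).commutes (Y.1 a b))
    simp only [lmul_coe, dπ₁, LinearMap.codRestrict_apply, LinearMap.sub_apply, LinearMap.id_apply,
      LinearMap.comp_apply, AlgHom.toLinearMap_apply, LinearMap.mulRight_apply]
    rw [this, mul_sub, ← mul_assoc, ← mul_assoc, Units.inv_mul, one_mul]
  have hg' : g'.1 = g.1 * s := by rw [hs, mul_inv_cancel_left]
  have e1 : D' = lmul (s⁻¹).1 (rmul s.1 D) - (rmul y W' + lmul y W + rmul s.1 (rmul y W') -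
      rmul y W') := by
    apply Subtype.ext
    change (lmul (g'.1⁻¹).1 (dπ₁ g' (g'.1.1 * y)) : gl1 n k).1 =
      (s⁻¹).1 * ((lmul (g.1⁻¹).1 (dπ₁ g (g.1.1 * y)) : gl1 n k).1 * s.1) -
        (((s⁻¹).1 - 1) * y + y * (s.1 - 1) + ((s⁻¹).1 - 1) * y * s.1 - ((s⁻¹).1 - 1) * y)
    rw [hval, hval, hg', mul_inv_rev, Units.val_mul, Units.val_mul]
    noncomm_ring
  have e2 : rmul y W' + lmul y W + lmul s.1 (rmul y W') - rmul y W' =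
      lmul y W - rmul y W := by
    apply Subtype.ext
    change ((s⁻¹).1 - 1) * y + y * (s.1 - 1) + s.1 * (((s⁻¹).1 - 1) * y) - ((s⁻¹).1 - 1) * y =
      y * (s.1 - 1) - (s.1 - 1) * y
    rw [← mul_assoc, mul_sub s.1, Units.mul_inv]
    noncomm_ring
  change H.irr D = H.irr D'
  rw [e1, map_sub, inv1, map_sub, map_add, inv2, ← map_add, ← map_sub, e2, Y.2 W, sub_zero]

lemma orbitResidue_nu (H : HTL n k) (α : TstarGL1 n k) (hα : mu α = H.irr) (hA : nu α ∈ H.orbit) :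
    orbitResidue H ⟨nu α, hA⟩ = mu0 H α :=
  mu0_eq_of_nu_eq H (exists_nu_eq H ⟨nu α, hA⟩).choose_spec.1 hα
    (exists_nu_eq H ⟨nu α, hA⟩).choose_spec.2

/-! ## The identification of the central fibre with the orbit -/

namespace HTL.BlockOrdering

variable {H : HTL n k} (O : H.BlockOrdering)

/-- `𝔫^-_{m_l^{l+1}}(ℂ[z]_{l-1})^1` for `l = j + 2`. It is the Lie algebra, and the tangent space at
each point, of the unipotent group `(N^-)^{(l)} = N^-_{m_l^{l+1}}(ℂ[z]_{l-1})^1`. -/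
def tangent (j : ℕ) : Submodule ℂ (Matrix (Fin n) (Fin n) (Trunc k (j + 2))) where
  carrier := {U | (∀ a b, ¬ O.NegPos (j + 2) a b → U a b = 0) ∧
    (ev (0 : Fin (k + 1) → ℂ) (j + 1)).mapMatrix U = 0}
  add_mem' := by
    rintro U V ⟨hU, hU'⟩ ⟨hV, hV'⟩
    refine ⟨fun a b hab => ?_, ?_⟩
    · rw [Matrix.add_apply, hU a b hab, hV a b hab, add_zero]
    · rw [map_add, hU', hV', add_zero]
  zero_mem' := ⟨fun _ _ _ => rfl, map_zero _⟩
  smul_mem' := by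
    rintro r U ⟨hU, hU'⟩
    refine ⟨fun a b hab => ?_, ?_⟩
    · rw [Matrix.smul_apply, hU a b hab, smul_zero]
    · rw [map_smul, hU', smul_zero]

/-- The cotangent bundle `T^* (N^-)^{(l)}` for `l = j + 2`, in the coordinates of the group. -/
abbrev TstarN (j : ℕ) : Type :=
  (Fin (j + 1) → O.nMinus (j + 2)) × Module.Dual ℂ (O.tangent j)

/-- The right trivialization `(n, ξ) ↦ R_{n⁻¹}^* ξ`, where `ξ` is the functional
`Z ↦ - tr res_{z = ∞} (Z X)`. -/
def rightTriv (j : ℕ) (x : Fin (j + 1) → O.nMinus (j + 2)) (ξ : Fin (j + 1) → O.nPlus (j + 2)) :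
    O.TstarN j :=
  (x, pairing (0 : Fin (k + 1) → ℂ) (j + 2) (polarForm (0 : Fin (k + 1) → ℂ) fun i => (ξ i).1) ∘ₗ
    LinearMap.mulRight ℂ (unipotentGL O 0 (j + 2) x)⁻¹.1 ∘ₗ (O.tangent j).subtype)

open Classical in
/-- The projection of `𝔤𝔩_n` onto `𝔫^-_{m_l^{l+1}}` along the sum of the other blocks. -/
def negPart (l : ℕ) {A : Type} [CommRing A] [Algebra ℂ A] :
    Matrix (Fin n) (Fin n) A →ₗ[ℂ] Matrix (Fin n) (Fin n) A where
  toFun M := Matrix.of fun a b => if O.NegPos l a b then M a b else 0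
  map_add' M M' := by
    ext a b
    simp only [Matrix.of_apply, Matrix.add_apply]
    split_ifs <;> simp
  map_smul' r M := by
    ext a b
    simp only [Matrix.of_apply, Matrix.smul_apply, RingHom.id_apply]
    split_ifs <;> simp

/-- The differential at the point `n` of `(N^-)^{(l)} ⊆ GL_n(ℂ[z]_k)^1` of the projection
`GL_n(ℂ[z]_k)^1 → GL_n(ℂ[z]_{l-1})^1 → (N^-)^{(l)}`, truncation followed by projection along the LU
decomposition. As a curve `n (1 + t V)` is projected to `n (1 + t V^- + O(t^2))`, where `V^-` is the
component of `V` in `𝔫^-_{m_l^{l+1}}`, it is `V ↦ n (n⁻¹ V)^-`. -/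
def dπN (j : ℕ) (x : Fin (j + 1) → O.nMinus (j + 2)) : gl1 n k →ₗ[ℂ] O.tangent j :=
  LinearMap.codRestrict (O.tangent j)
    (LinearMap.mulLeft ℂ (unipotentGL O 0 (j + 2) x).1 ∘ₗ O.negPart (j + 2) ∘ₗ
      LinearMap.mulLeft ℂ (unipotentGL O 0 (j + 2) x)⁻¹.1 ∘ₗ
        (proj (0 : Fin (k + 1) → ℂ) (j + 2)).mapMatrix.toLinearMap ∘ₗ (gl1 n k).subtype)
    (fun V => by
      constructor
      · intro a b hab
        simp only [LinearMap.comp_apply, LinearMap.mulLeft_apply]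
        rw [Matrix.mul_apply]
        refine Finset.sum_eq_zero fun d _ => ?_
        by_cases hd : O.NegPos (j + 2) d b
        · have had : ¬ O.NegPos (j + 2) a d := fun h => hab ⟨h.1.trans hd.1, h.2.trans hd.2⟩
          have : (unipotentGL O (0 : Fin (k + 1) → ℂ) (j + 2) x).1 a d = 0 := by
            refine (unipotent_apply_of_not O 0 (j + 2) x had).trans (Matrix.one_apply_ne ?_)
            rintro rfl
            exact hab hd
          rw [this, zero_mul]
        · simp [negPart, hd]
      · simp only [LinearMap.comp_apply, LinearMap.mulLeft_apply, map_mul]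
        have h0 : (ev (0 : Fin (k + 1) → ℂ) (j + 1)).mapMatrix
            ((unipotentGL O (0 : Fin (k + 1) → ℂ) (j + 2) x)⁻¹.1 *
              (proj (0 : Fin (k + 1) → ℂ) (j + 2)).mapMatrix V.1) = 0 := by
          rw [map_mul]
          have : (ev (0 : Fin (k + 1) → ℂ) (j + 1)).mapMatrix
              ((proj (0 : Fin (k + 1) → ℂ) (j + 2)).mapMatrix V.1) = 0 := by
            rw [← mem_gl1.1 V.2]
            ext a b
            exact ev_proj 0 (j + 1) _
          rw [this, mul_zero]
        convert mul_zero _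
        ext a b
        simp only [negPart, LinearMap.coe_mk, AddHom.coe_mk, AlgHom.mapMatrix_apply,
          Matrix.map_apply, Matrix.of_apply, Matrix.zero_apply]
        split_ifs
        · exact congrFun (congrFun h0 a) b
        · exact map_zero _)

/-- The map `T^* (N^-)^{(l)} → T^* GL_n(ℂ[z]_k)^1` on cotangent vectors, for `l = j + 2`. -/
def pull {j : ℕ} (α : O.TstarN j) : Module.Dual ℂ (gl1 n k) := α.2 ∘ₗ O.dπN j α.1

/-- The inclusion `(N^-)^{(l)} → GL_n(ℂ[z]_k)^1`, which keeps the coefficients of powers of `z`. -/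
def incl {j : ℕ} (x : Fin (j + 1) → O.nMinus (j + 2)) : GL1 n k :=
  ⟨unipotentGL O 0 (k + 1) x, by
    rw [mem_GL1]
    change (ev (0 : Fin (k + 1) → ℂ) k).mapMatrix (unipotent 0 (k + 1) fun i => (x i).1) = 1
    rw [unipotent, map_add, map_one, map_sum, Finset.sum_eq_zero, add_zero]
    intro i _
    ext a b
    have : ev (0 : Fin (k + 1) → ℂ) k (AdjoinRoot.mk _
        (newton (0 : Fin (k + 1) → ℂ) (i + 1))) = 0 := by
      rw [ev, AdjoinRoot.liftAlgHom_mk]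
      exact newton_eval 0 i
    simp [this]⟩

/-- The product `θ(α_{l_r}) ⋯ θ(α_{l_1})` over the indices `l_1 < ... < l_r` that satisfy `P`. -/
def seg (α : (j : Fin (k - 1)) → O.TstarN j) (P : Fin (k - 1) → Bool) : GL1 n k :=
  (((List.finRange (k - 1)).filter P).reverse.map fun j => O.incl (α j).1).prod

/-- The map `F : ∏_{l=2}^k T^* (N^-)^{(l)} → T^* GL_n(ℂ[z]_k)^1`,
`(α_l) ↦ L_{g⁻¹}^* H_irr + ∑_l L_{θ^{[l+1;k]}⁻¹}^* R_{θ^{[2;l-1]}⁻¹}^* (pull α_l)` at the point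
`g = θ^{[2;k]}`, where `θ^{[a;b]} = θ(α_b) ⋯ θ(α_a)`. -/
def bigF (α : (j : Fin (k - 1)) → O.TstarN j) : TstarGL1 n k :=
  (O.seg α fun _ => true,
    H.irr ∘ₗ lmul (O.seg α fun _ => true)⁻¹.1.1 +
      ∑ j, O.pull (α j) ∘ₗ lmul (O.seg α fun i => j < i)⁻¹.1.1 ∘ₗ
        rmul (O.seg α fun i => i < j)⁻¹.1.1)

end HTL.BlockOrdering

/-- The identification of the central fibre `θ⁻¹(0) = ∏_{l=2}^k T^* (N^-)^{(l)}` with the orbit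
`𝕆_{H_irr}`, given by `ν ∘ F`. It is only used at points `p` with `θ(p) = 0`. -/
def Deformation.central {H : HTL n k} {O : H.BlockOrdering} (p : Deformation O) :
    Module.Dual ℂ (gl1 n k) :=
  nu (O.bigF fun j => O.rightTriv j (p.x j) (p.ξ j))

end Unfolding

end

noncomputable section

namespace Unfolding

open Polynomial

variable {n k : ℕ}

/-! ## Matrices supported on a relation -/

section Support

variable {A : Type} [CommRing A]

/-! Write `G` for `GL_n(ℂ[z]_k)^1` and move functionals on `𝔤𝔩_n(ℂ[z]_k)^1` to all matrices by `V ↦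
z V` (`shift`). Let `𝕆_l` (`leviOrbit`) be the set of functionals conjugate to `H_irr` under
elements of `G` that lie in `𝔩_{m_l}`. Then `𝕆_2` is a point (`leviOrbit_two`) and `𝕆_{k+1}` is the
whole orbit. The theorem reduces to one step: `(φ, n, β) ↦ Ad^*(n)(φ + β)` is a bijection from `𝕆_l
× T^*N_l` to `𝕆_{l+1}`, where the cotangent vector `β` is a strictly triangular functional.

For the inverse of the step, take a functional in `𝕆_{l+1}`. Its leading coefficient is `S_l`, whose
eigenspaces inside a block of level `l + 1` are the blocks of level `l`. So bracketing with `S_l` is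
invertible on strictly triangular matrices, and `n` can be found coefficient by coefficient such
that `Ad^*(n⁻¹)` clears the functional on the positions opposite to those of `N_l`. This `n` is
unique (`Good.exists_reduction`, `Good.reduction_unique`). What remains is a block diagonal part `D`
plus a strictly triangular part `β`. The same reduction for the opposite numbering shows that `D +
β` is conjugate to `D` by a unipotent `u` (`Good.exists_coAd_eq_add`). Thus `D` is conjugate to
`H_irr`, and since both are block diagonal the conjugating matrix can be taken block diagonal
(`exists_coAd_eq_of_mask`), that is, `D ∈ 𝕆_l`. The possible `β` are exactly the cotangent vectors
in the right trivialization (`exists_shiftedCotangent`). Iterating the step gives `fibreFunctional`,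
and unrolling this recursion gives `ν ∘ F` (`shift_nu_bigF`).

At `Ad^*(g) H_irr` the residue of the orbit is `Y ↦ H(Y) - (Ad^*(g) H)(Y)` (`orbitResidue_coAd1`).
One step of the recursion replaces `g` by `n u g`. Conjugation by `u` does not change the value at
`Y`, because `u⁻¹ Y u - Y` lies in positions that a block diagonal functional does not see.
Conjugation by `n` contributes the value of the cotangent vector on `n⁻¹ Y n - Y`, which is minus
the summand of level `l` in the deformed residue (`exists_fibreFunctional_eq`).

The stabilizers are found by testing against `z^l` times matrix units. Equivariance is cyclicity of
the trace, as constant matrices pass through all the constructions. -/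

/-- The entries of `V` vanish off the positions in `P`. -/
def SuppOn (P : Fin n → Fin n → Prop) (V : Matrix (Fin n) (Fin n) A) : Prop :=
  ∀ a b, ¬ P a b → V a b = 0

open Classical in
/-- The projection onto the matrices supported on `P` that discards the other entries. -/
def mask (P : Fin n → Fin n → Prop) : Matrix (Fin n) (Fin n) A →ₗ[A] Matrix (Fin n) (Fin n) A where
  toFun V := Matrix.of fun a b => if P a b then V a b else 0
  map_add' V W := by ext a b; by_cases h : P a b <;> simp [h]
  map_smul' r V := by ext a b; by_cases h : P a b <;> simp [h]

lemma mask_apply_of {P : Fin n → Fin n → Prop} (V : Matrix (Fin n) (Fin n) A) {a b : Fin n}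
    (h : P a b) : mask P V a b = V a b := by simp [mask, h]

lemma mask_apply_of_not {P : Fin n → Fin n → Prop} (V : Matrix (Fin n) (Fin n) A) {a b : Fin n}
    (h : ¬ P a b) : mask P V a b = 0 := by simp [mask, h]

lemma suppOn_mask (P : Fin n → Fin n → Prop) (V : Matrix (Fin n) (Fin n) A) :
    SuppOn P (mask P V) := fun _ _ h => mask_apply_of_not V h

lemma SuppOn.mask_eq {P : Fin n → Fin n → Prop} {V : Matrix (Fin n) (Fin n) A} (h : SuppOn P V) :
    mask P V = V := by
  ext a b
  by_cases hab : P a b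
  · exact mask_apply_of V hab
  · rw [mask_apply_of_not V hab, h a b hab]

lemma SuppOn.mask_eq_zero {P Q : Fin n → Fin n → Prop} {V : Matrix (Fin n) (Fin n) A}
    (h : SuppOn Q V) (hPQ : ∀ a b, P a b → ¬ Q a b) : mask P V = 0 := by
  ext a b
  by_cases hab : P a b
  · rw [mask_apply_of V hab, h a b (hPQ a b hab)]; rfl
  · exact mask_apply_of_not V hab

lemma SuppOn.mono {P Q : Fin n → Fin n → Prop} {V : Matrix (Fin n) (Fin n) A} (h : SuppOn P V)
    (hPQ : ∀ a b, P a b → Q a b) : SuppOn Q V := fun a b hab => h a b fun h' => hab (hPQ a b h')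

lemma SuppOn.zero (P : Fin n → Fin n → Prop) : SuppOn P (0 : Matrix (Fin n) (Fin n) A) :=
  fun _ _ _ => rfl

lemma SuppOn.add {P : Fin n → Fin n → Prop} {V W : Matrix (Fin n) (Fin n) A} (hV : SuppOn P V)
    (hW : SuppOn P W) : SuppOn P (V + W) := fun a b h => by
  rw [Matrix.add_apply, hV a b h, hW a b h, add_zero]

lemma SuppOn.neg {P : Fin n → Fin n → Prop} {V : Matrix (Fin n) (Fin n) A} (hV : SuppOn P V) :
    SuppOn P (-V) := fun a b h => by rw [Matrix.neg_apply, hV a b h, neg_zero]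

lemma SuppOn.sub {P : Fin n → Fin n → Prop} {V W : Matrix (Fin n) (Fin n) A} (hV : SuppOn P V)
    (hW : SuppOn P W) : SuppOn P (V - W) := by
  rw [sub_eq_add_neg]; exact hV.add hW.neg

lemma SuppOn.smul {P : Fin n → Fin n → Prop} {V : Matrix (Fin n) (Fin n) A} (hV : SuppOn P V)
    (r : A) : SuppOn P (r • V) := fun a b h => by
  rw [Matrix.smul_apply, hV a b h, smul_zero]

lemma SuppOn.sum {P : Fin n → Fin n → Prop} {ι : Type*} (s : Finset ι)
    {f : ι → Matrix (Fin n) (Fin n) A} (h : ∀ i, SuppOn P (f i)) : SuppOn P (∑ i ∈ s, f i) :=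
  fun a b hab => by
    rw [Matrix.sum_apply]; exact Finset.sum_eq_zero fun i _ => h i a b hab

lemma SuppOn.one {P : Fin n → Fin n → Prop} (hP : ∀ a, P a a) :
    SuppOn P (1 : Matrix (Fin n) (Fin n) A) := fun a _ h =>
  Matrix.one_apply_ne fun hab => h (hab ▸ hP a)

lemma SuppOn.mul {P Q T : Fin n → Fin n → Prop} {V W : Matrix (Fin n) (Fin n) A}
    (hV : SuppOn P V) (hW : SuppOn Q W) (h : ∀ a b c, P a b → Q b c → T a c) :
    SuppOn T (V * W) := fun a c hac => by
  rw [Matrix.mul_apply]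
  refine Finset.sum_eq_zero fun b _ => ?_
  by_cases hab : P a b
  · rw [hW b c fun hbc => hac (h a b c hab hbc), mul_zero]
  · rw [hV a b hab, zero_mul]

variable {E : Fin n → Fin n → Prop} (hE : Equivalence E)
include hE

/-- If `a` and `c` are related and `g a b` is nonzero, then `b` and `c` are related, so the same
terms survive on both sides. -/
lemma mask_mul_left {g : Matrix (Fin n) (Fin n) A} (hg : SuppOn E g)
    (V : Matrix (Fin n) (Fin n) A) : mask E (g * V) = g * mask E V := by
  ext a c
  by_cases hac : E a c
  · rw [mask_apply_of _ hac, Matrix.mul_apply, Matrix.mul_apply]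
    refine Finset.sum_congr rfl fun b _ => ?_
    by_cases hab : E a b
    · rw [mask_apply_of _ (hE.trans (hE.symm hab) hac)]
    · rw [hg a b hab, zero_mul, zero_mul]
  · rw [mask_apply_of_not _ hac]
    exact ((hg.mul (suppOn_mask E V) fun _ _ _ => hE.trans) a c hac).symm

lemma mask_mul_right {g : Matrix (Fin n) (Fin n) A} (hg : SuppOn E g)
    (V : Matrix (Fin n) (Fin n) A) : mask E (V * g) = mask E V * g := by
  ext a c
  by_cases hac : E a c
  · rw [mask_apply_of _ hac, Matrix.mul_apply, Matrix.mul_apply]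
    refine Finset.sum_congr rfl fun b _ => ?_
    by_cases hbc : E b c
    · rw [mask_apply_of _ (hE.trans hac (hE.symm hbc))]
    · rw [hg b c hbc, mul_zero, mul_zero]
  · rw [mask_apply_of_not _ hac]
    exact (((suppOn_mask E V).mul hg fun _ _ _ => hE.trans) a c hac).symm

/-- Masking `g * g⁻¹ = 1` shows that the block part of `g⁻¹` is also a right inverse of `g`, so it
is all of `g⁻¹`. -/
lemma SuppOn.inv {g : GL (Fin n) A} (hg : SuppOn E g.1) : SuppOn E (g⁻¹).1 := by
  have h : g.1 * mask E (g⁻¹).1 = 1 := by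
    rw [← mask_mul_left hE hg, Units.mul_inv, (SuppOn.one hE.refl).mask_eq]
  have h' : (g⁻¹).1 = mask E (g⁻¹).1 := by
    calc (g⁻¹).1 = (g⁻¹).1 * (g.1 * mask E (g⁻¹).1) := by rw [h, mul_one]
      _ = _ := by rw [← mul_assoc, Units.inv_mul, one_mul]
  rw [h']
  exact suppOn_mask E _

end Support

/-! ### Block triangular and unipotent matrices of a flag -/

/-- An equivalence relation on `{1, ..., n}` and a numbering: the data of block triangular matrices
inside a block diagonal algebra. -/
structure Flag (n : ℕ) where
  E : Fin n → Fin n → Prop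
  equiv : Equivalence E
  r : Fin n → ℤ

namespace Flag

/-- The block diagonal positions. -/
def diag (F : Flag n) (a b : Fin n) : Prop := F.E a b ∧ F.r a = F.r b

/-- The positions that strictly increase the numbering. -/
def low (F : Flag n) (a b : Fin n) : Prop := F.E a b ∧ F.r a < F.r b

/-- The positions that strictly decrease the numbering. -/
def upp (F : Flag n) (a b : Fin n) : Prop := F.E a b ∧ F.r b < F.r a

/-- The opposite numbering. -/
def op (F : Flag n) : Flag n where
  E := F.E
  equiv := F.equiv
  r a := -F.r a

/-- Numberings are integer valued so that they can be negated; every result on `low` then gives one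
on `upp`. -/
lemma op_low (F : Flag n) : F.op.low = F.upp := by
  funext a b; simp [low, upp, op]

lemma op_upp (F : Flag n) : F.op.upp = F.low := by
  funext a b; simp [low, upp, op]

lemma op_diag (F : Flag n) : F.op.diag = F.diag := by
  funext a b; simp [diag, op]

variable {A : Type} [CommRing A] (F : Flag n)

lemma mask_decomp (V : Matrix (Fin n) (Fin n) A) :
    mask F.E V = mask F.diag V + mask F.low V + mask F.upp V := by
  ext a b
  rw [Matrix.add_apply, Matrix.add_apply]
  by_cases hE : F.E a b
  · rw [mask_apply_of _ hE]
    rcases lt_trichotomy (F.r a) (F.r b) with h | h | h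
    · rw [mask_apply_of_not _ (fun h' : F.diag a b => h.ne h'.2),
        mask_apply_of _ (show F.low a b from ⟨hE, h⟩),
        mask_apply_of_not _ (fun h' : F.upp a b => lt_asymm h h'.2)]
      ring
    · rw [mask_apply_of _ (show F.diag a b from ⟨hE, h⟩),
        mask_apply_of_not _ (fun h' : F.low a b => h'.2.ne h),
        mask_apply_of_not _ (fun h' : F.upp a b => h'.2.ne h.symm)]
      ring
    · rw [mask_apply_of_not _ (fun h' : F.diag a b => h.ne h'.2.symm),
        mask_apply_of_not _ (fun h' : F.low a b => lt_asymm h h'.2),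
        mask_apply_of _ (show F.upp a b from ⟨hE, h⟩)]
      ring
  · rw [mask_apply_of_not _ hE, mask_apply_of_not _ (fun h' : F.diag a b => hE h'.1),
      mask_apply_of_not _ (fun h' : F.low a b => hE h'.1),
      mask_apply_of_not _ (fun h' : F.upp a b => hE h'.1)]
    ring

lemma low_mul_low {V W : Matrix (Fin n) (Fin n) A} (hV : SuppOn F.low V) (hW : SuppOn F.low W) :
    SuppOn F.low (V * W) :=
  hV.mul hW fun _ _ _ h h' => ⟨F.equiv.trans h.1 h'.1, h.2.trans h'.2⟩

lemma low_mul_diag {V W : Matrix (Fin n) (Fin n) A} (hV : SuppOn F.low V) (hW : SuppOn F.diag W) :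
    SuppOn F.low (V * W) :=
  hV.mul hW fun _ _ _ h h' => ⟨F.equiv.trans h.1 h'.1, h.2.trans_eq h'.2⟩

lemma diag_mul_low {V W : Matrix (Fin n) (Fin n) A} (hV : SuppOn F.diag V) (hW : SuppOn F.low W) :
    SuppOn F.low (V * W) :=
  hV.mul hW fun _ _ _ h h' => ⟨F.equiv.trans h.1 h'.1, h.2.trans_lt h'.2⟩

lemma blockTriangular_one_add {W : Matrix (Fin n) (Fin n) A} (hW : SuppOn F.low W) :
    (1 + W).BlockTriangular F.r := by
  intro a b hab
  rw [Matrix.add_apply, hW a b fun h => lt_asymm h.2 hab, add_zero, Matrix.one_apply_ne]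
  rintro rfl
  exact lt_irrefl _ hab

lemma isUnit_det_one_add {W : Matrix (Fin n) (Fin n) A} (hW : SuppOn F.low W) :
    IsUnit (1 + W).det := by
  rw [(F.blockTriangular_one_add hW).det, Finset.prod_eq_one]
  · exact isUnit_one
  · intro r _
    have : (1 + W).toSquareBlock F.r r = 1 := by
      ext a b
      rw [Matrix.toSquareBlock_def, Matrix.of_apply, Matrix.add_apply,
        hW a b fun h => absurd h.2 (by rw [a.2, b.2]; exact lt_irrefl _), add_zero,
        Matrix.one_apply, Matrix.one_apply]
      simp [Subtype.ext_iff]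
    rw [this, Matrix.det_one]

/-- The block unipotent matrix `1 + W`. -/
def uni {W : Matrix (Fin n) (Fin n) A} (hW : SuppOn F.low W) : GL (Fin n) A :=
  Matrix.nonsingInvUnit (1 + W) (F.isUnit_det_one_add hW)

lemma uni_val {W : Matrix (Fin n) (Fin n) A} (hW : SuppOn F.low W) : (F.uni hW).1 = 1 + W := rfl

/-- `g` is unipotent with `g - 1` supported on the positions `F.low`. -/
def IsUni (g : GL (Fin n) A) : Prop := SuppOn F.low (g.1 - 1)

variable {F}

lemma IsUni.supp {g : GL (Fin n) A} (hg : F.IsUni g) : SuppOn F.E g.1 := by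
  have : g.1 = (g.1 - 1) + 1 := by abel
  rw [this]
  exact (SuppOn.mono hg fun _ _ h => h.1).add (SuppOn.one F.equiv.refl)

/-- The inverse is weakly block triangular, and `g⁻¹ - 1 = -g⁻¹ (g - 1)` is then a weakly times a
strictly triangular matrix. -/
lemma IsUni.inv {g : GL (Fin n) A} (hg : F.IsUni g) : F.IsUni g⁻¹ := by
  have hT : SuppOn (fun a b => F.E a b ∧ F.r a ≤ F.r b) (g⁻¹).1 := by
    intro a b hab
    by_cases hE : F.E a b
    · have h1 : g.1.BlockTriangular F.r := by
        have := F.blockTriangular_one_add hg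
        rwa [add_sub_cancel] at this
      let _ := g.invertible
      have h2 := Matrix.blockTriangular_inv_of_blockTriangular h1
      rw [Matrix.coe_units_inv]
      exact h2 (not_le.1 fun h => hab ⟨hE, h⟩)
    · exact hg.supp.inv F.equiv a b hE
  have e : (g⁻¹).1 - 1 = -((g⁻¹).1 * (g.1 - 1)) := by
    rw [mul_sub, Units.inv_mul, mul_one, neg_sub]
  rw [IsUni, e]
  exact (hT.mul hg fun _ _ _ h h' => ⟨F.equiv.trans h.1 h'.1, h.2.trans_lt h'.2⟩).neg

lemma IsUni.mul {g h : GL (Fin n) A} (hg : F.IsUni g) (hh : F.IsUni h) : F.IsUni (g * h) := by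
  have e : (g * h).1 - 1 = (g.1 - 1) * (h.1 - 1) + (g.1 - 1) + (h.1 - 1) := by
    rw [Units.val_mul]; noncomm_ring
  rw [IsUni, e]
  exact ((F.low_mul_low hg hh).add hg).add hh

lemma IsUni.conj_low {g : GL (Fin n) A} (hg : F.IsUni g) {V : Matrix (Fin n) (Fin n) A}
    (hV : SuppOn F.low V) : SuppOn F.low (g⁻¹.1 * (V * g.1)) := by
  have e : g⁻¹.1 * (V * g.1) = (g⁻¹.1 - 1) * (V * (g.1 - 1) + V) + (V * (g.1 - 1) + V) := by
    noncomm_ring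
  have h1 := (F.low_mul_low hV hg).add hV
  rw [e]
  exact (F.low_mul_low hg.inv h1).add h1

/-- Every term of the expansion has a strictly triangular factor. Consequently functionals that
vanish on strictly triangular matrices do not notice unipotent conjugation of block diagonal ones.
-/
lemma IsUni.conj_diag {g : GL (Fin n) A} (hg : F.IsUni g) {V : Matrix (Fin n) (Fin n) A}
    (hV : SuppOn F.diag V) : SuppOn F.low (g⁻¹.1 * (V * g.1) - V) := by
  have e : g⁻¹.1 * (V * g.1) - V =
      (g⁻¹.1 - 1) * (V * (g.1 - 1)) + (g⁻¹.1 - 1) * V + V * (g.1 - 1) := by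
    noncomm_ring
  rw [e]
  exact ((F.low_mul_low hg.inv (F.diag_mul_low hV hg)).add (F.low_mul_diag hg.inv hV)).add
    (F.diag_mul_low hV hg)

end Flag

/-! ## Reduction of functionals to block triangular form -/

section Reduction

variable {A : Type} [CommRing A] [Algebra ℂ A]

/-- `z` is a coordinate at the point `e`: the kernel of `e` is generated by `z`. -/
structure IsCoord (z : A) (e : A →ₐ[ℂ] ℂ) : Prop where
  map_eq_zero : e z = 0
  expand : ∀ a, ∃ b, a = algebraMap ℂ A (e a) + z * b

lemma const_apply (v : Matrix (Fin n) (Fin n) ℂ) (a b : Fin n) :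
    const A v a b = algebraMap ℂ A (v a b) := rfl

lemma SuppOn.const {P : Fin n → Fin n → Prop} {v : Matrix (Fin n) (Fin n) ℂ} (h : SuppOn P v) :
    SuppOn P (const A v) := fun a b hab => by
  rw [const_apply, h a b hab, map_zero]

lemma SuppOn.mapMatrix {P : Fin n → Fin n → Prop} {B : Type} [CommRing B] [Algebra ℂ B]
    (f : A →ₐ[ℂ] B) {V : Matrix (Fin n) (Fin n) A} (h : SuppOn P V) :
    SuppOn P (f.mapMatrix V) := fun a b hab => by
  rw [AlgHom.mapMatrix_apply, Matrix.map_apply, h a b hab, map_zero]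

lemma mapMatrix_const {B : Type} [CommRing B] [Algebra ℂ B] (f : A →ₐ[ℂ] B)
    (v : Matrix (Fin n) (Fin n) ℂ) : f.mapMatrix (Unfolding.const A v) = Unfolding.const B v := by
  ext a b
  exact f.commutes _

lemma mapMatrix_const' (f : A →ₐ[ℂ] ℂ) (v : Matrix (Fin n) (Fin n) ℂ) :
    f.mapMatrix (Unfolding.const A v) = v := by
  ext a b
  exact f.commutes _

lemma mapMatrix_smul {B : Type} [CommRing B] [Algebra ℂ B]
    (f : A →ₐ[ℂ] B) (a : A) (V : Matrix (Fin n) (Fin n) A) :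
    f.mapMatrix (a • V) = f a • f.mapMatrix V := by
  ext i j
  exact map_mul f _ _

lemma mapMatrix_mask {B : Type} [CommRing B] [Algebra ℂ B]
    (f : A →ₐ[ℂ] B) (P : Fin n → Fin n → Prop) (V : Matrix (Fin n) (Fin n) A) :
    f.mapMatrix (mask P V) = mask P (f.mapMatrix V) := by
  ext a b
  by_cases hab : P a b
  · rw [mask_apply_of _ hab, AlgHom.mapMatrix_apply, Matrix.map_apply, mask_apply_of _ hab]; rfl
  · rw [mask_apply_of_not _ hab, AlgHom.mapMatrix_apply, Matrix.map_apply,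
      mask_apply_of_not _ hab, map_zero]

lemma coAd_apply (g : GL (Fin n) A) (φ : Module.Dual ℂ (Matrix (Fin n) (Fin n) A))
    (V : Matrix (Fin n) (Fin n) A) : coAd g φ V = φ ((g⁻¹).1 * (V * g.1)) := rfl

lemma coAd_mul (g h : GL (Fin n) A) (φ : Module.Dual ℂ (Matrix (Fin n) (Fin n) A)) :
    coAd (g * h) φ = coAd g (coAd h φ) := by
  ext1 V
  rw [coAd_apply, coAd_apply, coAd_apply, mul_inv_rev, Units.val_mul, Units.val_mul]
  simp only [mul_assoc]

lemma coAd_one (φ : Module.Dual ℂ (Matrix (Fin n) (Fin n) A)) : coAd 1 φ = φ := by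
  ext1 V
  rw [coAd_apply]
  simp

lemma coAd_inv_coAd (g : GL (Fin n) A) (φ : Module.Dual ℂ (Matrix (Fin n) (Fin n) A)) :
    coAd g⁻¹ (coAd g φ) = φ := by rw [← coAd_mul, inv_mul_cancel, coAd_one]

lemma coAd_coAd_inv (g : GL (Fin n) A) (φ : Module.Dual ℂ (Matrix (Fin n) (Fin n) A)) :
    coAd g (coAd g⁻¹ φ) = φ := by rw [← coAd_mul, mul_inv_cancel, coAd_one]

variable {z : A} {e : A →ₐ[ℂ] ℂ}

lemma IsCoord.expand_matrix (hz : IsCoord z e) {P : Fin n → Fin n → Prop}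
    {V : Matrix (Fin n) (Fin n) A} (hV : SuppOn P V) :
    ∃ V', SuppOn P V' ∧ V = const A (e.mapMatrix V) + z • V' := by
  choose f hf using hz.expand
  refine ⟨mask P (V.map f), suppOn_mask _ _, ?_⟩
  have : V = const A (e.mapMatrix V) + z • V.map f := by
    ext a b
    exact hf (V a b)
  calc V = mask P V := hV.mask_eq.symm
    _ = mask P (const A (e.mapMatrix V) + z • V.map f) := by rw [← this]
    _ = _ := by rw [map_add, map_smul, (hV.mapMatrix e).const.mask_eq]

/-- Only the first bracket has order zero. The left entries of the other two are again supported on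
`P`, so hypotheses on brackets with such matrices apply to them. -/
lemma IsCoord.bracket_expand (hz : IsCoord z e) {P : Fin n → Fin n → Prop}
    {w : Matrix (Fin n) (Fin n) A} (hw : SuppOn P w) (V : Matrix (Fin n) (Fin n) A) :
    ∃ w' V', SuppOn P w' ∧ w * V - V * w =
      const A (e.mapMatrix w * e.mapMatrix V - e.mapMatrix V * e.mapMatrix w) +
        z • (const A (e.mapMatrix w) * V' - V' * const A (e.mapMatrix w)) +
          z • (w' * V - V * w') := by
  obtain ⟨w', hw', ew⟩ := hz.expand_matrix hw
  obtain ⟨V', -, eV⟩ := hz.expand_matrix (P := fun _ _ => True) (V := V) (by intro a b h; simp at h)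
  refine ⟨w', V', hw', ?_⟩
  conv_lhs => rw [ew]
  rw [add_mul, mul_add, smul_mul_assoc, mul_smul_comm]
  conv_lhs =>
    enter [1, 1]
    rw [eV]
  conv_lhs =>
    enter [2, 1]
    rw [eV]
  rw [map_sub, map_mul, map_mul, mul_add, add_mul, mul_smul_comm, smul_mul_assoc, smul_sub,
    smul_sub]
  abel

lemma IsCoord.expand_pow (hz : IsCoord z e) {P : Fin n → Fin n → Prop} (m : ℕ)
    {V : Matrix (Fin n) (Fin n) A} (hV : SuppOn P V) :
    ∃ (w : ℕ → Matrix (Fin n) (Fin n) ℂ) (V' : Matrix (Fin n) (Fin n) A), (∀ i, SuppOn P (w i)) ∧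
      V = ∑ i ∈ Finset.range m, z ^ i • const A (w i) + z ^ m • V' := by
  suffices H : ∃ (w : ℕ → Matrix (Fin n) (Fin n) ℂ) (V' : Matrix (Fin n) (Fin n) A),
      (∀ i, SuppOn P (w i)) ∧ SuppOn P V' ∧
        V = ∑ i ∈ Finset.range m, z ^ i • const A (w i) + z ^ m • V' by
    obtain ⟨w, V', h, -, h'⟩ := H
    exact ⟨w, V', h, h'⟩
  induction m with
  | zero => exact ⟨0, V, fun _ => SuppOn.zero _, hV, by simp⟩
  | succ m ih =>
    obtain ⟨w, V', hw, hV', h⟩ := ih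
    obtain ⟨V'', hV'', e'⟩ := hz.expand_matrix hV'
    refine ⟨Function.update w m (e.mapMatrix V'), V'', fun i => ?_, hV'', ?_⟩
    · by_cases hi : i = m
      · subst hi; rw [Function.update_self]; exact hV'.mapMatrix e
      · rw [Function.update_of_ne hi]; exact hw i
    · rw [Finset.sum_range_succ, Function.update_self,
        Finset.sum_congr rfl fun i hi => by
          rw [Function.update_of_ne (Finset.mem_range.1 hi).ne], add_assoc, pow_succ, mul_smul,
        ← smul_add, ← e']
      exact h

/-- This is the nondegeneracy behind the reduction: the positions `(a, b)` and `(b, a)` are paired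
with weight `s a - s b`. -/
lemma trace_bracket_single (s : Fin n → ℂ) (y : Matrix (Fin n) (Fin n) ℂ) (a b : Fin n) :
    (Matrix.diagonal s * (y * Matrix.single b a 1 - Matrix.single b a 1 * y)).trace =
      (s a - s b) * y a b := by
  rw [mul_sub, Matrix.trace_sub, ← mul_assoc, Matrix.trace_mul_comm, ← mul_assoc (Matrix.diagonal s),
    Matrix.trace_mul_comm (_ * _) y, Matrix.trace_single_mul, ← mul_assoc, Matrix.trace_mul_comm,
    Matrix.trace_single_mul]
  simp only [Matrix.diagonal_mul, Matrix.mul_diagonal, smul_eq_mul]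
  ring

/-- The functionals to which the reduction to block triangular form along `F` applies: supported
on `F.E`, with leading coefficient `diagonal s` on `F.E` and higher coefficients that commute with
the block diagonal matrices. -/
structure Good (F : Flag n) (s : Fin n → ℂ) (z : A) (m : ℕ)
    (φ : Module.Dual ℂ (Matrix (Fin n) (Fin n) A)) : Prop where
  supp : ∀ V, φ (mask F.E V) = φ V
  comm : ∀ g V, SuppOn F.E g → φ (z ^ (m + 1) • (g * V - V * g)) = 0
  lead : ∀ v : Matrix (Fin n) (Fin n) ℂ, φ (z ^ m • const A v) = (Matrix.diagonal s * v).trace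

namespace Good

variable {F : Flag n} {s : Fin n → ℂ} {m : ℕ} {φ : Module.Dual ℂ (Matrix (Fin n) (Fin n) A)}

lemma op (h : Good F s z m φ) : Good F.op s z m φ := ⟨h.supp, h.comm, h.lead⟩

/-- `comm` kills every term of `bracket_expand` that carries an extra `z`, so at order `m` only the
constant terms of the bracket count. -/
lemma bracket (h : Good F s z m φ) (hz : IsCoord z e) {w : Matrix (Fin n) (Fin n) A}
    (hw : SuppOn F.E w) (V : Matrix (Fin n) (Fin n) A) :
    φ (z ^ m • (w * V - V * w)) = (Matrix.diagonal s *
      (e.mapMatrix w * e.mapMatrix V - e.mapMatrix V * e.mapMatrix w)).trace := by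
  obtain ⟨w', V', hw', e2⟩ := hz.bracket_expand hw V
  have e1 : z ^ m • (w * V - V * w) =
      z ^ m • const A (e.mapMatrix w * e.mapMatrix V - e.mapMatrix V * e.mapMatrix w) +
        z ^ (m + 1) • (const A (e.mapMatrix w) * V' - V' * const A (e.mapMatrix w)) +
        z ^ (m + 1) • (w' * V - V * w') := by
    rw [e2, smul_add, smul_add, smul_smul, smul_smul, ← pow_succ]
  rw [e1, map_add, map_add, h.lead, h.comm _ _ (hw.mapMatrix e).const, h.comm _ _ hw', add_zero,
    add_zero]

lemma comm_of_one (h : Good F s z m φ) (hz : IsCoord z e) {g : Matrix (Fin n) (Fin n) A}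
    (hg : SuppOn F.E g) (hg1 : e.mapMatrix g = 1) (V : Matrix (Fin n) (Fin n) A) :
    φ (z ^ m • (g * V)) = φ (z ^ m • (V * g)) := by
  rw [← sub_eq_zero, ← map_sub, ← smul_sub, h.bracket hz hg, hg1]
  simp

lemma conj (h : Good F s z m φ) (hz : IsCoord z e) {g : GL (Fin n) A}
    (hg : SuppOn F.E g.1) (hg1 : e.mapMatrix g.1 = 1) (V : Matrix (Fin n) (Fin n) A) :
    φ (z ^ m • (g⁻¹.1 * (V * g.1))) = φ (z ^ m • V) := by
  have h1 := h.comm_of_one hz hg hg1 (g⁻¹.1 * V)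
  rw [← mul_assoc, Units.mul_inv, one_mul, mul_assoc] at h1
  exact h1.symm

/-- Conjugation by `g` in the block algebra preserves brackets with block matrices, and as `g` is
`1` at the origin it does not change the leading coefficient. -/
lemma coAd (h : Good F s z m φ) (hz : IsCoord z e) {g : GL (Fin n) A}
    (hg : SuppOn F.E g.1) (hg1 : e.mapMatrix g.1 = 1) : Good F s z m (coAd g φ) where
  supp V := by
    rw [coAd_apply, coAd_apply, ← mask_mul_right F.equiv hg,
      ← mask_mul_left F.equiv (hg.inv F.equiv), h.supp]
  comm w V hw := by
    have e1 : g⁻¹.1 * (z ^ (m + 1) • (w * V - V * w) * g.1) =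
        z ^ (m + 1) • ((g⁻¹.1 * w * g.1) * (g⁻¹.1 * V * g.1) -
          (g⁻¹.1 * V * g.1) * (g⁻¹.1 * w * g.1)) := by
      rw [smul_mul_assoc, mul_smul_comm]
      congr 1
      simp only [mul_assoc, Units.mul_inv_cancel_left, sub_mul, mul_sub]
    rw [coAd_apply, e1]
    exact h.comm _ _ (((hg.inv F.equiv).mul hw fun _ _ _ => F.equiv.trans).mul hg
      fun _ _ _ => F.equiv.trans)
  lead v := by
    rw [coAd_apply, smul_mul_assoc, mul_smul_comm, h.conj hz hg hg1, h.lead]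

/-- With `d` the diagonal matrix of the numbering, `V = [d, W]`, where `W` divides each entry by `r
a - r b`. By `bracket` the value is the trace of `diagonal s` against `[d, W(0)]`, and this bracket
has zero diagonal. -/
lemma upp_zero (h : Good F s z m φ) (hz : IsCoord z e) {V : Matrix (Fin n) (Fin n) A}
    (hV : SuppOn F.upp V) : φ (z ^ m • V) = 0 := by
  let d : Matrix (Fin n) (Fin n) ℂ := Matrix.diagonal fun a => (F.r a : ℂ)
  let W : Matrix (Fin n) (Fin n) A :=
    Matrix.of fun a b => algebraMap ℂ A ((F.r a : ℂ) - F.r b)⁻¹ * V a b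
  have hd : SuppOn F.E d := fun a b hab => Matrix.diagonal_apply_ne _ fun h' =>
    hab (h' ▸ F.equiv.refl a)
  have hVW : V = const A d * W - W * const A d := by
    have hcd : const A d = Matrix.diagonal fun a => algebraMap ℂ A (F.r a : ℂ) := by
      ext a b
      rw [const_apply]
      by_cases hab : a = b
      · subst hab; simp [d]
      · simp [d, hab]
    ext a b
    rw [hcd, Matrix.sub_apply, Matrix.diagonal_mul, Matrix.mul_diagonal]
    simp only [W, Matrix.of_apply]
    by_cases hab : F.upp a b
    · have hne : (F.r a : ℂ) - F.r b ≠ 0 := by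
        rw [sub_ne_zero]; exact_mod_cast hab.2.ne'
      calc V a b = algebraMap ℂ A (((F.r a : ℂ) - F.r b) * ((F.r a : ℂ) - F.r b)⁻¹) * V a b := by
            rw [mul_inv_cancel₀ hne, map_one, one_mul]
        _ = _ := by rw [map_mul, map_sub]; ring
    · rw [hV a b hab]; ring
  rw [hVW, h.bracket hz hd.const, mapMatrix_const']
  simp only [Matrix.trace, Matrix.diag_apply, d, Matrix.diagonal_mul, Matrix.sub_apply,
    Matrix.mul_diagonal]
  refine Finset.sum_eq_zero fun a _ => ?_
  ring

end Good

/-- `1 + ∑ x_i z^{i+1}`. -/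
def polyUni (z : A) {m : ℕ} (x : Fin m → Matrix (Fin n) (Fin n) ℂ) : Matrix (Fin n) (Fin n) A :=
  1 + ∑ i : Fin m, z ^ ((i : ℕ) + 1) • const A (x i)

lemma suppOn_polyUni_sub_one {P : Fin n → Fin n → Prop} {m : ℕ}
    {x : Fin m → Matrix (Fin n) (Fin n) ℂ} (hx : ∀ i, SuppOn P (x i)) :
    SuppOn P (polyUni z x - 1) := by
  rw [polyUni, add_sub_cancel_left]
  exact SuppOn.sum _ fun i => (hx i).const.smul _

lemma mapMatrix_polyUni (hz : IsCoord z e) {m : ℕ} (x : Fin m → Matrix (Fin n) (Fin n) ℂ) :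
    e.mapMatrix (polyUni z x) = 1 := by
  rw [polyUni, map_add, map_one, map_sum, Finset.sum_eq_zero, add_zero]
  intro i _
  rw [mapMatrix_smul, map_pow, hz.map_eq_zero, zero_pow (Nat.succ_ne_zero _), zero_smul]

variable {F : Flag n} {s : Fin n → ℂ} {m : ℕ} {φ : Module.Dual ℂ (Matrix (Fin n) (Fin n) A)}

lemma mapMatrix_inv {g : GL (Fin n) A} (hg : e.mapMatrix g.1 = 1) : e.mapMatrix g⁻¹.1 = 1 := by
  have := congrArg e.mapMatrix g.mul_inv
  rwa [map_mul, hg, one_mul, map_one] at this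

/-- A linear form on the upper positions is `v ↦ tr (diagonal s [y, v])` for some `y`. -/
lemma exists_trace_bracket (hs : ∀ a b, F.E a b → (F.r a = F.r b ↔ s a = s b))
    (ψ : Module.Dual ℂ (Matrix (Fin n) (Fin n) ℂ)) :
    ∃ y : Matrix (Fin n) (Fin n) ℂ, SuppOn F.low y ∧ ∀ v, SuppOn F.upp v →
      (Matrix.diagonal s * (y * v - v * y)).trace = ψ v := by
  -- The bracket with `diagonal s` is inverted entrywise as in `trace_bracket_single`; by `hs` the
  -- denominators do not vanish on `F.low`.
  let y : Matrix (Fin n) (Fin n) ℂ :=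
    mask F.low (Matrix.of fun a b => (s a - s b)⁻¹ * ψ (Matrix.single b a 1))
  refine ⟨y, suppOn_mask _ _, fun v hv => ?_⟩
  let T : Module.Dual ℂ (Matrix (Fin n) (Fin n) ℂ) :=
    Matrix.traceLinearMap (Fin n) ℂ ℂ ∘ₗ LinearMap.mulLeft ℂ (Matrix.diagonal s) ∘ₗ
      (LinearMap.mulLeft ℂ y - LinearMap.mulRight ℂ y)
  change T v = ψ v
  rw [Matrix.matrix_eq_sum_single v]
  simp only [map_sum]
  refine Finset.sum_congr rfl fun b _ => Finset.sum_congr rfl fun a _ => ?_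
  have hsm : Matrix.single b a (v b a) = v b a • Matrix.single b a (1 : ℂ) := by
    rw [Matrix.smul_single, smul_eq_mul, mul_one]
  rw [hsm, map_smul, map_smul]
  by_cases hab : F.low a b
  · congr 1
    change (Matrix.diagonal s * (y * Matrix.single b a 1 - Matrix.single b a 1 * y)).trace = _
    have hne : s a - s b ≠ 0 := sub_ne_zero.2 fun h => hab.2.ne ((hs a b hab.1).2 h)
    rw [trace_bracket_single, show y a b = _ from mask_apply_of _ hab, Matrix.of_apply,
      mul_inv_cancel_left₀ hne]
  · rw [hv b a fun h => hab ⟨F.equiv.symm h.1, h.2⟩, zero_smul, zero_smul]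

/-- Existence of the reduction to block triangular form. -/
lemma Good.exists_reduction (h : Good F s z m φ) (hz : IsCoord z e)
    (hs : ∀ a b, F.E a b → (F.r a = F.r b ↔ s a = s b)) :
    ∃ x : Fin m → Matrix (Fin n) (Fin n) ℂ, (∀ i, SuppOn F.low (x i)) ∧
      ∀ g : GL (Fin n) A, g.1 = polyUni z x → ∀ V, SuppOn F.upp V →
        Unfolding.coAd g⁻¹ φ V = 0 := by
  -- Stage `t` makes the functional vanish on `z^(m-t)` times upper matrices. Stage `0` is
  -- `upp_zero`, stage `m` is the claim, and going from `t` to `t + 1` changes only the coefficient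
  -- of `z^(t+1)` in the unipotent matrix.
  suffices H : ∀ t, t ≤ m → ∃ x : Fin m → Matrix (Fin n) (Fin n) ℂ, (∀ i, SuppOn F.low (x i)) ∧
      ∀ g : GL (Fin n) A, g.1 = polyUni z x → ∀ V, SuppOn F.upp V →
        Unfolding.coAd g⁻¹ φ (z ^ (m - t) • V) = 0 by
    obtain ⟨x, hx, hx'⟩ := H m le_rfl
    refine ⟨x, hx, fun g hg V hV => ?_⟩
    simpa using hx' g hg V hV
  intro t
  induction t with
  | zero =>
    intro _
    refine ⟨0, fun i => SuppOn.zero _, fun g hg V hV => ?_⟩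
    have hg' : g⁻¹ = 1 := by
      rw [inv_eq_one]
      apply Units.ext
      rw [hg]
      simp [polyUni]
    rw [hg', coAd_one]
    exact h.upp_zero hz hV
  | succ t ih =>
    intro ht
    obtain ⟨x, hx, hx'⟩ := ih (by omega)
    have hu := suppOn_polyUni_sub_one (z := z) hx
    let g₀ : GL (Fin n) A := F.uni hu
    have hg₀ : g₀.1 = polyUni z x := by rw [F.uni_val]; abel
    have hg₀u : F.IsUni g₀ := by rw [Flag.IsUni, hg₀]; exact hu
    have hg₀e : e.mapMatrix g₀.1 = 1 := by rw [hg₀, mapMatrix_polyUni hz]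
    have hB := h.coAd hz hg₀u.inv.supp (mapMatrix_inv hg₀e)
    have hx0 := hx' g₀ hg₀
    set B := Unfolding.coAd g₀⁻¹ φ with hBdef
    -- The negative of the obstruction to stage `t + 1`: the values on `z^(m-(t+1))` times constant
    -- matrices, to be cancelled by a bracket with `y`.
    let ψ : Module.Dual ℂ (Matrix (Fin n) (Fin n) ℂ) :=
      -(B ∘ₗ LinearMap.mulLeft ℂ (z ^ (m - (t + 1)) • (1 : Matrix (Fin n) (Fin n) A)) ∘ₗ
        (const A).toLinearMap)
    obtain ⟨y, hy, hyψ⟩ := exists_trace_bracket hs ψ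
    refine ⟨x + Pi.single ⟨t, ht⟩ y, fun i => ?_, fun g hg V hV => ?_⟩
    · refine (hx i).add ?_
      by_cases hi : i = ⟨t, ht⟩
      · subst hi; simpa using hy
      · rw [Pi.single_eq_of_ne hi]; exact SuppOn.zero _
    · have hgg : g.1 = g₀.1 + z ^ (t + 1) • const A y := by
        rw [hg, hg₀, polyUni, polyUni, add_assoc]
        congr 1
        simp only [Pi.add_apply, map_add, smul_add, Finset.sum_add_distrib]
        congr 1
        rw [Finset.sum_eq_single ⟨t, ht⟩]
        · simp
        · intro i _ hi; simp [hi]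
        · simp
      let w := g₀⁻¹.1 * const A y
      let M := g₀⁻¹ * g
      have hM : M.1 = 1 + z ^ (t + 1) • w := by
        rw [Units.val_mul, hgg, mul_add, Units.inv_mul, mul_smul_comm]
      have hwM : w * M.1 = M.1 * w := by
        rw [hM, mul_add, add_mul, mul_smul_comm, smul_mul_assoc, mul_one, one_mul]
      have hwM' : w * M⁻¹.1 = M⁻¹.1 * w := by
        calc w * M⁻¹.1 = M⁻¹.1 * (M.1 * w) * M⁻¹.1 := by rw [Units.inv_mul_cancel_left]
          _ = _ := by rw [← hwM, mul_assoc, mul_assoc, Units.mul_inv, mul_one]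
      have hwE : SuppOn F.E w :=
        hg₀u.inv.supp.mul (hy.const.mono fun _ _ h => h.1) fun _ _ _ => F.equiv.trans
      have hew : e.mapMatrix w = y := by
        rw [map_mul, mapMatrix_inv hg₀e, one_mul, mapMatrix_const']
      have hMe : e.mapMatrix M.1 = 1 := by
        rw [hM, map_add, map_one, mapMatrix_smul, map_pow, hz.map_eq_zero,
          zero_pow (Nat.succ_ne_zero _), zero_smul, add_zero]
      have hgM : Unfolding.coAd g⁻¹ φ = Unfolding.coAd M⁻¹ B := by
        rw [hBdef, ← coAd_mul]
        congr 1
        simp [M]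
      -- Conjugation by `M = 1 + z^(t+1) w` changes `V` by `z^(t+1)` times a bracket with `w`. After
      -- multiplication by `z^(m-(t+1))` the change has order `m`, where only `w(0) = y` and `V(0)`
      -- matter.
      have hconj : M.1 * (V * M⁻¹.1) = V + z ^ (t + 1) • (w * (V * M⁻¹.1) - (V * M⁻¹.1) * w) := by
        have : V * M⁻¹.1 * M.1 = V := by rw [mul_assoc, Units.inv_mul, mul_one]
        conv_rhs => enter [1]; rw [← this]
        rw [hM, smul_sub, mul_add, add_mul, mul_one, one_mul, mul_smul_comm, smul_mul_assoc]
        abel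
      rw [hgM, coAd_apply, inv_inv, smul_mul_assoc, mul_smul_comm, hconj, smul_add, smul_smul,
        ← pow_add, map_add, show m - (t + 1) + (t + 1) = m by omega, hB.bracket hz hwE, hew,
        map_mul, mapMatrix_inv hMe, mul_one, hyψ _ (hV.mapMatrix e)]
      -- The non-constant part of `V` carries a further `z` and is killed by stage `t`.
      obtain ⟨V', hV', eV⟩ := hz.expand_matrix hV
      conv_lhs => enter [1]; rw [eV]
      rw [smul_add, smul_smul, ← pow_succ, show m - (t + 1) + 1 = m - t by omega, map_add,
        hx0 V' hV', add_zero]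
      change _ + -B ((z ^ (m - (t + 1)) • (1 : Matrix (Fin n) (Fin n) A)) *
        const A (e.mapMatrix V)) = 0
      rw [smul_mul_assoc, one_mul, add_neg_cancel]

/-- Uniqueness of the reduction to block triangular form. -/
lemma Good.reduction_unique (h : Good F s z m φ) (hz : IsCoord z e)
    (hs : ∀ a b, F.E a b → (F.r a = F.r b ↔ s a = s b))
    {x x' : Fin m → Matrix (Fin n) (Fin n) ℂ} (hx : ∀ i, SuppOn F.low (x i))
    (hx' : ∀ i, SuppOn F.low (x' i)) {g g' : GL (Fin n) A} (hg : g.1 = polyUni z x)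
    (hg' : g'.1 = polyUni z x') (h0 : ∀ V, SuppOn F.upp V → Unfolding.coAd g⁻¹ φ V = 0)
    (h0' : ∀ V, SuppOn F.upp V → Unfolding.coAd g'⁻¹ φ V = 0) : x = x' := by
  have hgu : F.IsUni g := by rw [Flag.IsUni, hg]; exact suppOn_polyUni_sub_one hx
  have hgu' : F.IsUni g' := by rw [Flag.IsUni, hg']; exact suppOn_polyUni_sub_one hx'
  have hge : e.mapMatrix g.1 = 1 := by rw [hg, mapMatrix_polyUni hz]
  have hge' : e.mapMatrix g'.1 = 1 := by rw [hg', mapMatrix_polyUni hz]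
  have hB := h.coAd hz hgu.inv.supp (mapMatrix_inv hge)
  set B := Unfolding.coAd g⁻¹ φ with hBdef
  let M := g'⁻¹ * g
  have hMu : F.IsUni M := hgu'.inv.mul hgu
  have hMe : e.mapMatrix M.1 = 1 := by
    rw [Units.val_mul, map_mul, hge, mul_one, mapMatrix_inv hge']
  have hB' : Unfolding.coAd g'⁻¹ φ = Unfolding.coAd M B := by
    rw [hBdef, ← coAd_mul]; simp [M]
  rw [hB'] at h0'
  -- The coefficients are compared in increasing order. If those before `i` agree, then `g'⁻¹ g = 1
  -- + z^(i+1) w`, where `w(0)` is the difference of the `i`-th coefficients.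
  suffices H : ∀ i, (hi : i < m) → x ⟨i, hi⟩ = x' ⟨i, hi⟩ by
    funext i; exact H i i.2
  intro i
  induction i using Nat.strong_induction_on with
  | _ i ih =>
    intro hi
    have hdiff : ∃ D : Matrix (Fin n) (Fin n) A, SuppOn F.E D ∧
        g.1 - g'.1 = z ^ (i + 1) • (const A (x ⟨i, hi⟩ - x' ⟨i, hi⟩) + z • D) := by
      refine ⟨∑ j : Fin m, if (j : ℕ) ≤ i then 0 else
        z ^ ((j : ℕ) - (i + 1)) • const A (x j - x' j), ?_, ?_⟩
      · refine SuppOn.sum _ fun j => ?_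
        split_ifs
        · exact SuppOn.zero _
        · exact (((hx j).sub (hx' j)).const.smul _).mono fun _ _ h => h.1
      · rw [hg, hg', polyUni, polyUni, add_sub_add_left_eq_sub, ← Finset.sum_sub_distrib, smul_add,
          smul_smul, ← pow_succ, Finset.smul_sum]
        rw [← Finset.add_sum_erase _ _ (Finset.mem_univ (⟨i, hi⟩ : Fin m)),
          ← Finset.add_sum_erase (a := (⟨i, hi⟩ : Fin m)) _ (fun j : Fin m => z ^ (i + 1 + 1) •
            (if (j : ℕ) ≤ i then 0 else z ^ ((j : ℕ) - (i + 1)) • const A (x j - x' j)))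
            (Finset.mem_univ _)]
        simp only [le_refl, if_true, smul_zero, zero_add, ← smul_sub, ← map_sub]
        congr 1
        refine Finset.sum_congr rfl fun j hj => ?_
        have hji : (j : ℕ) ≠ i := fun h => (Finset.ne_of_mem_erase hj) (Fin.ext h)
        split_ifs with hle
        · rw [ih j (lt_of_le_of_ne hle hji) j.2, sub_self, map_zero, smul_zero, smul_zero]
        · rw [smul_smul, ← pow_add]
          congr 2
          omega
    obtain ⟨D, hD, hdiff⟩ := hdiff
    set y := x ⟨i, hi⟩ - x' ⟨i, hi⟩ with hy
    have hyl : SuppOn F.low y := (hx _).sub (hx' _)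
    let w := g'⁻¹.1 * (const A y + z • D)
    have hwE : SuppOn F.E w := hgu'.inv.supp.mul
      ((hyl.const.mono fun _ _ h => h.1).add (hD.smul z)) fun _ _ _ => F.equiv.trans
    have hew : e.mapMatrix w = y := by
      rw [map_mul, mapMatrix_inv hge', one_mul, map_add, mapMatrix_const', mapMatrix_smul,
        hz.map_eq_zero, zero_smul, add_zero]
    have hM : M.1 = 1 + z ^ (i + 1) • w := by
      rw [Units.val_mul, ← mul_smul_comm, ← hdiff, mul_sub, Units.inv_mul]
      abel
    have key : ∀ v, SuppOn F.upp v → (Matrix.diagonal s * (y * v - v * y)).trace = 0 := by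
      intro v hv
      have hV : SuppOn F.upp (z ^ (m - (i + 1)) • const A v) := hv.const.smul _
      have e1 := h0' _ hV
      have e2 := h0 _ hV
      -- Evaluating on `M W` removes the inverse of `M`, so that `M = 1 + z^(i+1) w` can be inserted
      -- on both sides. The terms without `w` vanish because both reduced functionals are zero on
      -- upper matrices.
      have e3 : Unfolding.coAd M B (M.1 * (z ^ (m - (i + 1)) • const A v)) =
          B (z ^ (m - (i + 1)) • const A v * M.1) := by
        rw [coAd_apply, mul_assoc, Units.inv_mul_cancel_left]
      have hpow : z ^ (m - (i + 1)) * z ^ (i + 1) = z ^ m := by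
        rw [← pow_add]; congr 1; omega
      have e4 : M.1 * (z ^ (m - (i + 1)) • const A v) =
          z ^ (m - (i + 1)) • const A v + z ^ m • (w * const A v) := by
        rw [hM, add_mul, one_mul, smul_mul_assoc, mul_smul_comm, smul_smul, mul_comm, hpow]
      have e5 : z ^ (m - (i + 1)) • const A v * M.1 =
          z ^ (m - (i + 1)) • const A v + z ^ m • (const A v * w) := by
        rw [hM, mul_add, mul_one, smul_mul_assoc, mul_smul_comm, smul_smul, hpow]
      rw [e4, e5, map_add, map_add, e1, e2, zero_add, zero_add, coAd_apply, smul_mul_assoc,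
        mul_smul_comm, hB.conj hz hMu.supp hMe] at e3
      have e6 := hB.bracket hz hwE (const A v)
      rw [hew, mapMatrix_const', smul_sub, map_sub, e3, sub_self] at e6
      exact e6.symm
    rw [← sub_eq_zero, ← hy]
    ext a b
    by_cases hab : F.low a b
    · have hne : s a - s b ≠ 0 := sub_ne_zero.2 fun h => hab.2.ne ((hs a b hab.1).2 h)
      have := key (Matrix.single b a 1) (by
        intro c d hcd
        rw [Matrix.single_apply_of_ne]
        rintro ⟨rfl, rfl⟩
        exact hcd ⟨F.equiv.symm hab.1, hab.2⟩)
      rw [trace_bracket_single] at this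
      exact (mul_eq_zero.1 this).resolve_left hne
    · exact hyl a b hab

/-- A block diagonal functional and its perturbations by strictly triangular ones are conjugate. -/
lemma Good.exists_coAd_eq_add (h : Good F s z m φ) (hz : IsCoord z e)
    (hs : ∀ a b, F.E a b → (F.r a = F.r b ↔ s a = s b))
    {β : Module.Dual ℂ (Matrix (Fin n) (Fin n) A)} (hφ : ∀ V, φ (mask F.diag V) = φ V)
    (hβ : ∀ V, β (mask F.low V) = β V) (hβ0 : ∀ V, β (z ^ m • V) = 0) :
    ∃ u : GL (Fin n) A, F.op.IsUni u ∧ e.mapMatrix u.1 = 1 ∧ Unfolding.coAd u φ = φ + β := by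
  -- As `β` kills `z^m`, adding it affects neither the leading coefficient nor the commutation, and
  -- the reduction applies to `φ + β` with the opposite numbering.
  have hG : Good F.op s z m (φ + β) := by
    refine Good.op ⟨fun V => ?_, fun g V hg => ?_, fun v => ?_⟩
    · rw [LinearMap.add_apply, h.supp, ← hβ, LinearMap.add_apply, ← hβ V]
      congr 2
      ext a b
      by_cases hab : F.low a b
      · rw [mask_apply_of _ hab, mask_apply_of _ hab, mask_apply_of _ hab.1]
      · rw [mask_apply_of_not _ hab, mask_apply_of_not _ hab]
    · rw [LinearMap.add_apply, h.comm g V hg, pow_succ, mul_smul, hβ0, add_zero]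
    · rw [LinearMap.add_apply, h.lead, hβ0, add_zero]
  obtain ⟨x, hx, hx'⟩ := hG.exists_reduction hz
    (fun a b hab => by rw [← hs a b hab]; exact neg_inj)
  have hu := suppOn_polyUni_sub_one (z := z) hx
  let u : GL (Fin n) A := F.op.uni hu
  have hu₀ : u.1 = polyUni z x := by rw [F.op.uni_val]; abel
  have huu : F.op.IsUni u := by rw [Flag.IsUni, hu₀]; exact hu
  have hue : e.mapMatrix u.1 = 1 := by rw [hu₀, mapMatrix_polyUni hz]
  have hlow := hx' u hu₀
  rw [F.op_upp] at hlow
  have hC := hG.coAd hz huu.inv.supp (mapMatrix_inv hue)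
  have hupp : ∀ V, SuppOn F.upp V → (φ + β) V = 0 := fun V hV => by
    rw [LinearMap.add_apply, ← hφ, ← hβ, hV.mask_eq_zero fun a b h h' => h'.2.ne' h.2,
      hV.mask_eq_zero fun a b h h' => lt_asymm h'.2 h.2, map_zero, map_zero, add_zero]
  refine ⟨u, huu, hue, ?_⟩
  -- The left side vanishes on lower positions by the choice of `u`. It vanishes on upper positions
  -- because conjugation by `u` preserves them and `φ + β` is zero there. On block diagonal matrices
  -- conjugation adds only upper terms, and `β` is zero, which leaves `φ`.
  suffices H : Unfolding.coAd u⁻¹ (φ + β) = φ by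
    conv_lhs => rw [← H]
    rw [coAd_coAd_inv]
  ext1 V
  rw [← hC.supp, ← hφ V]
  change Unfolding.coAd u⁻¹ (φ + β) (mask F.E V) = _
  rw [F.mask_decomp, map_add, map_add, hlow _ (suppOn_mask _ _), add_zero, coAd_apply, coAd_apply,
    hupp (_ * (mask F.upp V * _)), add_zero]
  · have e1 := huu.inv.conj_diag (V := mask F.diag V) (by rw [F.op_diag]; exact suppOn_mask _ _)
    rw [F.op_low] at e1
    have e2 := hupp _ e1
    rw [map_sub, sub_eq_zero] at e2
    rw [e2, LinearMap.add_apply, ← hβ,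
      (suppOn_mask F.diag V).mask_eq_zero fun a b h h' => h.2.ne h'.2, map_zero, add_zero]
  · have := huu.inv.conj_low (V := mask F.upp V) (by rw [F.op_low]; exact suppOn_mask _ _)
    rwa [F.op_low] at this

/-- The block triangular form of a functional is conjugate to a block diagonal one. -/
lemma Good.exists_coAd_diag (h : Good F s z m φ) (hz : IsCoord z e)
    (hs : ∀ a b, F.E a b → (F.r a = F.r b ↔ s a = s b))
    (h0 : ∀ V, SuppOn F.upp V → φ V = 0) :
    ∃ D β : Module.Dual ℂ (Matrix (Fin n) (Fin n) A), φ = D + β ∧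
      (∀ V, D (mask F.diag V) = D V) ∧ (∀ V, β (mask F.low V) = β V) ∧
      (∀ V, β (z ^ m • V) = 0) ∧
      ∃ u : GL (Fin n) A, F.op.IsUni u ∧ e.mapMatrix u.1 = 1 ∧ Unfolding.coAd u D = φ := by
  let D : Module.Dual ℂ (Matrix (Fin n) (Fin n) A) := φ ∘ₗ (mask F.diag).restrictScalars ℂ
  let β : Module.Dual ℂ (Matrix (Fin n) (Fin n) A) := φ ∘ₗ (mask F.low).restrictScalars ℂ
  have hDa : ∀ V, D V = φ (mask F.diag V) := fun _ => rfl
  have hβa : ∀ V, β V = φ (mask F.low V) := fun _ => rfl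
  have hsum : φ = D + β := by
    ext1 V
    rw [LinearMap.add_apply, hDa, hβa, ← h.supp, F.mask_decomp, map_add, map_add,
      h0 _ (suppOn_mask _ _), add_zero]
  have hD : ∀ V, D (mask F.diag V) = D V := fun V => by
    rw [hDa, hDa, (suppOn_mask _ _).mask_eq]
  have hβ : ∀ V, β (mask F.low V) = β V := fun V => by
    rw [hβa, hβa, (suppOn_mask _ _).mask_eq]
  -- This is `upp_zero` for the opposite numbering.
  have hβ0 : ∀ V, β (z ^ m • V) = 0 := fun V => by
    rw [hβa, map_smul]
    exact h.op.upp_zero hz (by rw [F.op_upp]; exact suppOn_mask _ _)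
  have hDz : ∀ V, D (z ^ m • V) = φ (z ^ m • V) := fun V => by
    rw [hsum, LinearMap.add_apply, hβ0, add_zero]
  have hG : Good F s z m D := by
    refine ⟨fun V => ?_, fun g V hg => ?_, fun v => ?_⟩
    · rw [hDa, hDa]
      congr 1
      ext a b
      by_cases hab : F.diag a b
      · rw [mask_apply_of _ hab, mask_apply_of _ hab, mask_apply_of _ hab.1]
      · rw [mask_apply_of_not _ hab, mask_apply_of_not _ hab]
    · rw [pow_succ, mul_smul, hDz, ← mul_smul, ← pow_succ, h.comm g V hg]
    · rw [hDz, h.lead]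
  obtain ⟨u, hu, hue, hcu⟩ := hG.exists_coAd_eq_add hz hs hD hβ hβ0
  exact ⟨D, β, hsum, hD, hβ, hβ0, u, hu, hue, hcu.trans hsum.symm⟩

/-- If two block diagonal functionals are conjugate, then by a block diagonal matrix. -/
lemma exists_coAd_eq_of_mask {P : Fin n → Fin n → Prop} (hP : Equivalence P)
    (he : ∀ a, e a = 1 → IsUnit a) {φ ψ : Module.Dual ℂ (Matrix (Fin n) (Fin n) A)}
    (hφ : ∀ V, φ (mask P V) = φ V) (hψ : ∀ V, ψ (mask P V) = ψ V) {g : GL (Fin n) A}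
    (hg : e.mapMatrix g.1 = 1) (h : φ = Unfolding.coAd g ψ) :
    ∃ g' : GL (Fin n) A, e.mapMatrix g'.1 = 1 ∧ SuppOn P g'.1 ∧ φ = Unfolding.coAd g' ψ := by
  -- The block part of `g` replaces `g`; it still reduces to `1`, so its determinant is a unit by
  -- `he`.
  have hmask : e.mapMatrix (mask P g.1) = 1 := by
    rw [mapMatrix_mask, hg, (SuppOn.one hP.refl).mask_eq]
  have hdet : IsUnit (mask P g.1).det := he _ <| by
    rw [AlgHom.map_det, hmask, Matrix.det_one]
  let g' : GL (Fin n) A := Matrix.nonsingInvUnit (mask P g.1) hdet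
  have hg' : SuppOn P g'.1 := suppOn_mask P g.1
  refine ⟨g', hmask, hg', ?_⟩
  -- Written without inverses, the conjugation is the relation `φ (g V) = ψ (V g)`. It is linear in
  -- `g`, so it survives masking.
  have key : ∀ V, φ (g'.1 * V) = ψ (V * g'.1) := fun V => by
    have e1 : φ (g.1 * mask P V) = ψ (mask P V * g.1) := by
      rw [h, coAd_apply, mul_assoc, Units.inv_mul_cancel_left]
    have e2 : mask P (g.1 * mask P V) = g'.1 * mask P V := mask_mul_right hP (suppOn_mask P V) g.1
    have e3 : mask P (mask P V * g.1) = mask P V * g'.1 := mask_mul_left hP (suppOn_mask P V) g.1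
    rw [← hφ, mask_mul_left hP hg', ← e2, hφ, e1, ← hψ, e3, ← hψ (V * g'.1),
      mask_mul_right hP hg']
  ext1 V
  rw [coAd_apply, ← mul_assoc, ← key, ← mul_assoc, Units.mul_inv, one_mul]

end Reduction

/-! ## Coefficients and residues -/

/-- The coefficient of `z^i` of the polynomial of minimal degree that represents an element. -/
def coef (c : Fin (k + 1) → ℂ) (l i : ℕ) : Zhat c l →ₗ[ℂ] ℂ :=
  Polynomial.lcoeff ℂ i ∘ₗ AdjoinRoot.modByMonicHom (newton_monic c l)

/-- The class of `z`. -/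
def zed (k l : ℕ) : Trunc k l := AdjoinRoot.root _

lemma coef_mk {l i : ℕ} (hl : l ≤ k + 1) (hi : i < l) (p : ℂ[X]) :
    coef (0 : Fin (k + 1) → ℂ) l i (AdjoinRoot.mk _ p) = p.coeff i := by
  rw [coef, LinearMap.comp_apply, AdjoinRoot.modByMonicHom_mk, lcoeff_apply, newton_zero hl,
    ← sub_eq_zero, ← coeff_sub, modByMonic_eq_sub_mul_div, sub_sub_cancel_left, coeff_neg,
    neg_eq_zero]
  exact X_pow_dvd_iff.1 (dvd_mul_right _ _) i hi

lemma zed_pow_eq_zero {l i : ℕ} (hl : l ≤ k + 1) (hi : l ≤ i) : zed k l ^ i = 0 := by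
  rw [zed, ← AdjoinRoot.mk_X, ← map_pow, AdjoinRoot.mk_eq_zero, newton_zero hl]
  exact pow_dvd_pow _ hi

lemma coef_zed_pow_mul {l i j : ℕ} (hl : l ≤ k + 1) (hi : i < l) (a : Trunc k l) :
    coef (0 : Fin (k + 1) → ℂ) l i (zed k l ^ j * a) =
      if j ≤ i then coef (0 : Fin (k + 1) → ℂ) l (i - j) a else 0 := by
  obtain ⟨p, rfl⟩ := AdjoinRoot.mk_surjective a
  rw [zed, ← AdjoinRoot.mk_X, ← map_pow, ← map_mul, coef_mk hl hi, coeff_X_pow_mul']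
  split_ifs
  · rw [coef_mk hl (by omega)]
  · rfl

lemma coef_algebraMap {l i : ℕ} (hl : l ≤ k + 1) (hi : i < l) (a : ℂ) :
    coef (0 : Fin (k + 1) → ℂ) l i (algebraMap ℂ _ a) = if i = 0 then a else 0 := by
  have : algebraMap ℂ (Trunc k l) a = AdjoinRoot.mk _ (C a) := rfl
  rw [this, coef_mk hl hi, coeff_C]

lemma newton_zero_mk {l L : ℕ} (hl : l ≤ k + 1) :
    AdjoinRoot.mk (newton (0 : Fin (k + 1) → ℂ) L) (newton (0 : Fin (k + 1) → ℂ) l) =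
      zed k L ^ l := by
  rw [newton_zero hl, map_pow]; rfl

lemma ev_mk (c : Fin (k + 1) → ℂ) (l : ℕ) (p : ℂ[X]) :
    ev c l (AdjoinRoot.mk _ p) = p.eval (c 0) := by
  rw [ev, AdjoinRoot.liftAlgHom_mk]
  exact eval₂_eq_eval_map _ |>.trans (by rw [AlgHom.id_toRingHom, Polynomial.map_id])

lemma isCoord_zed (k l : ℕ) : IsCoord (zed k (l + 1)) (ev (0 : Fin (k + 1) → ℂ) l) where
  map_eq_zero := by
    rw [zed, ← AdjoinRoot.mk_X, ev_mk, eval_X]; rfl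
  expand a := by
    obtain ⟨p, rfl⟩ := AdjoinRoot.mk_surjective a
    refine ⟨AdjoinRoot.mk _ p.divX, ?_⟩
    have h : algebraMap ℂ (Trunc k (l + 1)) (ev (0 : Fin (k + 1) → ℂ) l (AdjoinRoot.mk _ p)) =
        AdjoinRoot.mk _ (C (p.coeff 0)) := by
      rw [ev_mk, Pi.zero_apply, ← coeff_zero_eq_eval_zero]; rfl
    rw [h, zed, ← AdjoinRoot.mk_X, ← map_mul, ← map_add]
    congr 1
    rw [add_comm, X_mul, divX_mul_X_add]

lemma unipotent_zero_eq_polyUni {L m : ℕ} (hm : m ≤ k + 1)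
    (x : Fin m → Matrix (Fin n) (Fin n) ℂ) :
    unipotent (0 : Fin (k + 1) → ℂ) L x = polyUni (zed k L) x := by
  rw [unipotent, polyUni]
  congr 1
  refine Finset.sum_congr rfl fun i _ => ?_
  rw [newton_zero_mk (by omega)]

lemma coeff_eval₂_single {d : ℤ} (hd : d ≠ 0) (p : ℂ[X]) (m : ℕ) :
    (eval₂RingHom (HahnSeries.C : ℂ →+* LaurentSeries ℂ)
      (HahnSeries.single d 1) p).coeff (m * d) = p.coeff m := by
  rw [coe_eval₂RingHom, eval₂_eq_sum, Polynomial.sum]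
  simp only [HahnSeries.single_pow, HahnSeries.C_apply, HahnSeries.single_mul_single,
    HahnSeries.coeff_sum, one_pow, mul_one, zero_add, HahnSeries.coeff_single, nsmul_eq_mul,
    mul_left_inj' hd, Nat.cast_inj]
  rw [Finset.sum_ite_eq]
  split_ifs with hm
  · rfl
  · exact (notMem_support_iff.mp hm).symm

lemma laurent_polynomial_mul_inv (d : ℤ) (hd : d ≠ 0) (p : ℂ[X]) (i : ℕ) :
    laurent d hd (algebraMap ℂ[X] (RatFunc ℂ) p * (RatFunc.X ^ i)⁻¹) =
      eval₂RingHom (HahnSeries.C : ℂ →+* LaurentSeries ℂ) (HahnSeries.single d 1) p *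
        HahnSeries.single (-(i * d)) 1 := by
  have hX : laurent d hd RatFunc.X = HahnSeries.single d 1 := by
    rw [laurent, ← RatFunc.algebraMap_X, RatFunc.liftRingHom_algebraMap, coe_eval₂RingHom, eval₂_X]
  rw [map_mul, map_inv₀, map_pow, hX]
  congr 1
  · rw [laurent, RatFunc.liftRingHom_algebraMap]
  · apply inv_eq_of_mul_eq_one_right
    rw [HahnSeries.single_pow, HahnSeries.single_mul_single]
    simp

lemma coeff_mul_single_of_eq (f : LaurentSeries ℂ) {a b d : ℤ} (h : a = b + d) :
    (f * HahnSeries.single d 1).coeff a = f.coeff b := by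
  rw [h, HahnSeries.coeff_mul_single_add, mul_one]

lemma resZero_polynomial_mul_inv (p : ℂ[X]) (i : ℕ) :
    resZero (algebraMap ℂ[X] (RatFunc ℂ) p * (RatFunc.X ^ (i + 1))⁻¹) = p.coeff i := by
  change (laurent 1 one_ne_zero _).coeff (-1) = _
  rw [laurent_polynomial_mul_inv, ← coeff_eval₂_single one_ne_zero p i,
    coeff_mul_single_of_eq _ (b := i * 1) (by push_cast; ring)]

lemma resInfty_polynomial_mul_inv (p : ℂ[X]) (i : ℕ) :
    resInfty (algebraMap ℂ[X] (RatFunc ℂ) p * (RatFunc.X ^ (i + 1))⁻¹) = -p.coeff i := by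
  change -(laurent (-1) (neg_ne_zero.mpr one_ne_zero) _ * HahnSeries.single (-2 : ℤ) 1).coeff (-1) = _
  rw [laurent_polynomial_mul_inv, ← coeff_eval₂_single (neg_ne_zero.mpr one_ne_zero) p i, mul_assoc,
    HahnSeries.single_mul_single, mul_one,
    coeff_mul_single_of_eq _ (b := i * -1) (by push_cast; ring)]

/-- A residue pairing with a single pole. -/
lemma residue_trace_pole (ρ : RatFunc ℂ →ₗ[ℂ] ℂ) (w : RatFunc ℂ) (i : ℕ)
    (hρ : ∀ p : ℂ[X], ρ (algebraMap ℂ[X] (RatFunc ℂ) p * w) = p.coeff i)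
    (P : Matrix (Fin n) (Fin n) ℂ[X]) (v : Matrix (Fin n) (Fin n) ℂ) :
    ρ (((IsScalarTower.toAlgHom ℂ ℂ[X] (RatFunc ℂ)).mapMatrix P *
      v.map fun a => RatFunc.C a * w).trace) = (v * P.map fun p => p.coeff i).trace := by
  rw [Matrix.trace_mul_comm v]
  simp only [Matrix.trace, Matrix.diag_apply, Matrix.mul_apply, map_sum]
  refine Finset.sum_congr rfl fun a _ => Finset.sum_congr rfl fun b _ => ?_
  have h : (IsScalarTower.toAlgHom ℂ ℂ[X] (RatFunc ℂ)).mapMatrix P a b *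
      (v.map fun a => RatFunc.C a * w) b a = v b a • (algebraMap ℂ[X] (RatFunc ℂ) (P a b) * w) := by
    rw [RatFunc.smul_eq_C_mul]
    simp only [AlgHom.mapMatrix_apply, Matrix.map_apply, IsScalarTower.coe_toAlgHom']
    ring
  rw [h, map_smul, hρ, smul_eq_mul, mul_comm]
  rfl

/-- Because of the factor `dz / z`, the coefficient `S_i` stands at `z^(-i-1)` and pairs with the
coefficient of `z^i`. -/
lemma functional_apply (H : HTL n k) (V : Matrix (Fin n) (Fin n) (Trunc k (k + 1))) :
    H.functional V =
      ∑ i : Fin (k + 1), (Matrix.diagonal (H.s i) * V.map (coef 0 (k + 1) i)).trace +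
        (H.N₀ * V.map (coef 0 (k + 1) 0)).trace := by
  have h0 : H.form = (∑ i : Fin (k + 1), (Matrix.diagonal (H.s i)).map fun a =>
      RatFunc.C a * (RatFunc.X ^ ((i : ℕ) + 1))⁻¹) +
        H.N₀.map fun a => RatFunc.C a * (RatFunc.X ^ (0 + 1))⁻¹ := by
    rw [HTL.form, zero_add, pow_one]
  change resZero (((IsScalarTower.toAlgHom ℂ ℂ[X] (RatFunc ℂ)).mapMatrix (lift 0 (k + 1) V) *
    H.form).trace) = _
  rw [h0, mul_add, Matrix.mul_sum, Matrix.trace_add, Matrix.trace_sum, map_add, map_sum]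
  congr 1
  · refine Finset.sum_congr rfl fun i _ => ?_
    exact residue_trace_pole resZero _ i (fun p => resZero_polynomial_mul_inv p i) _ _
  · exact residue_trace_pole resZero _ 0 (fun p => resZero_polynomial_mul_inv p 0) _ _

/-- At the origin `ξ i` stands at `z^(-i-2)`, so it pairs with the coefficient of `z^(i+1)`; the
sign of the residue at infinity cancels that of the pairing. -/
lemma pairing_polarForm {l m : ℕ} (hm : m ≤ k) (ξ : Fin m → Matrix (Fin n) (Fin n) ℂ)
    (Z : Matrix (Fin n) (Fin n) (Trunc k l)) :
    pairing (0 : Fin (k + 1) → ℂ) l (polarForm (0 : Fin (k + 1) → ℂ) ξ) Z =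
      ∑ i : Fin m, (ξ i * Z.map (coef 0 l (i + 1))).trace := by
  have h0 : polarForm (0 : Fin (k + 1) → ℂ) ξ = ∑ i : Fin m, (ξ i).map fun a =>
      RatFunc.C a * (RatFunc.X ^ ((i : ℕ) + 1 + 1))⁻¹ := by
    refine Finset.sum_congr rfl fun i _ => ?_
    rw [newton_zero (by omega), map_pow, RatFunc.algebraMap_X]
    ext a b
    rw [Matrix.smul_apply, smul_eq_mul, mul_comm]
    rfl
  change -resInfty (((IsScalarTower.toAlgHom ℂ ℂ[X] (RatFunc ℂ)).mapMatrix (lift 0 l Z) *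
    polarForm (0 : Fin (k + 1) → ℂ) ξ).trace) = _
  rw [h0, Matrix.mul_sum, Matrix.trace_sum, map_sum, ← Finset.sum_neg_distrib]
  refine Finset.sum_congr rfl fun i _ => ?_
  exact residue_trace_pole (-resInfty) _ (i + 1) (fun p => by
    rw [LinearMap.neg_apply, resInfty_polynomial_mul_inv, neg_neg]) _ _

/-! ## The normal form as a functional and its stabilizers -/

lemma HTL.sameBlock_equivalence (H : HTL n k) (i : ℕ) : Equivalence (H.SameBlock i) :=
  ⟨fun _ _ _ => rfl, HTL.SameBlock.symm, HTL.SameBlock.trans⟩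

lemma map_coef_mask (P : Fin n → Fin n → Prop) {c : Fin (k + 1) → ℂ} {l i : ℕ}
    (V : Matrix (Fin n) (Fin n) (Zhat c l)) :
    (mask P V).map (coef c l i) = mask P (V.map (coef c l i)) := by
  ext a b
  by_cases hab : P a b
  · rw [Matrix.map_apply, mask_apply_of _ hab, mask_apply_of _ hab, Matrix.map_apply]
  · rw [Matrix.map_apply, mask_apply_of_not _ hab, mask_apply_of_not _ hab, map_zero]

lemma trace_mul_mask {P : Fin n → Fin n → Prop} {S : Matrix (Fin n) (Fin n) ℂ}
    (hS : ∀ a b, ¬ P b a → S a b = 0) (v : Matrix (Fin n) (Fin n) ℂ) :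
    (S * mask P v).trace = (S * v).trace := by
  simp only [Matrix.trace, Matrix.diag_apply, Matrix.mul_apply]
  refine Finset.sum_congr rfl fun a _ => Finset.sum_congr rfl fun b _ => ?_
  by_cases hab : P b a
  · rw [mask_apply_of _ hab]
  · rw [hS a b hab, zero_mul, zero_mul]

lemma HTL.N₀_apply (H : HTL n k) {a b : Fin n} (i : Fin (k + 1)) (h : H.s i a ≠ H.s i b) :
    H.N₀ a b = 0 := by
  have := congrFun (congrFun (H.commute i).eq a) b
  rw [Matrix.diagonal_mul, Matrix.mul_diagonal, mul_comm (H.N₀ a b), ← sub_eq_zero,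
    ← sub_mul] at this
  exact (mul_eq_zero.1 this).resolve_left (sub_ne_zero.2 h)

/-- `N₀` commutes with every `S_i`, so it has no entries between different joint eigenspaces. -/
lemma functional_mask (H : HTL n k) (i : ℕ) (V : Matrix (Fin n) (Fin n) (Trunc k (k + 1))) :
    H.functional (mask (H.SameBlock i) V) = H.functional V := by
  rw [functional_apply, functional_apply]
  congr 1
  · refine Finset.sum_congr rfl fun l _ => ?_
    rw [map_coef_mask, trace_mul_mask fun a b h => Matrix.diagonal_apply_ne _ ?_]
    rintro rfl
    exact h ((H.sameBlock_equivalence i).refl a)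
  · rw [map_coef_mask, trace_mul_mask fun a b h => ?_]
    have : ∃ l, H.s l a ≠ H.s l b := by
      by_contra! hc
      exact h fun l _ => (hc l).symm
    obtain ⟨l, hl⟩ := this
    exact H.N₀_apply l hl

/-- At order `0` the matrix `N₀` would contribute as well. -/
lemma functional_zed_pow (H : HTL n k) {p : ℕ} (hp : 1 ≤ p) (hpk : p < k + 1)
    (v : Matrix (Fin n) (Fin n) ℂ) :
    H.functional (zed k (k + 1) ^ p • const _ v) =
      (Matrix.diagonal (H.s ⟨p, hpk⟩) * v).trace := by
  have hc : ∀ i, i < k + 1 → (zed k (k + 1) ^ p • const (Trunc k (k + 1)) v).map (coef 0 (k + 1) i) =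
      if i = p then v else 0 := by
    intro i hi
    ext a b
    rw [Matrix.map_apply, Matrix.smul_apply, smul_eq_mul, coef_zed_pow_mul le_rfl hi, const_apply,
      coef_algebraMap le_rfl (by omega)]
    split_ifs <;> first | rfl | omega
  rw [functional_apply, Finset.sum_eq_single ⟨p, hpk⟩, hc p hpk, if_pos rfl, hc 0 (by omega),
    if_neg (by omega), mul_zero, Matrix.trace_zero, add_zero]
  · intro i _ hi
    rw [hc i i.2, if_neg fun h => hi (Fin.ext h), mul_zero, Matrix.trace_zero]
  · intro h; exact absurd (Finset.mem_univ _) h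

/-- The coefficients of order at least `l` of the normal form commute with `𝔩_{m_l}`. -/
lemma functional_bracket (H : HTL n k) {l p : ℕ} (hl : 1 ≤ l) (hp : l ≤ p)
    {w : Matrix (Fin n) (Fin n) (Trunc k (k + 1))} (hw : SuppOn (H.SameBlock l) w)
    (V : Matrix (Fin n) (Fin n) (Trunc k (k + 1))) :
    H.functional (zed k (k + 1) ^ p • (w * V - V * w)) = 0 := by
  -- Downward induction on the order `p`, starting from `z^p = 0` for `p > k`. At order `p` the
  -- contribution is the trace of `S_p [w(0), V(0)]`, which is zero because `S_p` is scalar on the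
  -- blocks of level `l ≤ p`.
  induction hd : k + 1 - p generalizing p w V with
  | zero => rw [zed_pow_eq_zero le_rfl (by omega), zero_smul, map_zero]
  | succ d ih =>
    have hpk : p < k + 1 := by omega
    obtain ⟨w', V', hw', e1⟩ := (isCoord_zed k k).bracket_expand hw V
    have hw0 := hw.mapMatrix (ev 0 k)
    rw [e1, smul_add, smul_add, smul_smul, smul_smul, ← pow_succ, map_add, map_add,
      ih (by omega) hw0.const V' (by omega), ih (by omega) hw' V (by omega), add_zero, add_zero,
      functional_zed_pow H (hl.trans hp) hpk]
    set w₀ := (ev (0 : Fin (k + 1) → ℂ) k).mapMatrix w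
    have hcomm : Matrix.diagonal (H.s ⟨p, hpk⟩) * w₀ = w₀ * Matrix.diagonal (H.s ⟨p, hpk⟩) := by
      ext a b
      rw [Matrix.diagonal_mul, Matrix.mul_diagonal]
      by_cases hab : H.SameBlock l a b
      · rw [hab ⟨p, hpk⟩ hp, mul_comm]
      · rw [hw0 a b hab, mul_zero, zero_mul]
    rw [mul_sub, ← mul_assoc, hcomm, ← mul_assoc, Matrix.trace_sub, Matrix.trace_mul_comm _ w₀,
      mul_assoc, sub_self]

/-- Multiplication by `z`, as a map onto `𝔤𝔩_n(ℂ[z]_k)^1`. -/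
def zmul (n k : ℕ) : Matrix (Fin n) (Fin n) (Trunc k (k + 1)) →ₗ[ℂ] gl1 n k :=
  LinearMap.codRestrict (gl1 n k)
    (LinearMap.mulLeft ℂ (zed k (k + 1) • (1 : Matrix (Fin n) (Fin n) (Trunc k (k + 1)))))
    (fun V => by
      rw [mem_gl1, LinearMap.mulLeft_apply, smul_mul_assoc, mapMatrix_smul,
        (isCoord_zed k k).map_eq_zero, zero_smul])

@[simp] lemma zmul_coe (V : Matrix (Fin n) (Fin n) (Trunc k (k + 1))) :
    (zmul n k V).1 = zed k (k + 1) • V := by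
  change _ * V = _
  rw [smul_mul_assoc, one_mul]

lemma zmul_surjective : Function.Surjective (zmul n k) := by
  intro W
  obtain ⟨V, -, h⟩ := (isCoord_zed k k).expand_matrix (P := fun _ _ => True) (V := W.1)
    (by intro a b h; simp at h)
  refine ⟨V, Subtype.ext ?_⟩
  rw [zmul_coe, h, mem_gl1.1 W.2, map_zero, zero_add]

/-- A functional on `𝔤𝔩_n(ℂ[z]_k)^1` as a functional on all matrices, through `V ↦ z V`. -/
def shift (φ : Module.Dual ℂ (gl1 n k)) :
    Module.Dual ℂ (Matrix (Fin n) (Fin n) (Trunc k (k + 1))) := φ ∘ₗ zmul n k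

lemma shift_injective : Function.Injective (shift (n := n) (k := k)) := by
  intro φ ψ h
  ext1 W
  obtain ⟨V, rfl⟩ := zmul_surjective W
  exact LinearMap.congr_fun h V

lemma shift_coAd1 (g : GL (Fin n) (Trunc k (k + 1))) (φ : Module.Dual ℂ (gl1 n k)) :
    shift (coAd1 g φ) = coAd g (shift φ) := by
  ext1 V
  refine congrArg φ (Subtype.ext ?_)
  change (g⁻¹).1 * ((zmul n k V).1 * g.1) = (zmul n k _).1
  rw [zmul_coe, zmul_coe, smul_mul_assoc, mul_smul_comm]
  rfl

lemma irr_apply (H : HTL n k) (Z : gl1 n k) : H.irr Z = H.functional Z.1 := rfl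

lemma shift_irr (H : HTL n k) (V : Matrix (Fin n) (Fin n) (Trunc k (k + 1))) :
    shift H.irr V = H.functional (zed k (k + 1) • V) := by
  change H.functional (zmul n k V).1 = _
  rw [zmul_coe]

lemma shift_irr_mask (H : HTL n k) (i : ℕ) (V : Matrix (Fin n) (Fin n) (Trunc k (k + 1))) :
    shift H.irr (mask (H.SameBlock i) V) = shift H.irr V := by
  rw [shift_irr, shift_irr, ← map_smul, functional_mask]

lemma isUnit_of_ev (a : Trunc k (k + 1)) (h : ev (0 : Fin (k + 1) → ℂ) k a = 1) : IsUnit a := by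
  obtain ⟨b, hb⟩ := (isCoord_zed k k).expand a
  rw [hb, h, map_one]
  refine IsNilpotent.isUnit_one_add ⟨k + 1, ?_⟩
  rw [mul_pow, zed_pow_eq_zero le_rfl le_rfl, zero_mul]

/-- The matrices over `ℂ` that preserve the irregular type. -/
lemma irr_bracket_iff (H : HTL n k) (Y : Matrix (Fin n) (Fin n) ℂ) :
    (∀ Z : gl1 n k, H.irr (lmul (const _ Y) Z - rmul (const _ Y) Z) = 0) ↔ Y ∈ H.levi 1 := by
  constructor
  · intro h a b hab
    have : ∃ l : Fin (k + 1), 1 ≤ (l : ℕ) ∧ H.s l a ≠ H.s l b := by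
      by_contra! hc
      exact hab hc
    obtain ⟨l, hl, hne⟩ := this
    -- Testing against `z^l` times the matrix unit at `(b, a)` isolates `(s_l(a) - s_l(b)) Y a b`.
    have h1 := h (zmul n k (zed k (k + 1) ^ ((l : ℕ) - 1) • const _ (Matrix.single b a 1)))
    rw [irr_apply, Submodule.coe_sub, lmul_coe, rmul_coe, zmul_coe, smul_smul, ← pow_succ', show (l : ℕ) - 1 + 1 = l by omega, mul_smul_comm,
      smul_mul_assoc, ← smul_sub, ← map_mul, ← map_mul, ← map_sub, functional_zed_pow H hl l.2,
      trace_bracket_single] at h1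
    exact (mul_eq_zero.1 h1).resolve_left (sub_ne_zero.2 hne)
  · intro hY Z
    obtain ⟨V, rfl⟩ := zmul_surjective Z
    rw [irr_apply, Submodule.coe_sub, lmul_coe, rmul_coe, zmul_coe, mul_smul_comm, smul_mul_assoc, ← smul_sub, ← pow_one (zed k (k + 1))]
    exact functional_bracket H le_rfl le_rfl (SuppOn.const hY) V

lemma levi_eq_lieStabilizer (H : HTL n k) :
    Subalgebra.toSubmodule (H.levi 1) = H.lieStabilizer :=
  Submodule.ext fun Y => (irr_bracket_iff H Y).symm

/-- Replacing `Z` by `g Z` turns invariance under conjugation into the linear relation of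
`irr_bracket_iff`, so one computation serves the group and the Lie algebra. -/
lemma mem_stabilizer_iff (H : HTL n k) (g : GL (Fin n) ℂ) :
    g ∈ H.stabilizer ↔ g.1 ∈ H.levi 1 := by
  rw [← irr_bracket_iff]
  have key : ∀ Z, coAd1 (constGL _ g) H.irr Z =
      H.irr (lmul (constGL _ g)⁻¹.1 (rmul (const _ g.1) Z)) := fun _ => rfl
  have hinv : (constGL (Trunc k (k + 1)) g)⁻¹.1 * const _ g.1 = 1 := (constGL _ g).inv_mul
  have hinv' : const (Trunc k (k + 1)) g.1 * (constGL _ g)⁻¹.1 = 1 := (constGL _ g).mul_inv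
  constructor
  · intro h Z
    have e1 := LinearMap.congr_fun (show coAd1 (constGL _ g) H.irr = H.irr from h)
      (lmul (const _ g.1) Z)
    rw [map_sub, sub_eq_zero, ← e1, key]
    refine congrArg H.irr (Subtype.ext ?_)
    rw [lmul_coe, rmul_coe, rmul_coe, lmul_coe, ← mul_assoc, ← mul_assoc, hinv, one_mul]
  · intro h
    refine LinearMap.ext fun Z => ?_
    have e1 := h (lmul (constGL _ g)⁻¹.1 Z)
    rw [map_sub, sub_eq_zero] at e1
    rw [key]
    calc _ = H.irr (rmul (const _ g.1) (lmul (constGL _ g)⁻¹.1 Z)) :=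
          congrArg H.irr (Subtype.ext (by
            rw [lmul_coe, rmul_coe, rmul_coe, lmul_coe, mul_assoc]))
      _ = _ := e1.symm.trans (congrArg H.irr (Subtype.ext (by
            rw [lmul_coe, lmul_coe, ← mul_assoc, hinv', one_mul])))

lemma leviGroup_eq_stabilizer (H : HTL n k) : H.leviGroup 1 = H.stabilizer := by
  ext g
  constructor
  · intro h
    exact (mem_stabilizer_iff H g).2 h.1
  · intro h
    exact ⟨(mem_stabilizer_iff H g).1 h, (mem_stabilizer_iff H g⁻¹).1 (H.stabilizer.inv_mem h)⟩

/-! ## The levels of the block decomposition -/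

/-- The refinement of the blocks of level `j + 3` by those of level `j + 2`. -/
def HTL.BlockOrdering.flag {H : HTL n k} (O : H.BlockOrdering) (j : ℕ) : Flag n where
  E := H.SameBlock (j + 3)
  equiv := H.sameBlock_equivalence _
  r a := O.rank (j + 2) a

section Levels

variable {H : HTL n k} (O : H.BlockOrdering)

lemma flag_low (j : ℕ) : (O.flag j).low = O.NegPos (j + 2) := by
  funext a b
  simp [Flag.low, HTL.BlockOrdering.flag, HTL.BlockOrdering.NegPos]

lemma flag_diag {j : ℕ} (hj : j + 2 ≤ k) : (O.flag j).diag = H.SameBlock (j + 2) := by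
  funext a b
  have := O.rank_eq_iff (j + 2) (by omega) hj a b
  simp only [Flag.diag, HTL.BlockOrdering.flag, Nat.cast_inj, this, eq_iff_iff]
  exact ⟨fun h => h.2, fun h => ⟨h.mono (by omega), h⟩⟩

/-- Inside a block of level `j + 3` the coefficients above `S_{j+2}` are already scalar, so
`S_{j+2}` alone separates the blocks of level `j + 2`. This is the hypothesis `hs` of the reduction.
-/
lemma flag_separates {j : ℕ} (hj : j + 2 ≤ k) (a b : Fin n) (hab : (O.flag j).E a b) :
    (O.flag j).r a = (O.flag j).r b ↔
      H.s ⟨j + 2, by omega⟩ a = H.s ⟨j + 2, by omega⟩ b := by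
  have := O.rank_eq_iff (j + 2) (by omega) hj a b
  simp only [HTL.BlockOrdering.flag, Nat.cast_inj, this]
  refine ⟨fun h => h _ le_rfl, fun h l hl => ?_⟩
  rcases hl.lt_or_eq with h' | h'
  · exact hab l h'
  · have : l = ⟨j + 2, by omega⟩ := Fin.ext h'.symm
    rw [this, h]

/-- The order is `j + 1` and not `j + 2` because `shift` absorbs one factor `z`. -/
lemma good_irr {j : ℕ} (hj : j + 2 ≤ k) :
    Good (O.flag j) (H.s ⟨j + 2, by omega⟩) (zed k (k + 1)) (j + 1) (shift H.irr) where
  supp V := shift_irr_mask H _ V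
  comm g V hg := by
    rw [shift_irr, smul_smul, ← pow_succ']
    exact functional_bracket H (by omega) le_rfl hg V
  lead v := by
    rw [shift_irr, smul_smul, ← pow_succ', functional_zed_pow H (by omega)]

/-- The functionals conjugate to the irregular type under matrices in `𝔩_{m_l}`. -/
def leviOrbit (H : HTL n k) (l : ℕ) :
    Set (Module.Dual ℂ (Matrix (Fin n) (Fin n) (Trunc k (k + 1)))) :=
  {φ | ∃ g ∈ GL1 n k, SuppOn (H.SameBlock l) g.1 ∧ φ = coAd g (shift H.irr)}

lemma leviOrbit_good {j : ℕ} (hj : j + 2 ≤ k)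
    {φ : Module.Dual ℂ (Matrix (Fin n) (Fin n) (Trunc k (k + 1)))} (h : φ ∈ leviOrbit H (j + 3)) :
    Good (O.flag j) (H.s ⟨j + 2, by omega⟩) (zed k (k + 1)) (j + 1) φ := by
  obtain ⟨g, hg, hgE, rfl⟩ := h
  exact (good_irr O hj).coAd (isCoord_zed k k) hgE (mem_GL1.1 hg)

lemma leviOrbit_mono {l l' : ℕ} (hl : l ≤ l') : leviOrbit H l ⊆ leviOrbit H l' := by
  rintro φ ⟨g, hg, hgE, rfl⟩
  exact ⟨g, hg, hgE.mono fun a b h => h.mono hl, rfl⟩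

lemma leviOrbit_mask {l : ℕ} {φ : Module.Dual ℂ (Matrix (Fin n) (Fin n) (Trunc k (k + 1)))}
    (h : φ ∈ leviOrbit H l) (V : Matrix (Fin n) (Fin n) (Trunc k (k + 1))) :
    φ (mask (H.SameBlock l) V) = φ V := by
  obtain ⟨g, hg, hgE, rfl⟩ := h
  have hE := H.sameBlock_equivalence l
  rw [coAd_apply, coAd_apply, ← mask_mul_right hE hgE, ← mask_mul_left hE (hgE.inv hE),
    shift_irr_mask]

/-- For `g = 1 + z w`, the factor `z` of `shift` raises the bracket with `g` to `z^2 [w, W]`, on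
which the normal form vanishes for `w` in `𝔩_{m_2}`. Hence the recursion starts from a single point.
-/
lemma leviOrbit_two : leviOrbit H 2 = {shift H.irr} := by
  ext φ
  constructor
  · rintro ⟨g, hg, hgE, rfl⟩
    ext1 V
    have hg1 := mem_GL1.1 hg
    obtain ⟨w, hw, e1⟩ := (isCoord_zed k k).expand_matrix hgE
    rw [hg1, map_one] at e1
    have key : ∀ W, shift H.irr (g.1 * W) = shift H.irr (W * g.1) := by
      intro W
      rw [← sub_eq_zero, ← map_sub, e1, shift_irr]
      have : zed k (k + 1) • ((1 + zed k (k + 1) • w) * W - W * (1 + zed k (k + 1) • w)) =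
          zed k (k + 1) ^ 2 • (w * W - W * w) := by
        rw [add_mul, mul_add, one_mul, mul_one, add_sub_add_left_eq_sub, smul_mul_assoc,
          mul_smul_comm, ← smul_sub, smul_smul, sq]
      rw [this]
      exact functional_bracket H (by omega) le_rfl hw W
    rw [coAd_apply, ← mul_assoc, ← key, ← mul_assoc, Units.mul_inv, one_mul]
  · rintro rfl
    exact ⟨1, (GL1 n k).one_mem, SuppOn.one (H.sameBlock_equivalence 2).refl, (coAd_one _).symm⟩

/-- From level `k + 1` on there is a single block and the support condition is void. -/
lemma mem_leviOrbit_iff {l : ℕ} (hl : k + 1 ≤ l) (φ : Module.Dual ℂ (gl1 n k)) :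
    shift φ ∈ leviOrbit H l ↔ φ ∈ H.orbit := by
  constructor
  · rintro ⟨g, hg, -, h⟩
    exact ⟨g, hg, shift_injective (by rw [h, shift_coAd1])⟩
  · rintro ⟨g, hg, rfl⟩
    exact ⟨g, hg, fun a b hab => absurd (fun i hi => absurd i.2 (by omega)) hab, shift_coAd1 _ _⟩

end Levels

/-! ## Cotangent vectors as strictly triangular functionals -/

section Cotangent

variable {H : HTL n k} (O : H.BlockOrdering)

lemma proj_zed (l : ℕ) : proj (0 : Fin (k + 1) → ℂ) l (zed k (k + 1)) = zed k l :=
  AdjoinRoot.algHomOfDvd_root ..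

lemma incl_val {j : ℕ} (hj : j + 2 ≤ k) (x : Fin (j + 1) → O.nMinus (j + 2)) :
    (O.incl x).1.1 = polyUni (zed k (k + 1)) fun i => (x i).1 :=
  unipotent_zero_eq_polyUni (by omega) _

lemma suppOn_nMinus {j : ℕ} (x : O.nMinus (j + 2)) : SuppOn (O.flag j).low x.1 := by
  rw [flag_low]; exact x.2

lemma incl_isUni {j : ℕ} (hj : j + 2 ≤ k) (x : Fin (j + 1) → O.nMinus (j + 2)) :
    (O.flag j).IsUni (O.incl x).1 := by
  rw [Flag.IsUni, incl_val O hj]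
  exact suppOn_polyUni_sub_one fun i => suppOn_nMinus O (x i)

lemma proj_incl {j : ℕ} (hj : j + 2 ≤ k) (x : Fin (j + 1) → O.nMinus (j + 2)) :
    (proj (0 : Fin (k + 1) → ℂ) (j + 2)).mapMatrix (O.incl x).1.1 =
      (unipotentGL O (0 : Fin (k + 1) → ℂ) (j + 2) x).1 := by
  have e1 : (unipotentGL O (0 : Fin (k + 1) → ℂ) (j + 2) x).1 =
      polyUni (zed k (j + 2)) fun i => (x i).1 := unipotent_zero_eq_polyUni (by omega) _
  rw [e1, incl_val O hj, polyUni, polyUni, map_add, map_one, map_sum]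
  congr 1
  refine Finset.sum_congr rfl fun i _ => ?_
  rw [mapMatrix_smul, map_pow, proj_zed, mapMatrix_const]

lemma proj_incl_inv {j : ℕ} (hj : j + 2 ≤ k) (x : Fin (j + 1) → O.nMinus (j + 2)) :
    (proj (0 : Fin (k + 1) → ℂ) (j + 2)).mapMatrix (O.incl x).1⁻¹.1 =
      (unipotentGL O (0 : Fin (k + 1) → ℂ) (j + 2) x)⁻¹.1 := by
  set u := unipotentGL O (0 : Fin (k + 1) → ℂ) (j + 2) x
  have e1 := congrArg (proj (0 : Fin (k + 1) → ℂ) (j + 2)).mapMatrix (O.incl x).1.mul_inv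
  rw [map_mul, map_one, proj_incl O hj] at e1
  calc _ = u⁻¹.1 * (u.1 * (proj (0 : Fin (k + 1) → ℂ) (j + 2)).mapMatrix (O.incl x).1⁻¹.1) := by
        rw [Units.inv_mul_cancel_left]
    _ = _ := by rw [e1, mul_one]

/-- The pull-back of a cotangent vector in the right trivialization, as a functional on all
matrices. -/
def cotangentFunctional (j : ℕ) (x : Fin (j + 1) → O.nMinus (j + 2))
    (ξ : Fin (j + 1) → O.nPlus (j + 2)) :
    Module.Dual ℂ (Matrix (Fin n) (Fin n) (Trunc k (k + 1))) :=
  pairing (0 : Fin (k + 1) → ℂ) (j + 2) (polarForm (0 : Fin (k + 1) → ℂ) fun i => (ξ i).1) ∘ₗ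
    LinearMap.mulRight ℂ (unipotentGL O 0 (j + 2) x)⁻¹.1 ∘ₗ
      LinearMap.mulLeft ℂ (unipotentGL O 0 (j + 2) x).1 ∘ₗ O.negPart (j + 2) ∘ₗ
        (proj (0 : Fin (k + 1) → ℂ) (j + 2)).mapMatrix.toLinearMap

lemma cotangentFunctional_apply {j : ℕ} (x : Fin (j + 1) → O.nMinus (j + 2))
    (ξ : Fin (j + 1) → O.nPlus (j + 2)) (V : Matrix (Fin n) (Fin n) (Trunc k (k + 1))) :
    cotangentFunctional O j x ξ V = pairing (0 : Fin (k + 1) → ℂ) (j + 2)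
      (polarForm (0 : Fin (k + 1) → ℂ) fun i => (ξ i).1) ((unipotentGL O 0 (j + 2) x).1 *
        mask (O.flag j).low ((proj (0 : Fin (k + 1) → ℂ) (j + 2)).mapMatrix V) *
          (unipotentGL O 0 (j + 2) x)⁻¹.1) := by
  rw [flag_low]; rfl

lemma cotangentFunctional_mask {j : ℕ} (x : Fin (j + 1) → O.nMinus (j + 2))
    (ξ : Fin (j + 1) → O.nPlus (j + 2)) (V : Matrix (Fin n) (Fin n) (Trunc k (k + 1))) :
    cotangentFunctional O j x ξ (mask (O.flag j).low V) = cotangentFunctional O j x ξ V := by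
  rw [cotangentFunctional_apply, cotangentFunctional_apply, mapMatrix_mask,
    (suppOn_mask _ _).mask_eq]

/-- Conjugation by the unipotent factor cancels the one built into the right trivialization and
leaves the bare residue pairing. -/
lemma cotangentFunctional_conj {j : ℕ} (hj : j + 2 ≤ k) (x : Fin (j + 1) → O.nMinus (j + 2))
    (ξ : Fin (j + 1) → O.nPlus (j + 2)) {W : Matrix (Fin n) (Fin n) (Trunc k (k + 1))}
    (hW : SuppOn (O.flag j).low W) :
    cotangentFunctional O j x ξ ((O.incl x).1⁻¹.1 * (W * (O.incl x).1.1)) =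
      pairing (0 : Fin (k + 1) → ℂ) (j + 2) (polarForm (0 : Fin (k + 1) → ℂ) fun i => (ξ i).1)
        ((proj (0 : Fin (k + 1) → ℂ) (j + 2)).mapMatrix W) := by
  rw [cotangentFunctional_apply,
    (((incl_isUni O hj x).conj_low hW).mapMatrix _).mask_eq,
    map_mul (proj (0 : Fin (k + 1) → ℂ) (j + 2)).mapMatrix,
    map_mul (proj (0 : Fin (k + 1) → ℂ) (j + 2)).mapMatrix,
    proj_incl O hj, proj_incl_inv O hj, Units.mul_inv_cancel_left, mul_assoc, Units.mul_inv, mul_one]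

lemma pairing_proj {j : ℕ} (hj : j + 2 ≤ k) (ξ : Fin (j + 1) → Matrix (Fin n) (Fin n) ℂ) (i : ℕ)
    (w : Matrix (Fin n) (Fin n) ℂ) :
    pairing (0 : Fin (k + 1) → ℂ) (j + 2) (polarForm (0 : Fin (k + 1) → ℂ) ξ)
      ((proj (0 : Fin (k + 1) → ℂ) (j + 2)).mapMatrix
        (zed k (k + 1) • zed k (k + 1) ^ i • const _ w)) =
      if h : i < j + 1 then (ξ ⟨i, h⟩ * w).trace else 0 := by
  have hc : ∀ i' : Fin (j + 1), ((proj (0 : Fin (k + 1) → ℂ) (j + 2)).mapMatrix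
        (zed k (k + 1) • zed k (k + 1) ^ i • const _ w)).map (coef 0 (j + 2) (i' + 1)) =
      if (i' : ℕ) = i then w else 0 := by
    intro i'
    rw [smul_smul, ← pow_succ', mapMatrix_smul, map_pow, proj_zed, mapMatrix_const]
    ext a b
    rw [Matrix.map_apply, Matrix.smul_apply, smul_eq_mul, coef_zed_pow_mul (by omega) (by omega),
      const_apply, coef_algebraMap (by omega) (by omega)]
    split_ifs <;> first | rfl | omega
  rw [pairing_polarForm (by omega)]
  simp only [hc]
  split_ifs with h
  · rw [Finset.sum_eq_single ⟨i, h⟩]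
    · rw [if_pos rfl]
    · intro i' _ hi'
      rw [if_neg fun h' => hi' (Fin.ext h'), mul_zero, Matrix.trace_zero]
    · intro h; exact absurd (Finset.mem_univ _) h
  · refine Finset.sum_eq_zero fun i' _ => ?_
    rw [if_neg (by omega), mul_zero, Matrix.trace_zero]

/-- The forms `X_l` have no simple pole. -/
lemma pairing_const {j : ℕ} (hj : j + 2 ≤ k) (ξ : Fin (j + 1) → Matrix (Fin n) (Fin n) ℂ)
    (w : Matrix (Fin n) (Fin n) ℂ) :
    pairing (0 : Fin (k + 1) → ℂ) (j + 2) (polarForm (0 : Fin (k + 1) → ℂ) ξ) (const _ w) = 0 := by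
  rw [pairing_polarForm (by omega)]
  refine Finset.sum_eq_zero fun i _ => ?_
  have : (const (Trunc k (j + 2)) w).map (coef 0 (j + 2) (i + 1)) = 0 := by
    ext a b
    rw [Matrix.map_apply, const_apply, coef_algebraMap (by omega) (by omega), if_neg (by omega)]
    rfl
  rw [this, mul_zero, Matrix.trace_zero]

lemma cotangentFunctional_pow {j : ℕ} (hj : j + 2 ≤ k) (x : Fin (j + 1) → O.nMinus (j + 2))
    (ξ : Fin (j + 1) → O.nPlus (j + 2)) (V : Matrix (Fin n) (Fin n) (Trunc k (k + 1))) :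
    cotangentFunctional O j x ξ (zed k (k + 1) • zed k (k + 1) ^ (j + 1) • V) = 0 := by
  rw [cotangentFunctional_apply, smul_smul, ← pow_succ', mapMatrix_smul, map_pow, proj_zed,
    zed_pow_eq_zero (by omega) le_rfl, zero_smul, map_zero, mul_zero, zero_mul, map_zero]

/-- Conjugating `n⁻¹ Y n - Y` back gives `Y - n Y n⁻¹`, whose constant term `Y` is not seen by
`X_l`. The right side is minus the summand of level `j + 2` of the deformed residue. -/
lemma cotangentFunctional_conj_sub {j : ℕ} (hj : j + 2 ≤ k) (x : Fin (j + 1) → O.nMinus (j + 2))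
    (ξ : Fin (j + 1) → O.nPlus (j + 2)) {Y : Matrix (Fin n) (Fin n) ℂ}
    (hY : SuppOn (O.flag j).diag Y) :
    cotangentFunctional O j x ξ ((O.incl x).1⁻¹.1 * (const _ Y * (O.incl x).1.1) - const _ Y) =
      -pairing (0 : Fin (k + 1) → ℂ) (j + 2) (polarForm (0 : Fin (k + 1) → ℂ) fun i => (ξ i).1)
        ((unipotentGL O 0 (j + 2) x).1 * (const _ Y * (unipotentGL O 0 (j + 2) x)⁻¹.1)) := by
  rw [cotangentFunctional_apply,
    (((incl_isUni O hj x).conj_diag hY.const).mapMatrix _).mask_eq,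
    map_sub (proj (0 : Fin (k + 1) → ℂ) (j + 2)).mapMatrix,
    map_mul (proj (0 : Fin (k + 1) → ℂ) (j + 2)).mapMatrix,
    map_mul (proj (0 : Fin (k + 1) → ℂ) (j + 2)).mapMatrix, proj_incl O hj, proj_incl_inv O hj, mapMatrix_const, mul_sub, sub_mul, map_sub,
    Units.mul_inv_cancel_left, mul_assoc, Units.mul_inv, mul_one, pairing_const hj, zero_sub,
    mul_assoc]

/-- The strictly triangular functional of a cotangent vector on `𝔤𝔩_n(ℂ[z]_k)^1`. -/
def shiftedCotangent (j : ℕ) (x : Fin (j + 1) → O.nMinus (j + 2))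
    (ξ : Fin (j + 1) → O.nPlus (j + 2)) :
    Module.Dual ℂ (Matrix (Fin n) (Fin n) (Trunc k (k + 1))) :=
  shift (cotangentFunctional O j x ξ ∘ₗ (gl1 n k).subtype)

lemma shiftedCotangent_apply {j : ℕ} (x : Fin (j + 1) → O.nMinus (j + 2))
    (ξ : Fin (j + 1) → O.nPlus (j + 2)) (V : Matrix (Fin n) (Fin n) (Trunc k (k + 1))) :
    shiftedCotangent O j x ξ V = cotangentFunctional O j x ξ (zed k (k + 1) • V) := by
  change cotangentFunctional O j x ξ (zmul n k V).1 = _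
  rw [zmul_coe]

lemma shiftedCotangent_mask {j : ℕ} (x : Fin (j + 1) → O.nMinus (j + 2))
    (ξ : Fin (j + 1) → O.nPlus (j + 2)) (V : Matrix (Fin n) (Fin n) (Trunc k (k + 1))) :
    shiftedCotangent O j x ξ (mask (O.flag j).low V) = shiftedCotangent O j x ξ V := by
  rw [shiftedCotangent_apply, shiftedCotangent_apply, ← map_smul, cotangentFunctional_mask]

lemma shiftedCotangent_pow {j : ℕ} (hj : j + 2 ≤ k) (x : Fin (j + 1) → O.nMinus (j + 2))
    (ξ : Fin (j + 1) → O.nPlus (j + 2)) (V : Matrix (Fin n) (Fin n) (Trunc k (k + 1))) :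
    shiftedCotangent O j x ξ (zed k (k + 1) ^ (j + 1) • V) = 0 := by
  rw [shiftedCotangent_apply, cotangentFunctional_pow O hj]

/-- The factor `z` of `shift` matches the index shift of `X_l`, so the coordinates `ξ i` are read
off against `z^i`. -/
lemma shiftedCotangent_conj {j : ℕ} (hj : j + 2 ≤ k) (x : Fin (j + 1) → O.nMinus (j + 2))
    (ξ : Fin (j + 1) → O.nPlus (j + 2)) {w : Matrix (Fin n) (Fin n) ℂ}
    (hw : SuppOn (O.flag j).low w) (i : ℕ) :
    shiftedCotangent O j x ξ
      ((O.incl x).1⁻¹.1 * ((zed k (k + 1) ^ i • const _ w) * (O.incl x).1.1)) =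
      if h : i < j + 1 then ((ξ ⟨i, h⟩).1 * w).trace else 0 := by
  rw [shiftedCotangent_apply, ← mul_smul_comm, ← smul_mul_assoc,
    cotangentFunctional_conj O hj x ξ ((hw.const.smul _).smul _), pairing_proj hj]

lemma shiftedCotangent_injective {j : ℕ} (hj : j + 2 ≤ k) (x : Fin (j + 1) → O.nMinus (j + 2))
    {ξ ξ' : Fin (j + 1) → O.nPlus (j + 2)}
    (h : shiftedCotangent O j x ξ = shiftedCotangent O j x ξ') : ξ = ξ' := by
  funext i
  apply Subtype.ext
  ext b a
  by_cases hab : (O.flag j).low a b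
  · have hw : SuppOn (O.flag j).low (Matrix.single a b (1 : ℂ)) := by
      intro c d hcd
      rw [Matrix.single_apply_of_ne]
      rintro ⟨rfl, rfl⟩
      exact hcd hab
    have e1 := shiftedCotangent_conj O hj x ξ hw i
    rw [h, shiftedCotangent_conj O hj x ξ' hw i, dif_pos i.2, dif_pos i.2,
      Matrix.trace_mul_comm, Matrix.trace_single_mul, Matrix.trace_mul_comm,
      Matrix.trace_single_mul] at e1
    simpa using e1.symm
  · rw [flag_low] at hab
    rw [(ξ i).2 b a hab, (ξ' i).2 b a hab]

/-- After conjugation by the unipotent factor, the coordinates are the values on `z^i` times matrix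
units for `i ≤ j`. The two hypotheses say that there is nothing else to match. -/
lemma exists_shiftedCotangent {j : ℕ} (hj : j + 2 ≤ k) (x : Fin (j + 1) → O.nMinus (j + 2))
    {β : Module.Dual ℂ (Matrix (Fin n) (Fin n) (Trunc k (k + 1)))}
    (hβ : ∀ V, β (mask (O.flag j).low V) = β V)
    (hβ0 : ∀ V, β (zed k (k + 1) ^ (j + 1) • V) = 0) :
    ∃ ξ : Fin (j + 1) → O.nPlus (j + 2), shiftedCotangent O j x ξ = β := by
  let u := (O.incl x).1
  have hu : (O.flag j).IsUni u := incl_isUni O hj x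
  let ψ : ℕ → Module.Dual ℂ (Matrix (Fin n) (Fin n) ℂ) := fun i =>
    Unfolding.coAd u β ∘ₗ
      LinearMap.mulLeft ℂ (zed k (k + 1) ^ i • (1 : Matrix (Fin n) (Fin n) (Trunc k (k + 1)))) ∘ₗ
        (const (Trunc k (k + 1))).toLinearMap
  have hψ : ∀ i w, ψ i w = Unfolding.coAd u β (zed k (k + 1) ^ i • const _ w) := by
    intro i w
    simp only [ψ, LinearMap.comp_apply, LinearMap.mulLeft_apply, AlgHom.toLinearMap_apply,
      smul_mul_assoc, one_mul]
  let ξ : Fin (j + 1) → O.nPlus (j + 2) := fun i =>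
    ⟨mask (fun b a => (O.flag j).low a b) (Matrix.of fun b a => ψ i (Matrix.single a b 1)),
      fun b a hab => mask_apply_of_not _ (by rwa [flag_low])⟩
  have hξ : ∀ (i : Fin (j + 1)) w, SuppOn (O.flag j).low w → ((ξ i).1 * w).trace = ψ i w := by
    intro i w hw
    change Matrix.traceLinearMap (Fin n) ℂ ℂ (LinearMap.mulLeft ℂ (ξ i).1 w) = _
    rw [Matrix.matrix_eq_sum_single w]
    simp only [map_sum]
    refine Finset.sum_congr rfl fun a _ => Finset.sum_congr rfl fun b _ => ?_
    have hsm : Matrix.single a b (w a b) = w a b • Matrix.single a b (1 : ℂ) := by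
      rw [Matrix.smul_single, smul_eq_mul, mul_one]
    rw [hsm, map_smul, map_smul, map_smul]
    by_cases hab : (O.flag j).low a b
    · congr 1
      rw [LinearMap.mulLeft_apply, Matrix.traceLinearMap_apply, Matrix.trace_mul_comm,
        Matrix.trace_single_mul, one_smul]
      exact mask_apply_of _ hab
    · rw [hw a b hab, zero_smul, zero_smul]
  refine ⟨ξ, ?_⟩
  suffices key : ∀ W, SuppOn (O.flag j).low W →
      Unfolding.coAd u (shiftedCotangent O j x ξ) W = Unfolding.coAd u β W by
    ext1 V
    rw [← shiftedCotangent_mask, ← hβ V]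
    have hV := hu.inv.conj_low (suppOn_mask (O.flag j).low V)
    have := key _ hV
    rw [coAd_apply, coAd_apply, inv_inv, mul_assoc, mul_assoc, Units.inv_mul_cancel_left,
      Units.inv_mul, mul_one] at this
    exact this
  intro W hW
  obtain ⟨w, W', hw, rfl⟩ := (isCoord_zed k k).expand_pow (j + 1) hW
  rw [map_add, map_add, map_sum, map_sum, coAd_apply u _ (_ • W'), coAd_apply u _ (_ • W'),
    smul_mul_assoc, mul_smul_comm, hβ0, shiftedCotangent_pow O hj]
  congr 1
  refine Finset.sum_congr rfl fun i hi => ?_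
  rw [coAd_apply, shiftedCotangent_conj O hj x ξ (hw i), dif_pos (Finset.mem_range.1 hi),
    hξ _ _ (hw i), hψ]

end Cotangent

/-! ## The central fibre and the orbit -/

lemma sum_lt_succ {m r : ℕ} (f : Fin m → ℂ) (h : r < m) :
    (∑ j : Fin m, if (j : ℕ) < r + 1 then f j else 0) =
      (∑ j : Fin m, if (j : ℕ) < r then f j else 0) + f ⟨r, h⟩ := by
  rw [← Finset.sum_ite_eq' Finset.univ (⟨r, h⟩ : Fin m) f |>.trans
    (if_pos (Finset.mem_univ _)), ← Finset.sum_add_distrib]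
  refine Finset.sum_congr rfl fun j _ => ?_
  simp only [Fin.ext_iff]
  split_ifs <;> first | omega | simp

section CentralFibre

variable {H : HTL n k} (O : H.BlockOrdering)

/-- The functionals obtained by adding the cotangent vectors one level at a time and conjugating. -/
def fibreFunctional (x : (j : Fin (k - 1)) → Fin (j + 1) → O.nMinus (j + 2))
    (ξ : (j : Fin (k - 1)) → Fin (j + 1) → O.nPlus (j + 2)) :
    ℕ → Module.Dual ℂ (Matrix (Fin n) (Fin n) (Trunc k (k + 1)))
  | 0 => shift H.irr
  | r + 1 => if h : r < k - 1 then
      coAd (O.incl (x ⟨r, h⟩)).1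
        (fibreFunctional x ξ r + shiftedCotangent O r (x ⟨r, h⟩) (ξ ⟨r, h⟩))
    else fibreFunctional x ξ r

variable {O}

lemma fibreFunctional_succ (x : (j : Fin (k - 1)) → Fin (j + 1) → O.nMinus (j + 2))
    (ξ : (j : Fin (k - 1)) → Fin (j + 1) → O.nPlus (j + 2)) {r : ℕ} (h : r < k - 1) :
    fibreFunctional O x ξ (r + 1) = coAd (O.incl (x ⟨r, h⟩)).1
      (fibreFunctional O x ξ r + shiftedCotangent O r (x ⟨r, h⟩) (ξ ⟨r, h⟩)) := dif_pos h

lemma fibreFunctional_congr {x x' : (j : Fin (k - 1)) → Fin (j + 1) → O.nMinus (j + 2)}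
    {ξ ξ' : (j : Fin (k - 1)) → Fin (j + 1) → O.nPlus (j + 2)} {r : ℕ} (hr : r ≤ k - 1)
    (hx : ∀ j : Fin (k - 1), (j : ℕ) < r → x j = x' j)
    (hξ : ∀ j : Fin (k - 1), (j : ℕ) < r → ξ j = ξ' j) :
    fibreFunctional O x ξ r = fibreFunctional O x' ξ' r := by
  induction r with
  | zero => rfl
  | succ r ih =>
    rw [fibreFunctional_succ x ξ hr, fibreFunctional_succ x' ξ' hr,
      ih (by omega) (fun j hj => hx j (by omega)) (fun j hj => hξ j (by omega)),
      hx ⟨r, hr⟩ (Nat.lt_succ_self r), hξ ⟨r, hr⟩ (Nat.lt_succ_self r)]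

lemma coAd_functional_smul (g : GL (Fin n) (Trunc k (k + 1)))
    (V : Matrix (Fin n) (Fin n) (Trunc k (k + 1))) :
    coAd g H.functional (zed k (k + 1) • V) = coAd g (shift H.irr) V := by
  rw [coAd_apply, coAd_apply, shift_irr, smul_mul_assoc, mul_smul_comm]

lemma coAd_functional_mask {l : ℕ} {g : GL (Fin n) (Trunc k (k + 1))}
    (hg : SuppOn (H.SameBlock l) g.1) (V : Matrix (Fin n) (Fin n) (Trunc k (k + 1))) :
    coAd g H.functional (mask (H.SameBlock l) V) = coAd g H.functional V := by
  have hE := H.sameBlock_equivalence l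
  rw [coAd_apply, coAd_apply, ← mask_mul_right hE hg, ← mask_mul_left hE (hg.inv hE),
    functional_mask]

/-- The partial functionals are conjugate to the irregular type, with the change of the residue. -/
lemma exists_fibreFunctional_eq (x : (j : Fin (k - 1)) → Fin (j + 1) → O.nMinus (j + 2))
    (ξ : (j : Fin (k - 1)) → Fin (j + 1) → O.nPlus (j + 2)) {r : ℕ} (hr : r ≤ k - 1) :
    ∃ g ∈ GL1 n k, SuppOn (H.SameBlock (r + 2)) g.1 ∧
      fibreFunctional O x ξ r = coAd g (shift H.irr) ∧ ∀ Y ∈ H.levi 1,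
        H.functional (const _ Y) - coAd g H.functional (const _ Y) =
          ∑ j : Fin (k - 1), if (j : ℕ) < r then
            pairing (0 : Fin (k + 1) → ℂ) (j + 2)
              (polarForm (0 : Fin (k + 1) → ℂ) fun i => (ξ j i).1)
              ((unipotentGL O 0 (j + 2) (x j)).1 *
                (const _ Y * (unipotentGL O 0 (j + 2) (x j))⁻¹.1)) else 0 := by
  induction r with
  | zero =>
    refine ⟨1, (GL1 n k).one_mem, SuppOn.one (H.sameBlock_equivalence _).refl, (coAd_one _).symm,
      fun Y _ => ?_⟩
    simp [coAd_one]
  | succ r ih =>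
    obtain ⟨g, hg, hgE, hfib, hres⟩ := ih (by omega)
    have hj : r + 2 ≤ k := by omega
    have hr' : r < k - 1 := hr
    set φ := fibreFunctional O x ξ r with hφdef
    have hφ : φ ∈ leviOrbit H (r + 2) := ⟨g, hg, hgE, hfib⟩
    have hG := leviOrbit_good O hj (leviOrbit_mono (Nat.le_succ (r + 2)) hφ)
    -- `φ` is block diagonal of level `r + 2`, so adding the strictly triangular cotangent vector
    -- amounts to a conjugation.
    obtain ⟨u, hu, hue, hcu⟩ := hG.exists_coAd_eq_add (isCoord_zed k k) (flag_separates O hj)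
      (β := shiftedCotangent O r (x ⟨r, hr'⟩) (ξ ⟨r, hr'⟩))
      (fun V => by rw [flag_diag O hj]; exact leviOrbit_mask hφ V)
      (shiftedCotangent_mask O _ _) (shiftedCotangent_pow O hj _ _)
    set N := O.incl (x ⟨r, hr'⟩)
    have hN : (O.flag r).IsUni N.1 := incl_isUni O hj _
    have hN1 := mem_GL1.1 N.2
    have hE := (O.flag r).equiv
    have hu1 : u ∈ GL1 n k := mem_GL1.2 hue
    refine ⟨N.1 * (u * g), (GL1 n k).mul_mem N.2 ((GL1 n k).mul_mem hu1 hg), ?_, ?_, fun Y hY => ?_⟩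
    · have huE : SuppOn (O.flag r).E u.1 := hu.supp
      refine hN.supp.mul (SuppOn.mul huE hgE (T := (O.flag r).E) ?_) fun a b c => hE.trans
      exact fun a b c h h' => hE.trans h (h'.mono (Nat.le_succ (r + 2)))
    · rw [fibreFunctional_succ x ξ hr', coAd_mul, coAd_mul, ← hfib, hcu]
    · have hYd : SuppOn (O.flag r).diag Y := by
        rw [flag_diag O hj]
        exact H.levi_mono (by omega) hY
      set Ψ := coAd g H.functional with hΨ
      have hΨd : ∀ V, Ψ (mask (O.flag r).diag V) = Ψ V := fun V => by
        rw [flag_diag O hj]; exact coAd_functional_mask hgE V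
      -- The conjugate of `Y` splits as `Y + X`. Since `X` vanishes at the origin, its value is
      -- determined by the irregular type, which the recursion controls; the value at `Y` also
      -- involves `S_0 + N_0`.
      set X := N.1⁻¹.1 * (const _ Y * N.1.1) - const (Trunc k (k + 1)) Y with hX
      have hXlow : SuppOn (O.flag r).low X := hN.conj_diag hYd.const
      obtain ⟨X', -, eX⟩ := (isCoord_zed k k).expand_matrix hXlow
      have hX0 : (ev (0 : Fin (k + 1) → ℂ) k).mapMatrix X = 0 := by
        rw [hX, map_sub, map_mul, map_mul, hN1, mapMatrix_inv hN1, mapMatrix_const', mul_one,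
          one_mul, sub_self]
      rw [hX0, map_zero, zero_add] at eX
      have e1 : coAd u Ψ X = -pairing (0 : Fin (k + 1) → ℂ) (r + 2)
          (polarForm (0 : Fin (k + 1) → ℂ) fun i => (ξ ⟨r, hr'⟩ i).1)
            ((unipotentGL O 0 (r + 2) (x ⟨r, hr'⟩)).1 *
              (const _ Y * (unipotentGL O 0 (r + 2) (x ⟨r, hr'⟩))⁻¹.1)) := by
        rw [← cotangentFunctional_conj_sub O hj _ _ hYd]
        change _ = cotangentFunctional O r (x ⟨r, hr'⟩) (ξ ⟨r, hr'⟩) X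
        -- `X` is strictly triangular and `Ψ` block diagonal, so only the cotangent vector
        -- contributes on `X`.
        have e2 : Ψ X = 0 := by
          rw [← hΨd, hXlow.mask_eq_zero fun a b h h' => h'.2.ne h.2, map_zero]
        have e3 : φ X' = Ψ X := by
          rw [hfib, eX, hΨ, coAd_functional_smul]
        rw [eX, ← shiftedCotangent_apply, hΨ, ← coAd_mul, coAd_functional_smul, coAd_mul, ← hfib,
          hcu, LinearMap.add_apply, e3, e2, zero_add]
      -- Conjugation by `u` changes `Y` only in strictly upper positions, which `Ψ` does not see.
      have e4 : coAd u Ψ (const _ Y) = Ψ (const _ Y) := by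
        have h1 := hu.conj_diag (V := const _ Y) (by rw [Flag.op_diag]; exact hYd.const)
        rw [Flag.op_low] at h1
        rw [coAd_apply, ← sub_eq_zero, ← map_sub, ← hΨd,
          h1.mask_eq_zero fun a b h h' => h'.2.ne' h.2, map_zero]
      have e5 : coAd (N.1 * (u * g)) H.functional (const _ Y) =
          coAd u Ψ X + coAd u Ψ (const _ Y) := by
        rw [coAd_mul, coAd_mul, ← hΨ, coAd_apply N.1, ← map_add, hX, sub_add_cancel]
      rw [e5, e1, e4]
      have hsum := hres Y hY
      rw [sum_lt_succ _ hr', ← hsum]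
      ring

lemma fibreFunctional_mem (x : (j : Fin (k - 1)) → Fin (j + 1) → O.nMinus (j + 2))
    (ξ : (j : Fin (k - 1)) → Fin (j + 1) → O.nPlus (j + 2)) {r : ℕ} (hr : r ≤ k - 1) :
    fibreFunctional O x ξ r ∈ leviOrbit H (r + 2) := by
  obtain ⟨g, hg, hgE, h, -⟩ := exists_fibreFunctional_eq x ξ hr
  exact ⟨g, hg, hgE, h⟩

/-- The data are peeled off from the top level. The last unipotent factor is the unique reduction;
the block diagonal part of the reduced functional is the previous functional, and the rest is the
cotangent vector. -/
lemma fibreFunctional_injective {x x' : (j : Fin (k - 1)) → Fin (j + 1) → O.nMinus (j + 2)}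
    {ξ ξ' : (j : Fin (k - 1)) → Fin (j + 1) → O.nPlus (j + 2)} {r : ℕ} (hr : r ≤ k - 1)
    (h : fibreFunctional O x ξ r = fibreFunctional O x' ξ' r) (j : Fin (k - 1)) (hj : (j : ℕ) < r) :
    x j = x' j ∧ ξ j = ξ' j := by
  induction r with
  | zero => omega
  | succ r ih =>
    have hr' : r < k - 1 := hr
    have hk : r + 2 ≤ k := by omega
    have hG := leviOrbit_good O hk (fibreFunctional_mem x ξ hr)
    have hupp : ∀ (x : (j : Fin (k - 1)) → Fin (j + 1) → O.nMinus (j + 2))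
        (ξ : (j : Fin (k - 1)) → Fin (j + 1) → O.nPlus (j + 2)) V, SuppOn (O.flag r).upp V →
        (fibreFunctional O x ξ r + shiftedCotangent O r (x ⟨r, hr'⟩) (ξ ⟨r, hr'⟩)) V = 0 := by
      intro x ξ V hV
      rw [LinearMap.add_apply, ← leviOrbit_mask (fibreFunctional_mem x ξ hr'.le), ← flag_diag O hk,
        ← shiftedCotangent_mask, hV.mask_eq_zero fun a b h h' => h'.2.ne' h.2,
        hV.mask_eq_zero fun a b h h' => lt_asymm h'.2 h.2, map_zero, map_zero, add_zero]
    have h1 := fibreFunctional_succ x ξ hr'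
    have h1' := fibreFunctional_succ x' ξ' hr'
    have hx : x ⟨r, hr'⟩ = x' ⟨r, hr'⟩ := by
      have := hG.reduction_unique (isCoord_zed k k) (flag_separates O hk)
        (fun i => suppOn_nMinus O (x ⟨r, hr'⟩ i)) (fun i => suppOn_nMinus O (x' ⟨r, hr'⟩ i))
        (incl_val O hk _) (incl_val O hk _)
        (by rw [h1, coAd_inv_coAd]; exact hupp x ξ) (by rw [h, h1', coAd_inv_coAd]; exact hupp x' ξ')
      funext i
      exact Subtype.ext (congrFun this i)
    rw [h1, h1', ← hx] at h
    have h2 := congrArg (coAd (O.incl (x ⟨r, hr'⟩)).1⁻¹) h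
    rw [coAd_inv_coAd, coAd_inv_coAd] at h2
    have hdiag : ∀ (x : (j : Fin (k - 1)) → Fin (j + 1) → O.nMinus (j + 2))
        (ξ ξ₁ : (j : Fin (k - 1)) → Fin (j + 1) → O.nPlus (j + 2)) y V,
        (fibreFunctional O x ξ r + shiftedCotangent O r y (ξ₁ ⟨r, hr'⟩))
          (mask (O.flag r).diag V) = fibreFunctional O x ξ r V := by
      intro x ξ ξ₁ y V
      rw [LinearMap.add_apply, ← shiftedCotangent_mask,
        (suppOn_mask (O.flag r).diag V).mask_eq_zero fun a b h h' => h.2.ne h'.2, map_zero, add_zero,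
        flag_diag O hk, leviOrbit_mask (fibreFunctional_mem x ξ hr'.le)]
    have h3 : fibreFunctional O x ξ r = fibreFunctional O x' ξ' r := by
      ext1 V
      rw [← hdiag x ξ ξ (x ⟨r, hr'⟩), h2, hdiag]
    rw [h3] at h2
    have hξ := shiftedCotangent_injective O hk _ (add_left_cancel h2)
    rcases Nat.lt_succ_iff_lt_or_eq.1 hj with h4 | h4
    · exact ih hr'.le h3 h4
    · have : j = ⟨r, hr'⟩ := Fin.ext h4
      rw [this]
      exact ⟨hx, hξ⟩

lemma exists_fibreFunctional {r : ℕ} (hr : r ≤ k - 1)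
    {A : Module.Dual ℂ (Matrix (Fin n) (Fin n) (Trunc k (k + 1)))} (hA : A ∈ leviOrbit H (r + 2)) :
    ∃ (x : (j : Fin (k - 1)) → Fin (j + 1) → O.nMinus (j + 2))
      (ξ : (j : Fin (k - 1)) → Fin (j + 1) → O.nPlus (j + 2)), fibreFunctional O x ξ r = A := by
  induction r generalizing A with
  | zero =>
    rw [leviOrbit_two] at hA
    exact ⟨0, 0, hA.symm⟩
  | succ r ih =>
    have hr' : r < k - 1 := hr
    have hk : r + 2 ≤ k := by omega
    have hG := leviOrbit_good O hk hA
    obtain ⟨x₀, hx₀, hx₀'⟩ := hG.exists_reduction (isCoord_zed k k) (flag_separates O hk)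
    let y : Fin (r + 1) → O.nMinus (r + 2) := fun i =>
      ⟨x₀ i, by have := hx₀ i; rw [flag_low] at this; exact this⟩
    have hy := incl_isUni O hk y
    have hy1 := mem_GL1.1 (O.incl y).2
    have hGB := hG.coAd (isCoord_zed k k) hy.inv.supp (mapMatrix_inv hy1)
    obtain ⟨D, β, hDβ, hD, hβ, hβ0, u, hu, hue, hcu⟩ := hGB.exists_coAd_diag (isCoord_zed k k)
      (flag_separates O hk) (hx₀' _ (incl_val O hk y))
    obtain ⟨ζ, hζ⟩ := exists_shiftedCotangent O hk y hβ hβ0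
    -- `D` is conjugate to the irregular type under `G`, and both are block diagonal of level `r +
    -- 2`, so the conjugating matrix can be taken block diagonal.
    have hDorb : D ∈ leviOrbit H (r + 2) := by
      obtain ⟨g, hg, -, rfl⟩ := hA
      have e1 : D = coAd (u⁻¹ * ((O.incl y).1⁻¹ * g)) (shift H.irr) := by
        rw [coAd_mul, coAd_mul, ← hcu, coAd_inv_coAd]
      rw [flag_diag O hk] at hD
      obtain ⟨g', hg', hgE', h'⟩ := exists_coAd_eq_of_mask (H.sameBlock_equivalence (r + 2))
        isUnit_of_ev hD (shift_irr_mask H _) (g := u⁻¹ * ((O.incl y).1⁻¹ * g))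
        (mem_GL1.1 ((GL1 n k).mul_mem ((GL1 n k).inv_mem (mem_GL1.2 hue))
          ((GL1 n k).mul_mem ((GL1 n k).inv_mem (O.incl y).2) hg))) e1
      exact ⟨g', mem_GL1.2 hg', hgE', h'⟩
    obtain ⟨x, ξ, hxξ⟩ := ih hr'.le hDorb
    refine ⟨Function.update x ⟨r, hr'⟩ y, Function.update ξ ⟨r, hr'⟩ ζ, ?_⟩
    have hne : ∀ j : Fin (k - 1), (j : ℕ) < r → j ≠ ⟨r, hr'⟩ := fun j hj h =>
      hj.ne (congrArg Fin.val h)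
    rw [fibreFunctional_succ _ _ hr', Function.update_self, Function.update_self, hζ,
      fibreFunctional_congr hr'.le (fun j hj => Function.update_of_ne (hne j hj) _ _)
        (fun j hj => Function.update_of_ne (hne j hj) _ _), hxξ, ← hDβ, coAd_coAd_inv]

end CentralFibre

/-! ## The map from the central fibre to the orbit -/

/-! ### Products in descending order -/

section DescendingProduct

variable {G : Type*} [Monoid G]

/-- The product `f (m - 1) ⋯ f 0` over the indices that satisfy `P`. -/
def descProd (f : ℕ → G) (P : ℕ → Bool) (m : ℕ) : G :=
  (((List.range m).filter P).reverse.map f).prod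

lemma descProd_succ (f : ℕ → G) (P : ℕ → Bool) (m : ℕ) :
    descProd f P (m + 1) = (if P m then f m else 1) * descProd f P m := by
  rw [descProd, descProd, List.range_succ, List.filter_append, List.reverse_append]
  by_cases h : P m <;> simp [h]

lemma descProd_lt (f : ℕ → G) {j m : ℕ} (h : j ≤ m) :
    descProd f (fun i => decide (i < j)) m = descProd f (fun _ => true) j := by
  induction m with
  | zero => obtain rfl : j = 0 := by omega
            rfl
  | succ m ih =>
    rcases h.lt_or_eq with h' | rfl
    · rw [descProd_succ, if_neg (by simp; omega), one_mul, ih (by omega)]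
    · rw [descProd, descProd, List.filter_congr]
      intro i hi
      simpa using hi

lemma descProd_split (f : ℕ → G) {j m : ℕ} (h : j < m) :
    descProd f (fun _ => true) m =
      descProd f (fun i => decide (j < i)) m * f j * descProd f (fun _ => true) j := by
  induction m with
  | zero => omega
  | succ m ih =>
    rw [descProd_succ, if_pos rfl, descProd_succ]
    rcases Nat.lt_succ_iff_lt_or_eq.1 h with h' | rfl
    · rw [if_pos (by simpa using h'), ih h', mul_assoc, mul_assoc, mul_assoc]
    · rw [if_neg (by simp), one_mul]
      have : descProd f (fun i => decide (j < i)) j = 1 := by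
        rw [descProd, List.filter_eq_nil_iff.2]
        · rfl
        · intro i hi
          have := List.mem_range.1 hi
          simp; omega
      rw [this, one_mul]

lemma finRange_descProd {m : ℕ} (f : ℕ → G) (P : ℕ → Bool) :
    (((List.finRange m).filter fun i : Fin m => P (i : ℕ)).reverse.map fun i : Fin m => f (i : ℕ)).prod = descProd f P m := by
  rw [descProd, ← List.map_coe_finRange_eq_range, List.filter_map, ← List.map_reverse, List.map_map]
  rfl

end DescendingProduct

/-! ### Unrolling the recursion and computing the residue of the orbit -/

section Central

variable {H : HTL n k} {O : H.BlockOrdering}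

/-- The sequence of the unipotent factors, extended by `1`. -/
def factor (x : (j : Fin (k - 1)) → Fin (j + 1) → O.nMinus (j + 2)) (i : ℕ) : GL1 n k :=
  if h : i < k - 1 then O.incl (x ⟨i, h⟩) else 1

lemma factor_coe (x : (j : Fin (k - 1)) → Fin (j + 1) → O.nMinus (j + 2)) (j : Fin (k - 1)) :
    factor x j = O.incl (x j) := dif_pos j.2

lemma seg_eq (α : (j : Fin (k - 1)) → O.TstarN j) (P : ℕ → Bool) :
    O.seg α (fun i => P i) = descProd (factor fun j => (α j).1) P (k - 1) := by
  rw [← finRange_descProd]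
  simp only [factor_coe]
  rfl

/-- The product of the first `r` unipotent factors. -/
def partialProd (x : (j : Fin (k - 1)) → Fin (j + 1) → O.nMinus (j + 2)) (r : ℕ) : GL1 n k :=
  descProd (factor x) (fun _ => true) r

lemma partialProd_succ (x : (j : Fin (k - 1)) → Fin (j + 1) → O.nMinus (j + 2)) {r : ℕ}
    (h : r < k - 1) : partialProd x (r + 1) = O.incl (x ⟨r, h⟩) * partialProd x r := by
  rw [partialProd, descProd_succ, if_pos rfl, factor, dif_pos h]
  rfl

lemma coAd_mul_apply {A : Type} [CommRing A] [Algebra ℂ A] (g h : GL (Fin n) A)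
    (φ : Module.Dual ℂ (Matrix (Fin n) (Fin n) A)) (V : Matrix (Fin n) (Fin n) A) :
    coAd (g * h) φ V = coAd h φ ((g⁻¹).1 * (V * g.1)) := by
  rw [coAd_mul, coAd_apply]

/-- The cotangent vector of index `j` is conjugated by all the factors of index `j, ..., r - 1`, the
`j`-th included. -/
lemma fibreFunctional_apply (x : (j : Fin (k - 1)) → Fin (j + 1) → O.nMinus (j + 2))
    (ξ : (j : Fin (k - 1)) → Fin (j + 1) → O.nPlus (j + 2)) {r : ℕ} (hr : r ≤ k - 1)
    (V : Matrix (Fin n) (Fin n) (Trunc k (k + 1))) :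
    fibreFunctional O x ξ r V = coAd (partialProd x r).1 (shift H.irr) V +
      ∑ j : Fin (k - 1), if (j : ℕ) < r then
        coAd ((partialProd x r).1 * (partialProd x j).1⁻¹) (shiftedCotangent O j (x j) (ξ j)) V
      else 0 := by
  induction r generalizing V with
  | zero =>
    have : (partialProd x 0).1 = 1 := rfl
    rw [this, coAd_one]
    simp [fibreFunctional]
  | succ r ih =>
    have hr' : r < k - 1 := hr
    have hp : (partialProd x (r + 1)).1 = (O.incl (x ⟨r, hr'⟩)).1 * (partialProd x r).1 := by
      rw [partialProd_succ x hr']; rfl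
    rw [fibreFunctional_succ x ξ hr', sum_lt_succ _ hr', hp, mul_inv_cancel_right, coAd_apply,
      LinearMap.add_apply, ih hr'.le, add_assoc, coAd_mul_apply, coAd_apply _ (shiftedCotangent ..)]
    simp only [mul_assoc (O.incl (x ⟨r, hr'⟩)).1, coAd_mul_apply]

lemma dπN_coe {j : ℕ} (x : Fin (j + 1) → O.nMinus (j + 2)) (V : gl1 n k) :
    (O.dπN j x V).1 = (unipotentGL O 0 (j + 2) x).1 * O.negPart (j + 2)
      ((unipotentGL O 0 (j + 2) x)⁻¹.1 * (proj (0 : Fin (k + 1) → ℂ) (j + 2)).mapMatrix V.1) := rfl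

/-- Left translation by `n` cancels the inner `n⁻¹` of `dπN`. -/
lemma pull_rightTriv {j : ℕ} (hj : j + 2 ≤ k) (x : Fin (j + 1) → O.nMinus (j + 2))
    (ξ : Fin (j + 1) → O.nPlus (j + 2)) (W : gl1 n k) :
    O.pull (O.rightTriv j x ξ) (lmul (O.incl x).1.1 W) = cotangentFunctional O j x ξ W.1 := by
  have e1 : O.dπN j x (lmul (O.incl x).1.1 W) = (unipotentGL O 0 (j + 2) x).1 *
      O.negPart (j + 2) ((proj (0 : Fin (k + 1) → ℂ) (j + 2)).mapMatrix W.1) := by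
    rw [dπN_coe, lmul_coe, map_mul (proj (0 : Fin (k + 1) → ℂ) (j + 2)).mapMatrix, proj_incl O hj,
      Units.inv_mul_cancel_left]
  rw [HTL.BlockOrdering.pull, HTL.BlockOrdering.rightTriv, cotangentFunctional]
  simp only [LinearMap.comp_apply, LinearMap.mulLeft_apply, LinearMap.mulRight_apply,
    AlgHom.toLinearMap_apply, Submodule.subtype_apply, e1]

lemma shift_apply (φ : Module.Dual ℂ (gl1 n k)) (V : Matrix (Fin n) (Fin n) (Trunc k (k + 1))) :
    shift φ V = φ (zmul n k V) := rfl

lemma nu_bigF_apply (α : (j : Fin (k - 1)) → O.TstarN j) (W : gl1 n k) :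
    nu (O.bigF α) W =
      coAd1 (O.seg α fun _ => true).1 H.irr W +
        ∑ j, O.pull (α j) (lmul (O.seg α fun i => j < i)⁻¹.1.1
          (rmul (O.seg α fun i => i < j)⁻¹.1.1 (rmul (O.seg α fun _ => true).1.1 W))) := by
  rw [nu, HTL.BlockOrdering.bigF, LinearMap.comp_apply, LinearMap.add_apply, LinearMap.sum_apply]
  rfl

lemma lmul_rmul_zmul (N p q : GL1 n k) (V : Matrix (Fin n) (Fin n) (Trunc k (k + 1))) :
    lmul (N * (p * q⁻¹)).1.1 (rmul p⁻¹.1.1 (rmul q.1.1 (zmul n k V))) =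
      lmul N.1.1 (zmul n k ((q.1 * p.1⁻¹)⁻¹.1 * (V * (q.1 * p.1⁻¹).1))) := by
  apply Subtype.ext
  simp only [lmul_coe, rmul_coe, zmul_coe, Subgroup.coe_mul, Subgroup.coe_inv, Units.val_mul,
    mul_inv_rev, inv_inv, mul_assoc, smul_mul_assoc, mul_smul_comm]

lemma shift_nu_bigF (x : (j : Fin (k - 1)) → Fin (j + 1) → O.nMinus (j + 2))
    (ξ : (j : Fin (k - 1)) → Fin (j + 1) → O.nPlus (j + 2)) :
    shift (nu (O.bigF fun j => O.rightTriv j (x j) (ξ j))) = fibreFunctional O x ξ (k - 1) := by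
  set α : (j : Fin (k - 1)) → O.TstarN j := fun j => O.rightTriv j (x j) (ξ j) with hα
  have hx : (factor fun j => (α j).1) = factor x := rfl
  have hq : O.seg α (fun _ => true) = partialProd x (k - 1) := seg_eq α fun _ => true
  have hlt : ∀ j : Fin (k - 1), O.seg α (fun i => i < j) = partialProd x j := fun j => by
    rw [partialProd, ← hx, ← descProd_lt _ j.2.le, ← seg_eq]
    rfl
  -- The total product is `θ^{[l+1;k]} n_l θ^{[2;l-1]}`; the factor `n_l` left in front is the one
  -- that `pull_rightTriv` absorbs.
  have hgt : ∀ j : Fin (k - 1), (O.seg α (fun i => j < i))⁻¹ =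
      O.incl (x j) * (partialProd x j * (partialProd x (k - 1))⁻¹) := fun j => by
    have h1 : O.seg α (fun i => j < i) = descProd (factor x) (fun i => decide ((j : ℕ) < i)) (k - 1) :=
      seg_eq α fun i => decide ((j : ℕ) < i)
    have h2 := descProd_split (factor x) j.2
    rw [factor_coe, ← h1] at h2
    change partialProd x (k - 1) = _ * _ * partialProd x j at h2
    rw [h2]
    group
  ext1 V
  rw [fibreFunctional_apply x ξ le_rfl]
  rw [shift_apply, nu_bigF_apply, hq, ← shift_coAd1, shift_apply]
  congr 1
  · refine Finset.sum_congr rfl fun j _ => ?_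
    rw [if_pos j.2, hlt]
    set q := partialProd x (k - 1)
    set p := partialProd x j
    have e1 : lmul (O.seg α (fun i => j < i))⁻¹.1.1 (rmul p⁻¹.1.1 (rmul q.1.1 (zmul n k V))) =
        lmul (O.incl (x j)).1.1 (zmul n k ((q.1 * p.1⁻¹)⁻¹.1 * (V * (q.1 * p.1⁻¹).1))) := by
      rw [hgt]
      exact lmul_rmul_zmul _ _ _ V
    rw [e1, pull_rightTriv (index_le j), zmul_coe, coAd_apply, shiftedCotangent_apply]

/-- Any point of `μ⁻¹(H_irr)` above `A` computes the residue, and at `g` the differential of `π_1`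
sends `g Y` to `g Y - Y g`. The difference `Y - g⁻¹ Y g` vanishes at the origin, so the right side
depends only on the irregular type. -/
lemma orbitResidue_coAd1 (H : HTL n k) {g : GL (Fin n) (Trunc k (k + 1))} (hg : g ∈ GL1 n k)
    (A : H.orbit) (hA : A.1 = coAd1 g H.irr) (Y : H.lieStabilizer) :
    orbitResidue H A Y = H.functional (const _ Y.1) - coAd g H.functional (const _ Y.1) := by
  let α : TstarGL1 n k := (⟨g, hg⟩, H.irr ∘ₗ lmul (g⁻¹).1)
  have hμ : mu α = H.irr := by
    refine LinearMap.ext fun V => congrArg H.irr (Subtype.ext ?_)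
    rw [lmul_coe, lmul_coe, Units.inv_mul_cancel_left]
  have hν : nu α = A.1 := hA.symm
  have h1 := orbitResidue_nu H α hμ (hν ▸ A.2)
  have h2 : (⟨nu α, hν ▸ A.2⟩ : H.orbit) = A := Subtype.ext hν
  rw [h2] at h1
  rw [h1]
  have h3 : (dπ₁ ⟨g, hg⟩ (g.1 * const _ Y.1)).1 = g.1 * const _ Y.1 - const _ Y.1 * g.1 := by
    rw [dπ₁, LinearMap.codRestrict_apply]
    simp only [LinearMap.sub_apply, LinearMap.id_apply, LinearMap.comp_apply,
      AlgHom.toLinearMap_apply, LinearMap.mulRight_apply]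
    rw [map_mul (ev (0 : Fin (k + 1) → ℂ) k).mapMatrix, mem_GL1.1 hg, one_mul, mapMatrix_const']
  have h4 : mu0 H α Y = H.functional ((g⁻¹).1 * (dπ₁ ⟨g, hg⟩ (g.1 * const _ Y.1)).1) := rfl
  rw [h4, h3, coAd_apply, mul_sub, Units.inv_mul_cancel_left, map_sub]

end Central

/-! ## Equivariance of the residue map -/

/-- Taking remainders modulo a monic polynomial is linear over `ℂ`, though not multiplicative. -/
lemma lift_const_mul (c : Fin (k + 1) → ℂ) (l : ℕ) (v : Matrix (Fin n) (Fin n) ℂ)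
    (Z : Matrix (Fin n) (Fin n) (Zhat c l)) :
    lift c l (const (Zhat c l) v * Z) = const ℂ[X] v * lift c l Z := by
  ext1 a b
  change AdjoinRoot.modByMonicHom (newton_monic c l) ((const (Zhat c l) v * Z) a b) = _
  rw [Matrix.mul_apply, Matrix.mul_apply, map_sum]
  refine Finset.sum_congr rfl fun i _ => ?_
  rw [const_apply, const_apply, ← Algebra.smul_def, ← Algebra.smul_def, map_smul]
  rfl

lemma lift_mul_const (c : Fin (k + 1) → ℂ) (l : ℕ) (v : Matrix (Fin n) (Fin n) ℂ)
    (Z : Matrix (Fin n) (Fin n) (Zhat c l)) :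
    lift c l (Z * const (Zhat c l) v) = lift c l Z * const ℂ[X] v := by
  ext1 a b
  change AdjoinRoot.modByMonicHom (newton_monic c l) ((Z * const (Zhat c l) v) a b) = _
  rw [Matrix.mul_apply, Matrix.mul_apply, map_sum]
  refine Finset.sum_congr rfl fun i _ => ?_
  rw [const_apply, const_apply, mul_comm, mul_comm (lift c l Z a i), ← Algebra.smul_def,
    ← Algebra.smul_def, map_smul]
  rfl

lemma pairing_apply (c : Fin (k + 1) → ℂ) (l : ℕ) (W : Matrix (Fin n) (Fin n) (RatFunc ℂ))
    (Z : Matrix (Fin n) (Fin n) (Zhat c l)) :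
    pairing c l W Z = -resInfty (((IsScalarTower.toAlgHom ℂ ℂ[X] (RatFunc ℂ)).mapMatrix
      (lift c l Z) * W).trace) := rfl

lemma pairing_conj (c : Fin (k + 1) → ℂ) (l : ℕ) (h h' : Matrix (Fin n) (Fin n) ℂ)
    (W : Matrix (Fin n) (Fin n) (RatFunc ℂ)) (Z : Matrix (Fin n) (Fin n) (Zhat c l)) :
    pairing c l (const _ h * W * const _ h') Z = pairing c l W (const _ h' * Z * const _ h) := by
  have hq : ∀ v : Matrix (Fin n) (Fin n) ℂ, (IsScalarTower.toAlgHom ℂ ℂ[X] (RatFunc ℂ)).mapMatrix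
      (const ℂ[X] v) = const (RatFunc ℂ) v := fun v => mapMatrix_const _ v
  rw [pairing_apply, pairing_apply, lift_mul_const, lift_const_mul, map_mul, map_mul, hq, hq,
    ← mul_assoc, Matrix.trace_mul_comm, mul_assoc, mul_assoc]

section Equivariance

variable {H : HTL n k} {O : H.BlockOrdering}

lemma smul_Xl (h : H.leviGroup 1) (p : Deformation O) (j : Fin (k - 1)) :
    (h • p).Xl j = const _ h.1.1 * p.Xl j * const _ (h.1⁻¹).1 := by
  rw [Deformation.Xl, Deformation.Xl, polarForm, polarForm, Matrix.mul_sum, Matrix.sum_mul]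
  refine Finset.sum_congr rfl fun i _ => ?_
  rw [mul_smul_comm, smul_mul_assoc]
  congr 1
  change const (RatFunc ℂ) (h.1.1 * (p.ξ j i).1 * (h.1⁻¹).1) = _
  rw [map_mul, map_mul]
  rfl

lemma smul_nl (h : H.leviGroup 1) (p : Deformation O) (j : Fin (k - 1)) :
    (h • p).nl j = constGL (Zhat p.θ (j + 2)) h.1 * p.nl j * (constGL (Zhat p.θ (j + 2)) h.1)⁻¹ := by
  apply Units.ext
  change unipotent p.θ (j + 2) (fun i => h.1.1 * (p.x j i).1 * (h.1⁻¹).1) =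
    const _ h.1.1 * unipotent p.θ (j + 2) (fun i => (p.x j i).1) * const _ (h.1⁻¹).1
  rw [unipotent, unipotent, mul_add, add_mul, mul_one, Matrix.mul_sum, Matrix.sum_mul, ← map_mul,
    Units.mul_inv, map_one]
  congr 1
  refine Finset.sum_congr rfl fun i _ => ?_
  rw [mul_smul_comm, smul_mul_assoc, map_mul, map_mul]

lemma residue_apply (p : Deformation O) (Y : H.levi 1) :
    p.residue Y = ∑ j : Fin (k - 1), pairing p.θ (j + 2) (p.Xl j)
      ((p.nl j).1 * (const _ Y.1 * (p.nl j)⁻¹.1)) := by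
  rw [Deformation.residue, LinearMap.sum_apply]
  rfl

/-- All `n_l` and `X_l` are conjugated by the same constant matrix, which `pairing_conj` moves onto
`Y` by cyclicity of the trace. -/
lemma residue_smul (h : H.leviGroup 1) (p : Deformation O) :
    (h • p).residue = leviCoAd h p.residue := by
  refine LinearMap.ext fun Y => ?_
  change _ = p.residue ((⟨(h.1⁻¹).1, h.2.2⟩ : H.levi 1) * (Y * (⟨h.1.1, h.2.1⟩ : H.levi 1)))
  rw [residue_apply, residue_apply]
  refine Finset.sum_congr rfl fun j _ => ?_
  set c := constGL (Zhat p.θ (j + 2)) h.1 with hc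
  have h1 : const (Zhat p.θ (j + 2)) h.1.1 = c.1 := rfl
  have h2 : const (Zhat p.θ (j + 2)) (h.1⁻¹).1 = c⁻¹.1 := rfl
  let u : GL (Fin n) (Zhat p.θ (j + 2)) := (h • p).nl j
  have hu : u = c * p.nl j * c⁻¹ := smul_nl h p j
  calc _ = pairing p.θ (j + 2) ((h • p).Xl j) (u.1 * (const (Zhat p.θ (j + 2)) Y.1 * u⁻¹.1)) := rfl
    _ = pairing p.θ (j + 2) (p.Xl j) ((p.nl j).1 *
        (const (Zhat p.θ (j + 2)) ((h.1⁻¹).1 * (Y.1 * h.1.1)) * (p.nl j)⁻¹.1)) := ?_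
    _ = _ := rfl
  rw [smul_Xl, pairing_conj, hu, map_mul (const (Zhat p.θ (j + 2))),
    map_mul (const (Zhat p.θ (j + 2))), h1, h2]
  congr 1
  simp only [mul_inv_rev, inv_inv, Units.val_mul, mul_assoc, Units.inv_mul_cancel_left,
    Units.inv_mul, mul_one]

end Equivariance

/-! ### The bijection with the orbit and the equality of the residues -/

section Comparison

variable {H : HTL n k} {O : H.BlockOrdering}

/-- At the origin only the term `l = e` survives, with an empty product. -/
lemma zero_mem_domain (H : HTL n k) : (0 : Fin (k + 1) → ℂ) ∈ H.domain := by
  intro i a b e _ hie hne _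
  rw [Finset.sum_eq_single e]
  · simpa [sub_eq_zero] using hne
  · intro l hl hle
    rw [Finset.prod_eq_zero (i := e)]
    · rw [mul_zero]
    · exact Finset.mem_Ioc.2 ⟨lt_of_le_of_ne (Finset.mem_Icc.1 hl).2 hle, le_rfl⟩
    · simp
  · intro h
    exact absurd (Finset.mem_Icc.2 ⟨hie, le_rfl⟩) h

lemma shift_central (p : Deformation O) :
    shift p.central = fibreFunctional O p.x p.ξ (k - 1) := shift_nu_bigF p.x p.ξ

lemma central_mem_orbit (p : Deformation O) : p.central ∈ H.orbit := by
  -- With truncated subtraction the last level is `k + 1` for `k ≥ 1` and `2` for `k = 0`; in both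
  -- cases there is a single block.
  rw [← mem_leviOrbit_iff (l := k - 1 + 2) (by omega), shift_central]
  exact fibreFunctional_mem p.x p.ξ le_rfl

lemma central_bijOn : Set.BijOn Deformation.central {p : Deformation O | p.θ = 0} H.orbit := by
  refine ⟨fun p _ => central_mem_orbit p, fun p hp p' hp' h => ?_, fun A hA => ?_⟩
  · have h1 := congrArg shift h
    rw [shift_central, shift_central] at h1
    have h2 := fibreFunctional_injective le_rfl h1
    refine Deformation.ext (Subtype.ext (hp.trans hp'.symm)) ?_ ?_
    · funext j
      exact (h2 j j.2).1
    · funext j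
      exact (h2 j j.2).2
  · rw [← mem_leviOrbit_iff (l := k - 1 + 2) (by omega)] at hA
    obtain ⟨x, ξ, h⟩ := exists_fibreFunctional (O := O) le_rfl hA
    exact ⟨⟨⟨0, zero_mem_domain H⟩, x, ξ⟩, rfl, shift_injective ((shift_central _).trans h)⟩

lemma residue_eq_orbitResidue (p : Deformation O) (hθ : p.θ = 0) (hp : p.central ∈ H.orbit)
    (Y : Matrix (Fin n) (Fin n) ℂ) (hY : Y ∈ H.levi 1) (hY' : Y ∈ H.lieStabilizer) :
    p.residue ⟨Y, hY⟩ = orbitResidue H ⟨p.central, hp⟩ ⟨Y, hY'⟩ := by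
  obtain ⟨g, hg, -, h1, h2⟩ := exists_fibreFunctional_eq p.x p.ξ (le_refl (k - 1))
  rw [orbitResidue_coAd1 H hg ⟨p.central, hp⟩
    (shift_injective (by rw [shift_central, h1, shift_coAd1])), h2 Y hY, residue_apply]
  -- The rings that contain the entries of `n_l` depend on `c`, so `c` has to become a variable
  -- before it is replaced by `0`.
  obtain ⟨⟨c, hc⟩, x, ξ⟩ := p
  change c = 0 at hθ
  subst hθ
  refine Finset.sum_congr rfl fun j _ => ?_
  rw [if_pos j.2]
  rfl

end Comparison

end Unfolding

end

theorem mainTheorem6 {n k : ℕ} (H : Unfolding.HTL n k) (O : H.BlockOrdering) :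
    -- `L_{m_1} = GL_n(ℂ)_{H_irr}`, with Lie algebra `𝔩_{m_1} = 𝔤𝔩_n(ℂ)_{H_irr}`
    (H.leviGroup 1 = H.stabilizer ∧ Subalgebra.toSubmodule (H.levi 1) = H.lieStabilizer) ∧
    -- the deformed residue map is `L_{m_1}`-equivariant
    (∀ (h : H.leviGroup 1) (p : Unfolding.Deformation O),
      (h • p).residue = Unfolding.leviCoAd h p.residue) ∧
    -- the central fibre is identified with the orbit
    Set.BijOn Unfolding.Deformation.central
      {p : Unfolding.Deformation O | p.θ = 0} H.orbit ∧
    -- under this identification it restricts to the residue map of the orbit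
    (∀ p : Unfolding.Deformation O, p.θ = 0 → ∀ (hp : p.central ∈ H.orbit)
      (Y : Matrix (Fin n) (Fin n) ℂ) (hY : Y ∈ H.levi 1) (hY' : Y ∈ H.lieStabilizer),
      p.residue ⟨Y, hY⟩ = Unfolding.orbitResidue H ⟨p.central, hp⟩ ⟨Y, hY'⟩) :=
  ⟨⟨Unfolding.leviGroup_eq_stabilizer H, Unfolding.levi_eq_lieStabilizer H⟩,
    Unfolding.residue_smul, Unfolding.central_bijOn, Unfolding.residue_eq_orbitResidue⟩
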